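/- For every $n\ge1$ let $\mathcal C_n$ be a closed product-form network with $n$ queues and $m_n$ clients, with service rates $\mu_{k,n}(q)>0$ ($q\ge1$) and an irreducible stochastic routing matrix with invariant probability vector $\pi_n$. Its queue lengths satisfy, for $q_1+\dots+q_n=m_n$, $$P(Q_{1,n}=q_1,\dots,Q_{n,n}=q_n)=\frac1{Z_n}\prod_{k=1}^n\frac{\pi_{k,n}^{q_k}}{\mu_{k,n}(1)\cdots\mu_{k,n}(q_k)},$$ where $Z_n$ is the normalizing constant. For $\lambda_n>0$ let $X_{1,n},\dots,X_{n,n}$ be independent with $P(X_{k,n}=x)$ proportional to $(\lambda_n\pi_{k,n})^x/(\mu_{k,n}(1)\cdots\mu_{k,n}(x))$, $x\ge0$, where $\lambda_n$ is such that these laws exist with finite second moments and $\sum_kE X_{k,n}=m_n$. Put $m_{k,n}=EX_{k,n}$, $\sigma_{k,n}^2=\operatorname{Var}X_{k,n}$, $\beta^{(s)}_{k,n}=E|X_{k,n}-m_{k,n}|^s$ and $$\gamma_{k,n}^2=\sum_{j\ge0}\frac{P(X_{k,n}=2j)\,P(X_{k,n}=2j+1)}{P(X_{k,n}=2j)+P(X_{k,n}=2j+1)}$$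 (a summand whose denominator is $0$ counts as $0$). Let $0<\rho_n<1$, $\alpha_n=\rho_n/(1-\rho_n)$ and $\omega_n(\theta)=(1-\rho_n)/(1-\rho_ne^{i\theta})$. Let $F_n$ be a nonempty set of ("saturable") queues such that for $k\in F_n$ there are real numbers $\xi_{k,n}$ and differentiable functions $\psi_{k,n}$ of $\theta\in\mathbb R$ with $$E e^{i\theta(X_{k,n}-m_{k,n})}=e^{-im_{k,n}\theta}\,\omega_n(\theta)^{\xi_{k,n}}\,\psi_{k,n}(\theta)\qquad(\theta\in\mathbb R),$$ where $\sup_{n,\,k\in F_n,\,\theta}|\psi_{k,n}'(\theta)|<\infty$, and $1\le\xi_{k,n}<\xi_{\max}<\infty$ for a constant $\xi_{\max}$. Put $\xi_n=\sum_{k\in F_n}\xi_{k,n}$. Let $0<r\le1$, let the $X_{k,n}$ with $k\notin F_n$ have finite moments of order $2+r$, and put $\hat\sigma_n^2=\sum_{k\notin F_n}\sigma_{k,n}^2$, $\hat\beta_n=\sum_{k\notin F_n}\beta^{(2+r)}_{k,n}$, $\hat\gamma_n^2=\sum_{k\notin F_n}\gamma_{k,n}^2$ (with $\hat\sigma_n,\hat\gamma_n\ge0$).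 Suppose that $\xi_n$ is bounded, that $\hat\sigma_n>0$ for all large $n$, and that, as $n\to\infty$, $\hat\sigma_n/\alpha_n\to0$, $\hat\beta_n/\hat\sigma_n^{2+r}\to0$ and $\hat\sigma_n=O(\hat\gamma_n)$. Let $$\varepsilon_n=\Bigl(\frac{\hat\sigma_n}{\alpha_n}\Bigr)^2+\frac1{\alpha_n}+\frac{\hat\beta_n}{\hat\sigma_n^{2+r}}\Bigl(\frac{\hat\sigma_n}{\alpha_n}\Bigr)^{2+r}+\frac{\hat\beta_n}{\hat\sigma_n^{2+r}}\Bigl(\frac{\hat\sigma_n}{\alpha_n}\Bigr)^{\xi_n-1}$$ (where the last two terms are read as $0$ for the finitely many $n$ with $\hat\sigma_n=0$). Then the following hold, where the constants in $O(\cdot)$ do not depend on $n$, on the queue indices or on the $q_k$, but in (ii) may depend on $\ell$. (i) For all $q_1,\dots,q_n\ge0$ with $q_1+\dots+q_n=m_n$, $$P(Q_{1,n}=q_1,\dots,Q_{n,n}=q_n)=\frac{\alpha_n\Gamma(\xi_n)}{e^{-\xi_n}\xi_n^{\xi_n-1}}\prod_{k=1}^nP(X_{k,n}=q_k)\,[1+O(\varepsilon_n)].$$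 (ii) For every fixed $\ell$, every set $A$ of at most $\ell$ queues with $A\cap F_n=\emptyset$ and all $q_k\ge0$ ($k\in A$), $$P(Q_{k,n}=q_k\ \forall k\in A)=\prod_{k\in A}P(X_{k,n}=q_k)\Bigl[1+O(\varepsilon_n)+O\Bigl(\frac{\sum_{k\in A}(m_{k,n}-q_k)}{\alpha_n}\Bigr)\Bigr].$$ (iii) For every $j\notin F_n$, $$EQ_{j,n}=EX_{j,n}\Bigl[1+O(\varepsilon_n)+O\Bigl(\frac{\sigma_{j,n}^2+m_{j,n}^2}{m_{j,n}\alpha_n}\Bigr)\Bigr].$$ (iv) For every $j\in F_n$, $EQ_{j,n}=EX_{j,n}\,[1+O(\varepsilon_n)]$. -/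

import Mathlib

open Filter Topology Asymptotics

noncomputable section

/-- The data of a closed single-chain product-form network with `n` queues. -/
structure ClosedNetwork (n : ℕ) where
  /-- number `m` of clients circulating in the network -/
  clients : ℕ
  /-- `serviceRate k q` is the service rate of queue `k` when it holds `q ≥ 1` clients -/
  serviceRate : Fin n → ℕ → ℝ
  serviceRate_pos : ∀ k q, 0 < q → 0 < serviceRate k q
  /-- routing probabilities -/
  routing : Matrix (Fin n) (Fin n) ℝ
  routing_stochastic : routing ∈ Matrix.rowStochastic ℝ (Fin n)
  routing_irreducible : routing.IsIrreducible
  /-- invariant probability measure of the routing matrix -/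
  visit : Fin n → ℝ
  visit_nonneg : ∀ k, 0 ≤ visit k
  visit_invariant : Matrix.vecMul visit routing = visit
  visit_sum : ∑ k, visit k = 1

namespace ClosedNetwork

variable {n : ℕ}

/-- `μ_k(1) ⋯ μ_k(q)` -/
def rateProd (C : ClosedNetwork n) (k : Fin n) (q : ℕ) : ℝ :=
  ∏ i ∈ Finset.range q, C.serviceRate k (i + 1)

/-! ### The closed network at steady state -/

/-- The possible states `(q_1, …, q_n)` of the closed network: `q_1 + ⋯ + q_n = m`. -/
def states (C : ClosedNetwork n) : Finset (Fin n → ℕ) :=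
  Finset.piAntidiag Finset.univ C.clients

/-- The unnormalized product-form weight `∏_k π_k ^ q_k / (μ_k(1) ⋯ μ_k(q_k))`. -/
def weight (C : ClosedNetwork n) (q : Fin n → ℕ) : ℝ :=
  ∏ k, C.visit k ^ q k / C.rateProd k (q k)

/-- The normalizing constant `Z`. -/
def normConst (C : ClosedNetwork n) : ℝ :=
  ∑ q ∈ C.states, C.weight q

/-- The joint law `P(Q_1 = q_1, …, Q_n = q_n)` of the queue lengths of the closed network. -/
def closedProb (C : ClosedNetwork n) (q : Fin n → ℕ) : ℝ :=
  if ∑ k, q k = C.clients then C.weight q / C.normConst else 0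

/-- The marginal law `P(Q_k = q_k for all k ∈ A)` of the queues in `A`. -/
def closedMarginal (C : ClosedNetwork n) (A : Finset (Fin n)) (q : Fin n → ℕ) : ℝ :=
  ∑ s ∈ C.states with ∀ k ∈ A, s k = q k, C.closedProb s

/-- The mean queue length `E Q_j` in the closed network. -/
def closedMean (C : ClosedNetwork n) (j : Fin n) : ℝ :=
  ∑ s ∈ C.states, (s j : ℝ) * C.closedProb s

/-! ### The open network of independent queues, with arrival rates `lam * π_k` -/

/-- The term `(lam π_k) ^ x / (μ_k(1) ⋯ μ_k(x))` of the generating function of queue `k`. -/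
def openWeight (C : ClosedNetwork n) (lam : ℝ) (k : Fin n) (x : ℕ) : ℝ :=
  (lam * C.visit k) ^ x / C.rateProd k x

/-- The law `P(X_k = x)` of the `k`-th queue length in the open network; the normalization
`∑' y, C.openWeight lam k y` is the generating function `f_k` at `lam π_k`. -/
def openProb (C : ClosedNetwork n) (lam : ℝ) (k : Fin n) (x : ℕ) : ℝ :=
  C.openWeight lam k x / ∑' y, C.openWeight lam k y

/-- `X_k` has a well-defined law and a finite moment of order `s` (for `s > 0`). This is stated on
the unnormalized weights, so that it includes convergence of the normalization. -/
def HasMoment (C : ClosedNetwork n) (lam : ℝ) (k : Fin n) (s : ℝ) : Prop :=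
  Summable fun x : ℕ => (x : ℝ) ^ s * C.openWeight lam k x

/-- `m_k = E X_k` -/
def openMean (C : ClosedNetwork n) (lam : ℝ) (k : Fin n) : ℝ :=
  ∑' x : ℕ, (x : ℝ) * C.openProb lam k x

/-- `E |X_k - m_k| ^ s` -/
def absCentralMoment (C : ClosedNetwork n) (lam : ℝ) (s : ℝ) (k : Fin n) : ℝ :=
  ∑' x : ℕ, |(x : ℝ) - C.openMean lam k| ^ s * C.openProb lam k x

/-- The variance `σ_k ^ 2` of `X_k`. -/
def variance (C : ClosedNetwork n) (lam : ℝ) (k : Fin n) : ℝ :=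
  C.absCentralMoment lam 2 k

/-- `γ_k ^ 2 = ∑_j p_{2j} p_{2j+1} / (p_{2j} + p_{2j+1})` with `p_x = P(X_k = x)`. -/
def gammaSq (C : ClosedNetwork n) (lam : ℝ) (k : Fin n) : ℝ :=
  ∑' j : ℕ, C.openProb lam k (2 * j) * C.openProb lam k (2 * j + 1) /
    (C.openProb lam k (2 * j) + C.openProb lam k (2 * j + 1))

/-- The characteristic function `E exp(i θ (X_k - m_k))` of the centered queue length. -/
def centeredCharFun (C : ClosedNetwork n) (lam : ℝ) (k : Fin n) (θ : ℝ) : ℂ :=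
  ∑' x : ℕ, (C.openProb lam k x : ℂ) *
    Complex.exp (Complex.I * (((x : ℝ) - C.openMean lam k : ℝ) : ℂ) * (θ : ℂ))

/-! ### Quantities attached to the queues outside a set `F` of saturable queues -/

/-- `σ̂`, the standard deviation of the total length of the queues outside `F`. -/
def sigmaHat (C : ClosedNetwork n) (lam : ℝ) (F : Finset (Fin n)) : ℝ :=
  √(∑ k ∈ Fᶜ, C.variance lam k)

/-- `β̂^(s)`, the sum of the absolute central moments of order `s` of the queues outside `F`. -/
def betaHat (C : ClosedNetwork n) (lam : ℝ) (F : Finset (Fin n)) (s : ℝ) : ℝ :=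
  ∑ k ∈ Fᶜ, C.absCentralMoment lam s k

/-- `γ̂`, the square root of the sum of the `γ_k ^ 2` over the queues outside `F`. -/
def gammaHat (C : ClosedNetwork n) (lam : ℝ) (F : Finset (Fin n)) : ℝ :=
  √(∑ k ∈ Fᶜ, C.gammaSq lam k)

/-- The Lyapounov ratio `β̂^(2+r) / σ̂ ^ (2+r)` of the queues outside `F`. -/
def lyapHat (C : ClosedNetwork n) (lam : ℝ) (F : Finset (Fin n)) (r : ℝ) : ℝ :=
  C.betaHat lam F (2 + r) / C.sigmaHat lam F ^ (2 + r)

end ClosedNetwork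

/-- `α = ρ / (1 - ρ)` -/
def heavyScale (ρ : ℝ) : ℝ := ρ / (1 - ρ)

/-- `ω(θ) = (1 - ρ) / (1 - ρ e^{iθ})`; for `0 ≤ ρ < 1` its values have positive real part, so
that the principal branch of `ω ^ ξ` is the continuous one. -/
def heavyOmega (ρ θ : ℝ) : ℂ :=
  (1 - (ρ : ℂ)) / (1 - (ρ : ℂ) * Complex.exp (Complex.I * (θ : ℂ)))

/-- The queues of `F n` are saturable, uniformly in `n`, with exponents `ξ n k`: the
characteristic function of each of them is `e^{-i m θ} ω(θ)^ξ ψ(θ)` with `ψ' = O(1)`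
uniformly, and the exponents lie in `[1, ξ_max)`. -/
def SaturableQueues (C : ∀ n : ℕ+, ClosedNetwork n) (lam ρ : ℕ+ → ℝ)
    (F : ∀ n : ℕ+, Finset (Fin n)) (ξ : ∀ n : ℕ+, Fin n → ℝ) : Prop :=
  (∃ (ψ : ∀ n : ℕ+, Fin n → ℝ → ℂ) (K : ℝ), ∀ n, ∀ k ∈ F n,
    (∀ θ : ℝ, (C n).centeredCharFun (lam n) k θ =
      Complex.exp (-(Complex.I * ((C n).openMean (lam n) k : ℂ) * (θ : ℂ))) *
        heavyOmega (ρ n) θ ^ (ξ n k : ℂ) * ψ n k θ) ∧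
    Differentiable ℝ (ψ n k) ∧ ∀ θ : ℝ, ‖deriv (ψ n k) θ‖ ≤ K) ∧
  ∃ ξmax : ℝ, ∀ n, ∀ k ∈ F n, 1 ≤ ξ n k ∧ ξ n k < ξmax

/-- The error rate
`(σ̂/α)^2 + 1/α + L (σ̂/α)^(2+r) + L (σ̂/α)^(ξ-1)`, where `L` is the Lyapounov ratio. -/
def heavyError (α σ L r ξ : ℝ) : ℝ :=
  (σ / α) ^ 2 + 1 / α + L * (σ / α) ^ (2 + r) + L * (σ / α) ^ (ξ - 1)

end

/-! The product form makes the closed network the open one conditioned on its total: the joint law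
at `q` is `∏ P(X_k = q_k)` divided by `D = P(∑ X_k = m)`. Since the means sum to `m`, `D` is a local
probability at the mean. The numerators `P(X_k = q_k on A, ∑ X_k = m)` and `E(X_j; ∑ X_k = m)` of
(ii) and (iv) are, like `D`, coefficients of products of generating functions, hence Fourier
integrals over `[-π, π]`. Everything follows from a local limit theorem for such integrals with
relative error `O(ε)`.

Write `u = 1 - iαθ` (`linFactor`) and `Ξ` for the sum of the exponents over `F`. The saturable
queues contribute `ω^Ξ ∏ ψ_k`. Now `ω^s u^s` equals `1` at `0` and has derivative bounded uniformly
in `α` (`isTilt_omega_mul_linFactor`), so this contribution is `u^{-Ξ}`, the transform of a Gamma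
law of shape `Ξ` and scale `α`, times a factor `h` that varies only on the scale of `1`.
Differentiating at `0`, the means over `F` sum to `Ξα + O(1)`; the `O(1)` is a phase that is put
into `h`, and the Gamma density `g_Ξ` ends up evaluated at `Ξ`. The other queues contribute a
centred transform `φ` close to a Gaussian of standard deviation `τ`. The outcome is `D ≈ g_Ξ(Ξ) /
α`, whose inverse is the constant of (i).

The errors, relative to `1/α` and with `L` the Lyapounov ratio, are these (`exists_local_limit_le`).
Replacing `φ` by the Gaussian costs `L ((σ/α)^{Ξ-1} + (σ/α)^2)`. This uses a pairing bound that
makes each characteristic function at most `exp(-c γ_k² θ²)` on all of `[-π, π]`, together with `σ =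
O(γ)`. Replacing `h` by `1` costs `(σ/α)^{Ξ-1} / σ` if `Ξ ≤ 3/2`, by absolute values, and `1/α`
otherwise, by integrating by parts against `exp(-iyαθ)`. The `1/σ` is absorbed because
integer-valued variables satisfy `σ^{-r} ≤ 4L` (`IsSqLaw.variance_le`). Extending the integral to
the line costs no more than the first error. The full integral is `2π/α` times the mean of `g_Ξ`
under a Gaussian of standard deviation `τ/α`; the first-order Taylor term has mean zero, which
leaves `(τ/α)^2`.

For (ii) the evaluation point moves by `∑_A (m_k - q_k) / α` and `g_Ξ` is Lipschitz away from `0`.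
Summing (ii) over the values of one queue gives (iii). For (iv), the sequence `x P(X_j = x)` has as
transform `-i` times the derivative of that of `X_j`; its main part is `ξ_j α exp(iθ) ω^{ξ_j+1}
ψ_j`, so `Ξ` becomes `Ξ + 1`, and `g_{Ξ+1}(Ξ) = g_Ξ(Ξ)` exactly. All this holds for large `n`;
finitely many `n` are covered by crude bounds, because `ε_n ≥ 1/α_n > 0`. -/

/-! ### Single laws on `ℕ`: moments and characteristic functions. -/

/-- The pairing functional `∑_j p_{2j} p_{2j+1} / (p_{2j} + p_{2j+1})` of a law on `ℕ`. -/
noncomputable def pairSum (p : ℕ → ℝ) : ℝ :=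
  ∑' j : ℕ, p (2 * j) * p (2 * j + 1) / (p (2 * j) + p (2 * j + 1))

/-- `E |X - m| ^ s` for `X` of law `p`. -/
noncomputable def absMoment (p : ℕ → ℝ) (m s : ℝ) : ℝ := ∑' x : ℕ, |(x : ℝ) - m| ^ s * p x

/-- `E exp(i θ (X - m))` for `X` of law `p`. -/
noncomputable def centeredChar (p : ℕ → ℝ) (m θ : ℝ) : ℂ :=
  ∑' x : ℕ, (p x : ℂ) * Complex.exp (Complex.I * (((x : ℝ) - m : ℝ) : ℂ) * (θ : ℂ))

/-- `p` is a probability on `ℕ` with a finite second moment. -/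
structure IsSqLaw (p : ℕ → ℝ) : Prop where
  nonneg : ∀ x, 0 ≤ p x
  hasSum : HasSum p 1
  summable_sq : Summable fun x : ℕ => (x : ℝ) ^ 2 * p x

/-- Third-order Taylor for `|y| ≤ 1` and a term-by-term bound beyond; `|y|^3`, respectively `|y|^2`,
is then at most `|y|^(2+r)`. The endpoint `r = 0` is kept for the comparison of `ω` with `u⁻¹`. -/
theorem norm_exp_I_mul_sub_taylor_le {r : ℝ} (hr0 : 0 ≤ r) (hr1 : r ≤ 1) (y : ℝ) :
    ‖Complex.exp (Complex.I * y) - 1 - Complex.I * y + (y : ℂ) ^ 2 / 2‖ ≤ 4 * |y| ^ (2 + r) := by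
  rcases eq_or_ne y 0 with rfl | hy0
  · simp
    positivity
  have hy : 0 < |y| := abs_pos.2 hy0
  have hn : ‖Complex.I * (y : ℂ)‖ = |y| := by simp
  rcases le_or_gt |y| 1 with h1 | h1
  · have h := Complex.exp_bound (x := Complex.I * y) (by rw [hn]; exact h1) (n := 3) (by norm_num)
    have e : Complex.exp (Complex.I * y) - ∑ m ∈ Finset.range 3, (Complex.I * (y : ℂ)) ^ m /
        (m.factorial : ℂ) = Complex.exp (Complex.I * y) - 1 - Complex.I * y + (y : ℂ) ^ 2 / 2 := by
      simp [Finset.sum_range_succ, mul_pow, Nat.factorial]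
      ring
    rw [e, hn] at h
    refine h.trans ?_
    have h3 : |y| ^ 3 ≤ |y| ^ (2 + r) := by
      rw [← Real.rpow_natCast]
      exact Real.rpow_le_rpow_of_exponent_ge hy h1 (by push_cast; linarith)
    have h4 : (0 : ℝ) ≤ |y| ^ 3 := by positivity
    norm_num [Nat.factorial]
    nlinarith
  · have h2 : |y| ^ 2 ≤ |y| ^ (2 + r) := by
      rw [← Real.rpow_natCast]
      exact Real.rpow_le_rpow_of_exponent_le h1.le (by push_cast; linarith)
    have he : ‖Complex.exp (Complex.I * y)‖ = 1 := by
      rw [mul_comm]; exact Complex.norm_exp_ofReal_mul_I y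
    calc _ ≤ ‖Complex.exp (Complex.I * y)‖ + ‖(1 : ℂ)‖ + ‖Complex.I * (y : ℂ)‖
            + ‖(y : ℂ) ^ 2 / 2‖ :=
          (norm_add_le _ _).trans (add_le_add_left ((norm_sub_le _ _).trans
            (add_le_add_left (norm_sub_le _ _) _)) _)
      _ = 2 + |y| + |y| ^ 2 / 2 := by
          rw [he, hn]; simp; ring
      _ ≤ 4 * |y| ^ 2 := by nlinarith
      _ ≤ _ := by linarith

namespace IsSqLaw

variable {p : ℕ → ℝ} (hp : IsSqLaw p)
include hp

theorem summable_mul : Summable fun x : ℕ => (x : ℝ) * p x := by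
  refine Summable.of_nonneg_of_le (fun x => mul_nonneg x.cast_nonneg (hp.nonneg x)) (fun x => ?_)
    hp.summable_sq
  refine mul_le_mul_of_nonneg_right ?_ (hp.nonneg x)
  rcases Nat.eq_zero_or_pos x with rfl | hx
  · simp
  · have : (1 : ℝ) ≤ x := by exact_mod_cast hx
    nlinarith

theorem summable_poly (a b c : ℝ) :
    Summable fun x : ℕ => (a * (x : ℝ) ^ 2 + b * x + c) * p x := by
  have := ((hp.summable_sq.mul_left a).add (hp.summable_mul.mul_left b)).add
    (hp.hasSum.summable.mul_left c)
  refine this.congr fun x => ?_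
  ring

theorem summable_sub_sq (m : ℝ) : Summable fun x : ℕ => ((x : ℝ) - m) ^ 2 * p x :=
  (hp.summable_poly 1 (-2 * m) (m ^ 2)).congr fun x => by ring

theorem hasSum_sub {m : ℝ} (hm : ∑' x : ℕ, (x : ℝ) * p x = m) :
    HasSum (fun x : ℕ => ((x : ℝ) - m) * p x) 0 := by
  have h := hp.summable_mul.hasSum.sub (hp.hasSum.mul_left m)
  rw [hm] at h
  simpa [sub_mul] using h

omit hp in
theorem absMoment_two (m : ℝ) : absMoment p m 2 = ∑' x : ℕ, ((x : ℝ) - m) ^ 2 * p x := by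
  unfold absMoment
  simp

theorem absMoment_nonneg (m s : ℝ) : 0 ≤ absMoment p m s :=
  tsum_nonneg fun x => mul_nonneg (by positivity) (hp.nonneg x)

theorem summable_char (m θ : ℝ) : Summable fun x : ℕ =>
    (p x : ℂ) * Complex.exp (Complex.I * (((x : ℝ) - m : ℝ) : ℂ) * (θ : ℂ)) := by
  refine Summable.of_norm ?_
  refine hp.hasSum.summable.congr fun x => ?_
  rw [norm_mul, show Complex.I * (((x : ℝ) - m : ℝ) : ℂ) * (θ : ℂ) =
    ((((x : ℝ) - m) * θ : ℝ) : ℂ) * Complex.I by push_cast; ring,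
    Complex.norm_exp_ofReal_mul_I]
  simp [abs_of_nonneg (hp.nonneg x)]

theorem pair_summable : Summable fun j : ℕ => p (2 * j) + p (2 * j + 1) :=
  (hp.hasSum.summable.comp_injective (mul_right_injective₀ two_ne_zero)).add
    (hp.hasSum.summable.comp_injective
      ((add_left_injective 1).comp (mul_right_injective₀ two_ne_zero)))

omit hp in
theorem tsum_pair {E : Type*} [NormedAddCommGroup E] [CompleteSpace E] {f : ℕ → E}
    (hf : Summable f) : HasSum (fun j : ℕ => f (2 * j) + f (2 * j + 1)) (∑' x, f x) := by
  have h0 := hf.comp_injective (mul_right_injective₀ (two_ne_zero (α := ℕ)))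
  have h1 := hf.comp_injective
      ((add_left_injective 1).comp (mul_right_injective₀ (two_ne_zero (α := ℕ))))
  have := (h0.hasSum.add h1.hasSum)
  have e := tsum_even_add_odd h0 h1
  simp only [Function.comp_def] at this e
  rw [e] at this
  exact this

end IsSqLaw

theorem mul_div_add_le_quarter {a b : ℝ} (ha : 0 ≤ a) (hb : 0 ≤ b) :
    a * b / (a + b) ≤ (a + b) / 4 := by
  rcases (add_nonneg ha hb).eq_or_lt with h | h
  · simp [← h]
  · rw [div_le_iff₀ h]
    nlinarith [sq_nonneg (a - b)]

/-- `ab/(a+b)` is the minimum over `y` of the right-hand side. With `y = 2j - m` this compares what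
a pair of atoms gives to `pairSum` with what it gives to the variance. -/
theorem mul_div_add_le_sq {a b : ℝ} (ha : 0 ≤ a) (hb : 0 ≤ b) (y : ℝ) :
    a * b / (a + b) ≤ y ^ 2 * a + (y + 1) ^ 2 * b := by
  rcases (add_nonneg ha hb).eq_or_lt with h | h
  · rw [← h]; simp; positivity
  · rw [div_le_iff₀ h]
    nlinarith [sq_nonneg (y * a + (y + 1) * b)]

/-- The squared norm is `(a+b)^2 - 2ab(1 - cos θ)` with `1 - cos θ ≥ w = 2θ²/π²`. For `q =
ab/(a+b)`, the quantity `(a+b)^2 - 2abw` is `((a+b) - qw)^2` minus the square of `qw`. -/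
theorem norm_add_mul_exp_le {a b : ℝ} (ha : 0 ≤ a) (hb : 0 ≤ b) {θ : ℝ} (hθ : |θ| ≤ Real.pi) :
    ‖(a : ℂ) + b * Complex.exp (Complex.I * θ)‖ ≤
      (a + b) - a * b / (a + b) * (2 / Real.pi ^ 2 * θ ^ 2) := by
  rcases (add_nonneg ha hb).eq_or_lt with h | h
  · have ha0 : a = 0 := by linarith
    have hb0 : b = 0 := by linarith
    simp [ha0, hb0]
  have hc := Real.cos_le_one_sub_mul_cos_sq hθ
  have hcos := Real.neg_one_le_cos θ
  set w := 2 / Real.pi ^ 2 * θ ^ 2 with hw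
  have hsq : ‖(a : ℂ) + b * Complex.exp (Complex.I * θ)‖ ^ 2
      = (a + b) ^ 2 - 2 * (a * b) * (1 - Real.cos θ) := by
    rw [← Complex.normSq_eq_norm_sq, mul_comm Complex.I, Complex.exp_mul_I, ← Complex.ofReal_cos,
      ← Complex.ofReal_sin, Complex.normSq_apply]
    simp only [Complex.add_re, Complex.add_im, Complex.mul_re, Complex.mul_im, Complex.ofReal_re,
      Complex.ofReal_im, Complex.I_re, Complex.I_im]
    linear_combination b ^ 2 * Real.sin_sq_add_cos_sq θ
  have hab : 0 ≤ a * b := mul_nonneg ha hb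
  have hq : a * b / (a + b) * (a + b) = a * b := div_mul_cancel₀ _ h.ne'
  have hq4 := mul_div_add_le_quarter ha hb
  set q := a * b / (a + b) with hqdef
  have hq0 : 0 ≤ q := div_nonneg hab h.le
  have hw2 : w ≤ 2 := by linarith
  have hw0 : 0 ≤ w := by positivity
  have hle : 0 ≤ (a + b) - q * w := by nlinarith
  refine abs_le_of_sq_le_sq' ?_ hle |>.2
  rw [hsq]
  nlinarith [mul_nonneg hab (sub_nonneg.2 (le_sub_comm.1 hc)), sq_nonneg (q * w)]

namespace IsSqLaw

variable {p : ℕ → ℝ} (hp : IsSqLaw p)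
include hp

theorem pairSum_summable :
    Summable fun j : ℕ => p (2 * j) * p (2 * j + 1) / (p (2 * j) + p (2 * j + 1)) := by
  refine Summable.of_nonneg_of_le (fun j => ?_)
    (fun j => mul_div_add_le_quarter (hp.nonneg _) (hp.nonneg _)) (hp.pair_summable.div_const 4)
  have h1 := hp.nonneg (2 * j)
  have h2 := hp.nonneg (2 * j + 1)
  positivity

theorem pairSum_nonneg : 0 ≤ pairSum p := tsum_nonneg fun j => by
  have h1 := hp.nonneg (2 * j)
  have h2 := hp.nonneg (2 * j + 1)
  positivity

theorem pairSum_le_quarter : pairSum p ≤ 1 / 4 := by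
  have h := (tsum_pair hp.hasSum.summable).div_const 4
  rw [hp.hasSum.tsum_eq] at h
  exact hasSum_le (fun j => mul_div_add_le_quarter (hp.nonneg _) (hp.nonneg _))
    hp.pairSum_summable.hasSum h

theorem pairSum_le_variance (m : ℝ) : pairSum p ≤ absMoment p m 2 := by
  rw [absMoment_two]
  refine hasSum_le (fun j => ?_) hp.pairSum_summable.hasSum (tsum_pair (hp.summable_sub_sq m))
  have := mul_div_add_le_sq (hp.nonneg (2 * j)) (hp.nonneg (2 * j + 1)) ((2 * j : ℕ) - m)
  refine this.trans (le_of_eq ?_)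
  push_cast
  ring

/-- Triangle inequality over the pairs `{2j, 2j+1}` instead of single atoms. Inside a pair the
relative phase is exactly `θ`, so cancellation is guaranteed up to `|θ| = π`, well outside the range
of a Taylor expansion at `0`. -/
theorem norm_centeredChar_le (m : ℝ) {θ : ℝ} (hθ : |θ| ≤ Real.pi) :
    ‖centeredChar p m θ‖ ≤ Real.exp (-(2 / Real.pi ^ 2 * pairSum p * θ ^ 2)) := by
  have h1 := tsum_pair (hp.summable_char m θ)
  have h2 := (tsum_pair hp.hasSum.summable).sub
    (hp.pairSum_summable.hasSum.mul_right (2 / Real.pi ^ 2 * θ ^ 2))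
  rw [hp.hasSum.tsum_eq] at h2
  have : ‖centeredChar p m θ‖ ≤ 1 - pairSum p * (2 / Real.pi ^ 2 * θ ^ 2) := by
    unfold centeredChar
    rw [← h1.tsum_eq]
    refine tsum_of_norm_bounded h2 fun j => ?_
    refine le_trans (le_of_eq ?_) (norm_add_mul_exp_le (hp.nonneg _) (hp.nonneg _) hθ)
    have e : (p (2 * j) : ℂ) * Complex.exp (Complex.I * ((((2 * j : ℕ) : ℝ) - m : ℝ) : ℂ) * (θ : ℂ))
        + (p (2 * j + 1) : ℂ) *
          Complex.exp (Complex.I * ((((2 * j + 1 : ℕ) : ℝ) - m : ℝ) : ℂ) * (θ : ℂ))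
        = Complex.exp (((((2 * j : ℕ) : ℝ) - m) * θ : ℝ) * Complex.I) *
          (p (2 * j) + p (2 * j + 1) * Complex.exp (Complex.I * θ)) := by
      have : Complex.exp (Complex.I * ((((2 * j + 1 : ℕ) : ℝ) - m : ℝ) : ℂ) * (θ : ℂ))
          = Complex.exp (((((2 * j : ℕ) : ℝ) - m) * θ : ℝ) * Complex.I)
            * Complex.exp (Complex.I * θ) := by
        rw [← Complex.exp_add]
        congr 1
        push_cast
        ring
      rw [this, show Complex.I * ((((2 * j : ℕ) : ℝ) - m : ℝ) : ℂ) * (θ : ℂ)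
        = ((((2 * j : ℕ) : ℝ) - m) * θ : ℝ) * Complex.I by push_cast; ring]
      ring
    rw [e, norm_mul, Complex.norm_exp_ofReal_mul_I, one_mul]
  refine this.trans ?_
  have h := Real.add_one_le_exp (-(2 / Real.pi ^ 2 * pairSum p * θ ^ 2))
  linarith

/-- Lyapounov's inequality, obtained by integrating Bernoulli's inequality, the tangent at `1` to
the power `1 + r/2`, in the variable `(x - m)^2 / v`. -/
theorem variance_rpow_le {m r : ℝ} (hr : 0 < r)
    (hs : Summable fun x : ℕ => |(x : ℝ) - m| ^ (2 + r) * p x) :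
    absMoment p m 2 ^ (1 + r / 2) ≤ absMoment p m (2 + r) := by
  have h0 := hp.absMoment_nonneg m 2
  rcases h0.eq_or_lt with h | h
  · rw [← h, Real.zero_rpow (by positivity)]
    exact hp.absMoment_nonneg m (2 + r)
  set v := absMoment p m 2 with hv
  have hv' : HasSum (fun x : ℕ => ((x : ℝ) - m) ^ 2 * p x) v := by
    rw [hv, absMoment_two]; exact (hp.summable_sub_sq m).hasSum
  have key : HasSum (fun x : ℕ => v ^ (1 + r / 2) *
      ((1 - (1 + r / 2)) * p x + (1 + r / 2) / v * (((x : ℝ) - m) ^ 2 * p x))) (v ^ (1 + r / 2)) := by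
    have := ((hp.hasSum.mul_left (1 - (1 + r / 2))).add
      (hv'.mul_left ((1 + r / 2) / v))).mul_left (v ^ (1 + r / 2))
    rw [div_mul_cancel₀ _ h.ne'] at this
    simpa using this
  refine hasSum_le (fun x => ?_) key hs.hasSum
  have hb := one_add_mul_self_le_rpow_one_add (s := ((x : ℝ) - m) ^ 2 / v - 1)
    (by have : 0 ≤ ((x : ℝ) - m) ^ 2 / v := by positivity
        linarith) (p := 1 + r / 2) (by linarith)
  have e : v ^ (1 + r / 2) * (((x : ℝ) - m) ^ 2 / v) ^ (1 + r / 2) = |(x : ℝ) - m| ^ (2 + r) := by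
    rw [← Real.mul_rpow h.le (by positivity), mul_div_cancel₀ _ h.ne', ← sq_abs,
      ← Real.rpow_natCast, ← Real.rpow_mul (abs_nonneg _)]
    congr 1
    push_cast
    ring
  rw [← e]
  have hb' : 1 + (1 + r / 2) * (((x : ℝ) - m) ^ 2 / v - 1) ≤
      (((x : ℝ) - m) ^ 2 / v) ^ (1 + r / 2) := by
    refine hb.trans (le_of_eq ?_); congr 1; ring
  calc _ = v ^ (1 + r / 2) * (1 + (1 + r / 2) * (((x : ℝ) - m) ^ 2 / v - 1)) * p x := by ring
    _ ≤ _ := by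
      refine mul_le_mul_of_nonneg_right ?_ (hp.nonneg x)
      exact mul_le_mul_of_nonneg_left hb' (by positivity)

end IsSqLaw

theorem norm_exp_neg_sub_le {r s : ℝ} (hr0 : 0 < r) (hr1 : r ≤ 1) (hs : 0 ≤ s) :
    |Real.exp (-s) - (1 - s)| ≤ s ^ (1 + r / 2) := by
  have h1 := Real.add_one_le_exp (-s)
  rw [abs_of_nonneg (by linarith)]
  rcases le_or_gt s 1 with h | h
  · have h2 : s ^ 2 ≤ s ^ (1 + r / 2) := by
      rcases hs.eq_or_lt with rfl | hs
      · simp; positivity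
      rw [← Real.rpow_natCast]
      exact Real.rpow_le_rpow_of_exponent_ge hs h (by push_cast; linarith)
    have h3 := Real.abs_exp_sub_one_sub_id_le (x := -s) (by rwa [abs_neg, abs_of_nonneg hs])
    have := (abs_le.1 h3).2
    nlinarith
  · have h2 : s ^ (1 : ℝ) ≤ s ^ (1 + r / 2) :=
      Real.rpow_le_rpow_of_exponent_le h.le (by linarith)
    rw [Real.rpow_one] at h2
    have : Real.exp (-s) ≤ 1 := Real.exp_le_one_iff.2 (by linarith)
    linarith

namespace IsSqLaw

variable {p : ℕ → ℝ} (hp : IsSqLaw p)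
include hp

/-- Integrality is what makes a lower moment bounded by a higher one here. Summed over the queues it
gives `σ^{-r} ≤ 4L`, so a small Lyapounov ratio forces a large `σ`. -/
theorem variance_le {m r : ℝ} (hm : ∑' x : ℕ, (x : ℝ) * p x = m) (hr0 : 0 < r) (hr1 : r ≤ 1)
    (hs : Summable fun x : ℕ => |(x : ℝ) - m| ^ (2 + r) * p x) :
    absMoment p m 2 ≤ 4 * absMoment p m (2 + r) := by
  have hv' : HasSum (fun x : ℕ => ((x : ℝ) - m) ^ 2 * p x) (absMoment p m 2) := by
    rw [absMoment_two]; exact (hp.summable_sub_sq m).hasSum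
  -- The subtracted term has mean zero and turns the integrand into `(x - m)(x - round m)`. This
  -- vanishes at the integer `round m`; at every other integer `|x - m| ≥ 1/2`.
  have key := hv'.sub ((hp.hasSum_sub hm).mul_left ((round m : ℝ) - m))
  rw [mul_zero, sub_zero] at key
  refine hasSum_le (fun x => ?_) key (hs.hasSum.mul_left 4)
  rw [← mul_assoc, ← mul_assoc, ← sub_mul]
  refine mul_le_mul_of_nonneg_right ?_ (hp.nonneg x)
  have hr := abs_sub_round m
  rw [abs_sub_comm] at hr
  by_cases hx : (x : ℤ) = round m
  · have : (x : ℝ) = round m := by exact_mod_cast hx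
    rw [this]
    have : 0 ≤ |(round m : ℝ) - m| ^ (2 + r) := by positivity
    nlinarith
  · have h1 : (1 : ℝ) ≤ |(x : ℝ) - round m| := by
      have : 1 ≤ |(x : ℤ) - round m| := Int.one_le_abs (sub_ne_zero.2 hx)
      exact_mod_cast this
    have h2 : |(x : ℝ) - round m| ≤ |(x : ℝ) - m| + |(round m : ℝ) - m| := by
      have := abs_sub ((x : ℝ) - m) ((round m : ℝ) - m)
      rwa [sub_sub_sub_cancel_right] at this
    set y := (x : ℝ) - m
    set z := (round m : ℝ) - m
    have hy : 1 / 2 ≤ |y| := by linarith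
    have h3 : |y| ^ 2 * (1 / 2) ≤ |y| ^ (2 + r) := by
      rw [Real.rpow_add (by linarith), Real.rpow_two]
      refine mul_le_mul_of_nonneg_left ?_ (by positivity)
      calc (1 / 2 : ℝ) = (1 / 2) ^ (1 : ℝ) := by rw [Real.rpow_one]
        _ ≤ (1 / 2) ^ r := Real.rpow_le_rpow_of_exponent_ge (by norm_num) (by norm_num) hr1
        _ ≤ |y| ^ r := Real.rpow_le_rpow (by norm_num) hy hr0.le
    have h4 : -(z * y) ≤ |y| ^ 2 := by
      calc -(z * y) ≤ |z * y| := neg_le_abs _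
        _ = |z| * |y| := abs_mul _ _
        _ ≤ |y| * |y| := mul_le_mul_of_nonneg_right (by linarith) (abs_nonneg _)
        _ = _ := by ring
    have h5 : y ^ 2 = |y| ^ 2 := (sq_abs y).symm
    linarith

/-- Both functions are compared with `1 - vθ²/2`. The transform is within `4β|θ|^(2+r)` by Taylor,
the Gaussian within `β|θ|^(2+r)` by Lyapounov's inequality. -/
theorem norm_centeredChar_sub_le {m r : ℝ} (hm : ∑' x : ℕ, (x : ℝ) * p x = m)
    (hr0 : 0 < r) (hr1 : r ≤ 1)
    (hs : Summable fun x : ℕ => |(x : ℝ) - m| ^ (2 + r) * p x) (θ : ℝ) :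
    ‖centeredChar p m θ - Real.exp (-(absMoment p m 2 * θ ^ 2 / 2))‖ ≤
      5 * (absMoment p m (2 + r) * |θ| ^ (2 + r)) := by
  have hv' : HasSum (fun x : ℕ => ((x : ℝ) - m) ^ 2 * p x) (absMoment p m 2) := by
    rw [absMoment_two]; exact (hp.summable_sub_sq m).hasSum
  set v := absMoment p m 2 with hv
  have hv0 : 0 ≤ v := hp.absMoment_nonneg m 2
  have hsum : HasSum (fun x : ℕ => (p x : ℂ) * (Complex.exp (Complex.I * ((((x : ℝ) - m) * θ : ℝ)))
      - 1 - Complex.I * ((((x : ℝ) - m) * θ : ℝ) : ℂ) + ((((x : ℝ) - m) * θ : ℝ) : ℂ) ^ 2 / 2))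
      (centeredChar p m θ - 1 - 0 + v * θ ^ 2 / 2) := by
    have h1 := (hp.summable_char m θ).hasSum
    have h2 : HasSum (fun x : ℕ => ((p x : ℝ) : ℂ)) ((1 : ℝ) : ℂ) :=
      Complex.hasSum_ofReal.2 hp.hasSum
    have h3 : HasSum (fun x : ℕ => ((((x : ℝ) - m) * p x : ℝ) : ℂ)) ((0 : ℝ) : ℂ) :=
      Complex.hasSum_ofReal.2 (hp.hasSum_sub hm)
    have h4 : HasSum (fun x : ℕ => ((((x : ℝ) - m) ^ 2 * p x : ℝ) : ℂ)) v :=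
      Complex.hasSum_ofReal.2 hv'
    have := ((h1.sub h2).sub (h3.mul_left (Complex.I * θ))).add (h4.mul_left ((θ : ℂ) ^ 2 / 2))
    rw [Complex.ofReal_zero, Complex.ofReal_one, mul_zero] at this
    have e : centeredChar p m θ - 1 - 0 + v * θ ^ 2 / 2 =
        centeredChar p m θ - 1 - 0 + θ ^ 2 / 2 * v := by ring
    rw [e]
    refine (congrArg (HasSum · _) (funext fun x => ?_)).mpr this
    rw [show Complex.I * (((x : ℝ) - m : ℝ) : ℂ) * (θ : ℂ)
      = Complex.I * ((((x : ℝ) - m) * θ : ℝ) : ℂ) by push_cast; ring]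
    push_cast
    ring
  have hA : ‖centeredChar p m θ - 1 - 0 + v * θ ^ 2 / 2‖ ≤
      4 * (absMoment p m (2 + r) * |θ| ^ (2 + r)) := by
    rw [← hsum.tsum_eq]
    refine tsum_of_norm_bounded ((hs.hasSum.mul_right (|θ| ^ (2 + r))).mul_left 4) fun x => ?_
    rw [norm_mul, Complex.norm_real, Real.norm_of_nonneg (hp.nonneg x)]
    refine (mul_le_mul_of_nonneg_left (norm_exp_I_mul_sub_taylor_le hr0.le hr1 _)
      (hp.nonneg x)).trans (le_of_eq ?_)
    rw [abs_mul, Real.mul_rpow (abs_nonneg _) (abs_nonneg _)]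
    ring
  have hB : |Real.exp (-(v * θ ^ 2 / 2)) - (1 - v * θ ^ 2 / 2)| ≤
      absMoment p m (2 + r) * |θ| ^ (2 + r) := by
    refine (norm_exp_neg_sub_le hr0 hr1 (by positivity)).trans ?_
    calc (v * θ ^ 2 / 2) ^ (1 + r / 2) ≤ (v * θ ^ 2) ^ (1 + r / 2) := by
          refine Real.rpow_le_rpow (by positivity) ?_ (by positivity)
          have : 0 ≤ v * θ ^ 2 := by positivity
          linarith
      _ = v ^ (1 + r / 2) * |θ| ^ (2 + r) := by
          rw [Real.mul_rpow hv0 (sq_nonneg _), ← sq_abs, ← Real.rpow_natCast,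
            ← Real.rpow_mul (abs_nonneg _)]
          congr 2
          push_cast
          ring
      _ ≤ _ := mul_le_mul_of_nonneg_right (hp.variance_rpow_le hr0 hs) (by positivity)
  calc _ = ‖(centeredChar p m θ - 1 - 0 + v * θ ^ 2 / 2) -
        ((Real.exp (-(v * θ ^ 2 / 2)) - (1 - v * θ ^ 2 / 2) : ℝ) : ℂ)‖ := by
        congr 1; push_cast; ring
    _ ≤ _ := norm_sub_le _ _
    _ ≤ 4 * (absMoment p m (2 + r) * |θ| ^ (2 + r)) + absMoment p m (2 + r) * |θ| ^ (2 + r) := by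
        refine add_le_add hA ?_
        rw [Complex.norm_real]; exact hB
    _ = _ := by ring

end IsSqLaw

/-! ### Products of characteristic functions. -/

section Products

variable {ι : Type*} {p : ι → ℕ → ℝ} {m : ι → ℝ}

theorem norm_prod_centeredChar_le {T : Finset ι} (hp : ∀ k ∈ T, IsSqLaw (p k)) {θ : ℝ}
    (hθ : |θ| ≤ Real.pi) : ‖∏ k ∈ T, centeredChar (p k) (m k) θ‖ ≤
      Real.exp (-(2 / Real.pi ^ 2 * (∑ k ∈ T, pairSum (p k)) * θ ^ 2)) := by
  rw [norm_prod, Finset.mul_sum, Finset.sum_mul, ← Finset.sum_neg_distrib, Real.exp_sum]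
  exact Finset.prod_le_prod (fun _ _ => norm_nonneg _) fun k hk =>
    (hp k hk).norm_centeredChar_le (m k) hθ

/-- The Gaussian factors obey the same decay as the pairing bound gives for the true ones, so that
the two kinds can be mixed in a telescoping product. -/
theorem exp_variance_le {i : ι} (hpi : IsSqLaw (p i)) (θ : ℝ) :
    Real.exp (-(absMoment (p i) (m i) 2 * θ ^ 2 / 2)) ≤
      Real.exp (-(2 / Real.pi ^ 2 * pairSum (p i) * θ ^ 2)) := by
  have h1 := hpi.pairSum_le_variance (m i)
  have h2 := hpi.pairSum_nonneg
  have hpi2 : 2 / Real.pi ^ 2 ≤ 1 / 2 := by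
    rw [div_le_div_iff₀ (by positivity) (by norm_num)]
    nlinarith [Real.pi_gt_three]
  refine Real.exp_le_exp.2 (neg_le_neg ?_)
  calc _ ≤ 1 / 2 * absMoment (p i) (m i) 2 * θ ^ 2 := by gcongr
    _ = _ := by ring

/-- Telescoping: one factor at a time is replaced by its Gaussian while the others, of either kind,
retain their decay. -/
theorem norm_prod_centeredChar_sub_le {T : Finset ι} {r : ℝ} (hr0 : 0 < r) (hr1 : r ≤ 1)
    (hp : ∀ k ∈ T, IsSqLaw (p k)) (hm : ∀ k ∈ T, ∑' x : ℕ, (x : ℝ) * p k x = m k)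
    (hs : ∀ k ∈ T, Summable fun x : ℕ => |(x : ℝ) - m k| ^ (2 + r) * p k x)
    {θ : ℝ} (hθ : |θ| ≤ Real.pi) :
    ‖∏ k ∈ T, centeredChar (p k) (m k) θ -
        Real.exp (-((∑ k ∈ T, absMoment (p k) (m k) 2) * θ ^ 2 / 2))‖ ≤
      5 * Real.exp (1 / 2) * (∑ k ∈ T, absMoment (p k) (m k) (2 + r)) * |θ| ^ (2 + r) *
        Real.exp (-(2 / Real.pi ^ 2 * (∑ k ∈ T, pairSum (p k)) * θ ^ 2)) := by
  classical
  induction T using Finset.induction_on with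
  | empty => simp
  | insert i T hi ih =>
    simp only [Finset.mem_insert, forall_eq_or_imp] at hp hm hs
    rw [Finset.prod_insert hi, Finset.sum_insert hi, Finset.sum_insert hi, Finset.sum_insert hi]
    have ih' := ih hp.2 hm.2 hs.2
    set P := ∏ k ∈ T, centeredChar (p k) (m k) θ
    set V := ∑ k ∈ T, absMoment (p k) (m k) 2
    set S := ∑ k ∈ T, absMoment (p k) (m k) (2 + r)
    set Q := ∑ k ∈ T, pairSum (p k) with hQ
    have hc1 := hp.1.norm_centeredChar_le (m i) hθ
    have hc2 := hp.1.norm_centeredChar_sub_le hm.1 hr0 hr1 hs.1 θ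
    have hv : Real.exp (-(V * θ ^ 2 / 2)) ≤ Real.exp (-(2 / Real.pi ^ 2 * Q * θ ^ 2)) := by
      have := Finset.prod_le_prod (s := T) (fun _ _ => (Real.exp_pos _).le)
        fun k hk => exp_variance_le (m := m) (hp.2 k hk) θ
      rw [← Real.exp_sum, ← Real.exp_sum, Finset.sum_neg_distrib, Finset.sum_neg_distrib,
        ← Finset.sum_div, ← Finset.sum_mul, ← Finset.sum_mul, ← Finset.mul_sum] at this
      exact this
    -- The replaced factor brings no decay of its own. Its missing exponential is restored at the
    -- price `exp(1/2)`, since `pairSum ≤ 1/4` and `|θ| ≤ π`.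
    have hq : 1 ≤ Real.exp (1 / 2) * Real.exp (-(2 / Real.pi ^ 2 * pairSum (p i) * θ ^ 2)) := by
      rw [← Real.exp_add]
      refine Real.one_le_exp ?_
      have h1 := hp.1.pairSum_le_quarter
      have h2 := hp.1.pairSum_nonneg
      have h3 : θ ^ 2 ≤ Real.pi ^ 2 := sq_le_sq' (by linarith [abs_le.1 hθ]) (abs_le.1 hθ).2
      have h4 : 2 / Real.pi ^ 2 * pairSum (p i) * θ ^ 2 ≤
          2 / Real.pi ^ 2 * (1 / 4) * Real.pi ^ 2 := by gcongr
      have h5 : 2 / Real.pi ^ 2 * (1 / 4) * Real.pi ^ 2 = 1 / 2 := by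
        field_simp; norm_num
      linarith
    set b := Real.exp (-(2 / Real.pi ^ 2 * pairSum (p i) * θ ^ 2)) with hb
    set E := Real.exp (-(2 / Real.pi ^ 2 * Q * θ ^ 2)) with hE
    set ci := centeredChar (p i) (m i) θ
    set vi := absMoment (p i) (m i) 2
    set βi := absMoment (p i) (m i) (2 + r) with hβi
    have hβ0 : 0 ≤ βi := hp.1.absMoment_nonneg _ _
    have e1 : Real.exp (-((vi + V) * θ ^ 2 / 2)) =
        Real.exp (-(vi * θ ^ 2 / 2)) * Real.exp (-(V * θ ^ 2 / 2)) := by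
      rw [← Real.exp_add]; congr 1; ring
    have e2 : Real.exp (-(2 / Real.pi ^ 2 * (pairSum (p i) + Q) * θ ^ 2)) = b * E := by
      rw [← Real.exp_add]; congr 1; ring
    rw [e1, e2]
    have e3 : ci * P - ((Real.exp (-(vi * θ ^ 2 / 2)) * Real.exp (-(V * θ ^ 2 / 2)) : ℝ) : ℂ)
        = ci * (P - Real.exp (-(V * θ ^ 2 / 2))) +
          (ci - Real.exp (-(vi * θ ^ 2 / 2))) * ((Real.exp (-(V * θ ^ 2 / 2)) : ℝ) : ℂ) := by
      push_cast; ring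
    rw [e3]
    refine (norm_add_le _ _).trans ?_
    rw [norm_mul, norm_mul, Complex.norm_real, Real.norm_of_nonneg (Real.exp_pos _).le]
    have hS0 : 0 ≤ S := Finset.sum_nonneg fun k hk => (hp.2 k hk).absMoment_nonneg _ _
    calc _ ≤ b * (5 * Real.exp (1 / 2) * S * |θ| ^ (2 + r) * E) +
          5 * (βi * |θ| ^ (2 + r)) * E := by gcongr
      _ ≤ b * (5 * Real.exp (1 / 2) * S * |θ| ^ (2 + r) * E) +
          5 * (βi * |θ| ^ (2 + r)) * E * (Real.exp (1 / 2) * b) := by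
          have : 0 ≤ 5 * (βi * |θ| ^ (2 + r)) * E := by positivity
          nlinarith
      _ = _ := by ring

end Products

/-! ### Fourier series on `ℕ` and inversion. -/

/-- The Fourier series `∑_x a_x exp(i x θ)`. -/
noncomputable def charSeries (a : ℕ → ℂ) (θ : ℝ) : ℂ := ∑' x : ℕ, a x * Complex.exp (Complex.I * x * θ)

theorem norm_exp_I_nat_mul (x : ℕ) (θ : ℝ) : ‖Complex.exp (Complex.I * x * θ)‖ = 1 := by
  rw [show Complex.I * x * θ = ((x * θ : ℝ) : ℂ) * Complex.I by push_cast; ring]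
  exact Complex.norm_exp_ofReal_mul_I _

theorem hasSum_charSeries {a : ℕ → ℂ} (ha : Summable fun x => ‖a x‖) (θ : ℝ) :
    HasSum (fun x : ℕ => a x * Complex.exp (Complex.I * x * θ)) (charSeries a θ) := by
  refine (Summable.of_norm (ha.congr fun x => ?_)).hasSum
  rw [norm_mul, norm_exp_I_nat_mul, mul_one]

theorem continuous_charSeries {a : ℕ → ℂ} (ha : Summable fun x => ‖a x‖) :
    Continuous (charSeries a) := by
  refine continuous_tsum (fun x => by fun_prop) ha fun x θ => ?_
  rw [norm_mul, norm_exp_I_nat_mul, mul_one]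

theorem norm_charSeries_le {a : ℕ → ℂ} {s : ℝ} (ha : HasSum (fun x => ‖a x‖) s) (θ : ℝ) :
    ‖charSeries a θ‖ ≤ s := by
  refine tsum_of_norm_bounded ha fun x => ?_
  rw [norm_mul, norm_exp_I_nat_mul, mul_one]

theorem charSeries_convolution {a b : ℕ → ℂ} (ha : Summable fun x => ‖a x‖)
    (hb : Summable fun x => ‖b x‖) (θ : ℝ) :
    charSeries a θ * charSeries b θ =
      charSeries (fun n => ∑ kl ∈ Finset.HasAntidiagonal.antidiagonal n, a kl.1 * b kl.2) θ := by
  unfold charSeries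
  rw [tsum_mul_tsum_eq_tsum_sum_antidiagonal_of_summable_norm]
  · refine tsum_congr fun n => ?_
    rw [Finset.sum_mul]
    refine Finset.sum_congr rfl fun kl hkl => ?_
    rw [← Finset.HasAntidiagonal.mem_antidiagonal.1 hkl]
    have : Complex.exp (Complex.I * ((kl.1 + kl.2 : ℕ) : ℂ) * θ) =
        Complex.exp (Complex.I * kl.1 * θ) * Complex.exp (Complex.I * kl.2 * θ) := by
      rw [← Complex.exp_add]; congr 1; push_cast; ring
    rw [this]
    ring
  · refine ha.congr fun x => ?_
    rw [norm_mul, norm_exp_I_nat_mul, mul_one]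
  · refine hb.congr fun x => ?_
    rw [norm_mul, norm_exp_I_nat_mul, mul_one]

theorem integral_exp_I_int_mul (k : ℤ) : ∫ θ in (-Real.pi)..Real.pi,
    Complex.exp (Complex.I * k * θ) = if k = 0 then 2 * (Real.pi : ℂ) else 0 := by
  split_ifs with h
  · subst h; simp; ring
  · have hc : Complex.I * (k : ℂ) ≠ 0 := by simp [h]
    rw [integral_exp_mul_complex hc]
    have : Complex.exp (Complex.I * k * (Real.pi : ℝ)) =
        Complex.exp (Complex.I * k * ((-Real.pi : ℝ) : ℂ)) := by
      rw [Complex.exp_eq_exp_iff_exists_int]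
      exact ⟨k, by push_cast; ring⟩
    rw [this, sub_self, zero_div]

theorem integral_charSeries {a : ℕ → ℂ} (ha : Summable fun x => ‖a x‖) (N : ℕ) :
    ∫ θ in (-Real.pi)..Real.pi, Complex.exp (-(Complex.I * N * θ)) * charSeries a θ =
      2 * Real.pi * a N := by
  have h := intervalIntegral.hasSum_integral_of_dominated_convergence (μ := MeasureTheory.volume)
    (a := -Real.pi) (b := Real.pi)
    (F := fun (x : ℕ) (θ : ℝ) => a x * Complex.exp (Complex.I * ((x - N : ℤ) : ℂ) * θ))
    (f := fun θ : ℝ => Complex.exp (-(Complex.I * N * θ)) * charSeries a θ)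
    (fun x _ => ‖a x‖) (fun x => Continuous.aestronglyMeasurable (by fun_prop))
    (fun x => Eventually.of_forall fun θ _ => by
      rw [norm_mul, show Complex.I * ((x - N : ℤ) : ℂ) * (θ : ℂ)
          = ((((x - N : ℤ) : ℝ) * θ : ℝ) : ℂ) * Complex.I by push_cast; ring,
        Complex.norm_exp_ofReal_mul_I, mul_one])
    (Eventually.of_forall fun θ _ => ha) (by simp)
    (Eventually.of_forall fun θ _ => by
      refine (congrArg (HasSum · _) (funext fun x => ?_)).mpr
        ((hasSum_charSeries ha θ).mul_left (Complex.exp (-(Complex.I * N * θ))))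
      rw [mul_left_comm, ← Complex.exp_add]
      congr 2
      push_cast
      ring)
  rw [← h.tsum_eq, tsum_eq_single N]
  · rw [intervalIntegral.integral_const_mul, integral_exp_I_int_mul]
    simp [mul_comm]
  · intro x hx
    rw [intervalIntegral.integral_const_mul, integral_exp_I_int_mul, if_neg, mul_zero]
    omega

/-- Power series do the bookkeeping of iterated convolution: Cauchy products preserve absolute
summability and multiply the Fourier series. -/
theorem charSeries_prod {ι : Type*} (a : ι → ℕ → ℂ) (T : Finset ι)
    (ha : ∀ k ∈ T, Summable fun x => ‖a k x‖) :
    (Summable fun x => ‖PowerSeries.coeff x (∏ k ∈ T, PowerSeries.mk (a k))‖) ∧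
    ∀ θ, ∏ k ∈ T, charSeries (a k) θ =
      charSeries (fun x => PowerSeries.coeff x (∏ k ∈ T, PowerSeries.mk (a k))) θ := by
  classical
  induction T using Finset.induction_on with
  | empty =>
    constructor
    · refine summable_of_ne_finset_zero (s := {0}) fun x hx => ?_
      have : x ≠ 0 := by simpa using hx
      simp [PowerSeries.coeff_one, this]
    · intro θ
      rw [charSeries, tsum_eq_single 0]
      · simp
      · intro x hx
        simp [PowerSeries.coeff_one, hx]
  | insert i T hi ih =>
    simp only [Finset.mem_insert, forall_eq_or_imp] at ha
    obtain ⟨ih1, ih2⟩ := ih ha.2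
    have e : ∀ x, PowerSeries.coeff x (∏ k ∈ insert i T, PowerSeries.mk (a k)) =
        ∑ kl ∈ Finset.HasAntidiagonal.antidiagonal x,
          a i kl.1 * PowerSeries.coeff kl.2 (∏ k ∈ T, PowerSeries.mk (a k)) := by
      intro x
      rw [Finset.prod_insert hi, PowerSeries.coeff_mul]
      simp
    have e' := funext e
    constructor
    · have h := summable_norm_sum_mul_antidiagonal_of_summable_norm ha.1 ih1
      exact h.congr fun x => by rw [e]
    · intro θ
      rw [Finset.prod_insert hi, ih2, charSeries_convolution ha.1 ih1, e']

theorem coeff_prod_mk {ι : Type*} [Fintype ι] [DecidableEq ι] (a : ι → ℕ → ℂ) (N : ℕ) :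
    PowerSeries.coeff N (∏ k, PowerSeries.mk (a k)) =
      ∑ q ∈ Finset.piAntidiag Finset.univ N, ∏ k, a k (q k) := by
  rw [PowerSeries.coeff_prod]
  refine Finset.sum_nbij' (fun l => ⇑l) (fun q => Finsupp.equivFunOnFinite.symm q) ?_ ?_ ?_ ?_ ?_
  · intro l hl
    simpa using hl
  · intro q hq
    simpa using hq
  · intro l hl; ext; simp
  · intro q hq; ext; simp
  · intro l hl; simp

/-- Fourier inversion for the coefficients of a product of generating functions. -/
theorem sum_piAntidiag_prod_eq_integral {ι : Type*} [Fintype ι] [DecidableEq ι] (a : ι → ℕ → ℂ)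
    (ha : ∀ k, Summable fun x => ‖a k x‖) (N : ℕ) :
    ∑ q ∈ Finset.piAntidiag Finset.univ N, ∏ k, a k (q k) =
      (1 / (2 * Real.pi) : ℝ) * ∫ θ in (-Real.pi)..Real.pi,
        Complex.exp (-(Complex.I * N * θ)) * ∏ k, charSeries (a k) θ := by
  obtain ⟨h1, h2⟩ := charSeries_prod a Finset.univ fun k _ => ha k
  simp_rw [h2]
  rw [integral_charSeries h1, coeff_prod_mk]
  have : (Real.pi : ℂ) ≠ 0 := by exact_mod_cast Real.pi_ne_zero
  push_cast
  field_simp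

/-! ### The factor `1 - iαθ` and its integrals against Gaussians. -/

/-- The factor `1 - i α θ`, the reciprocal of an exponential characteristic function. -/
noncomputable def linFactor (α θ : ℝ) : ℂ := 1 - Complex.I * α * θ

section LinFactor

variable {α : ℝ} (θ : ℝ)

@[simp] theorem linFactor_re : (linFactor α θ).re = 1 := by simp [linFactor]

@[simp] theorem linFactor_im : (linFactor α θ).im = -(α * θ) := by simp [linFactor]

theorem linFactor_ne_zero : linFactor α θ ≠ 0 := fun h => by
  have := congrArg Complex.re h; simp at this

theorem linFactor_mem_slitPlane : linFactor α θ ∈ Complex.slitPlane := Or.inl (by simp)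

theorem norm_linFactor_sq : ‖linFactor α θ‖ ^ 2 = 1 + (α * θ) ^ 2 := by
  rw [← Complex.normSq_eq_norm_sq, Complex.normSq_apply]; simp; ring

theorem one_le_norm_linFactor : 1 ≤ ‖linFactor α θ‖ := by
  have := Complex.abs_re_le_norm (linFactor α θ); simpa using this

theorem abs_le_norm_linFactor : α * |θ| ≤ ‖linFactor α θ‖ := by
  have := Complex.abs_im_le_norm (linFactor α θ)
  rw [linFactor_im, abs_neg, abs_mul] at this
  exact (mul_le_mul_of_nonneg_right (le_abs_self α) (abs_nonneg θ)).trans this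

theorem norm_linFactor_pos : 0 < ‖linFactor α θ‖ := one_pos.trans_le (one_le_norm_linFactor θ)

theorem hasDerivAt_linFactor : HasDerivAt (linFactor α) (-(Complex.I * α)) θ := by
  have h := ((hasDerivAt_id θ).ofReal_comp.const_mul (Complex.I * α)).const_sub 1
  have h' : HasDerivAt (linFactor α) (-(Complex.I * α * (1 : ℝ))) θ := h
  simpa using h'

theorem continuous_linFactor : Continuous (linFactor α) := by unfold linFactor; fun_prop

theorem continuous_linFactor_cpow (s : ℂ) : Continuous fun θ => linFactor α θ ^ s :=
  continuous_linFactor.cpow continuous_const fun θ => linFactor_mem_slitPlane θ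

theorem norm_linFactor_rpow_le {p s : ℝ} (hps : p ≤ s) :
    ‖linFactor α θ‖ ^ (-s) ≤ ‖linFactor α θ‖ ^ (-p) :=
  Real.rpow_le_rpow_of_exponent_le (one_le_norm_linFactor θ) (by linarith)

/-- Since `‖u‖ ≥ 1` and `‖u‖ ≥ α|θ|`, any part `p` of the decay exponent `s` can be traded for a
power of `|θ|` and the rest discarded. -/
theorem norm_linFactor_rpow_le_abs (hα : 0 < α) {θ : ℝ} (hθ : θ ≠ 0) {p s : ℝ} (hp : 0 ≤ p)
    (hps : p ≤ s) : ‖linFactor α θ‖ ^ (-s) ≤ α ^ (-p) * |θ| ^ (-p) := by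
  refine (norm_linFactor_rpow_le θ hps).trans ?_
  rw [← Real.mul_rpow hα.le (abs_nonneg _)]
  exact Real.rpow_le_rpow_of_nonpos (mul_pos hα (abs_pos.2 hθ)) (abs_le_norm_linFactor θ)
    (by linarith)

end LinFactor

theorem integral_abs_rpow_mul_exp_neg_mul_sq {a b : ℝ} (ha : -1 < a) (hb : 0 < b) :
    ∫ θ : ℝ, |θ| ^ a * Real.exp (-(b * θ ^ 2)) = b ^ (-(a + 1) / 2) * Real.Gamma ((a + 1) / 2) := by
  have h := integral_comp_abs (f := fun θ : ℝ => θ ^ a * Real.exp (-b * θ ^ (2 : ℝ)))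
  rw [integral_rpow_mul_exp_neg_mul_rpow two_pos ha hb] at h
  simp only [Real.rpow_two, sq_abs, neg_mul] at h
  rw [h]
  ring

theorem integrable_abs_rpow_mul_exp_neg_mul_sq {a b : ℝ} (ha : -1 < a) (hb : 0 < b) :
    MeasureTheory.Integrable fun θ : ℝ => |θ| ^ a * Real.exp (-(b * θ ^ 2)) := by
  -- The integral of a non-integrable function is `0` by convention, so the explicit positive value
  -- already proves integrability.
  refine MeasureTheory.Integrable.of_integral_ne_zero ?_
  rw [integral_abs_rpow_mul_exp_neg_mul_sq ha hb]
  exact (mul_pos (Real.rpow_pos_of_pos hb _) (Real.Gamma_pos_of_pos (by linarith))).ne'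

theorem continuousOn_Gamma_Ioi : ContinuousOn Real.Gamma (Set.Ioi 0) := fun x hx =>
  (Real.differentiableAt_Gamma fun m => by
    have : (0 : ℝ) ≤ m := m.cast_nonneg
    have := Set.mem_Ioi.1 hx
    linarith).continuousAt.continuousWithinAt

theorem exists_Gamma_le {lo hi : ℝ} (hlo : 0 < lo) :
    ∃ C, 0 < C ∧ ∀ x ∈ Set.Icc lo hi, Real.Gamma x ≤ C := by
  obtain ⟨C, hC⟩ := isCompact_Icc.bddAbove_image
    (continuousOn_Gamma_Ioi.mono fun x (hx : x ∈ Set.Icc lo hi) => hlo.trans_le hx.1)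
  exact ⟨max C 1, by positivity, fun x hx => (hC (Set.mem_image_of_mem _ hx)).trans (le_max_left _ _)⟩

/-- One constant serves a whole interval of exponents `a`: in the application `a` depends on `Ξ_n`,
which varies with `n` in a bounded range. -/
theorem exists_integral_abs_rpow_mul_exp_le {a₀ a₁ c : ℝ} (ha₀ : -1 < a₀) (hc : 0 < c)
    (hc1 : c ≤ 1) : ∃ C, 0 < C ∧ ∀ a ∈ Set.Icc a₀ a₁, ∀ σ : ℝ, 0 < σ →
      ∫ θ : ℝ, |θ| ^ a * Real.exp (-(c * σ ^ 2 * θ ^ 2)) ≤ C * σ ^ (-(a + 1)) := by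
  obtain ⟨C, hC0, hC⟩ := exists_Gamma_le (lo := (a₀ + 1) / 2) (hi := (a₁ + 1) / 2) (by linarith)
  refine ⟨c ^ (-(a₁ + 1) / 2) * C, by positivity, fun a ha σ hσ => ?_⟩
  rw [integral_abs_rpow_mul_exp_neg_mul_sq (ha₀.trans_le ha.1) (by positivity),
    Real.mul_rpow hc.le (by positivity), ← Real.rpow_natCast, ← Real.rpow_mul hσ.le]
  have h1 : c ^ (-(a + 1) / 2) ≤ c ^ (-(a₁ + 1) / 2) :=
    Real.rpow_le_rpow_of_exponent_ge hc hc1 (by linarith [ha.2])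
  have h2 := hC ((a + 1) / 2) ⟨by linarith [ha.1], by linarith [ha.2]⟩
  have h3 : 0 < Real.Gamma ((a + 1) / 2) := Real.Gamma_pos_of_pos (by linarith [ha.1])
  have e : ((2 : ℕ) : ℝ) * (-(a + 1) / 2) = -(a + 1) := by push_cast; ring
  rw [e]
  calc _ = (c ^ (-(a + 1) / 2) * Real.Gamma ((a + 1) / 2)) * σ ^ (-(a + 1)) := by ring
    _ ≤ _ := by gcongr

theorem rpow_scale {α σ : ℝ} (hα : 0 < α) (hσ : 0 < σ) (p e : ℝ) :
    α ^ (-p) * σ ^ (p - 1 - e) = σ ^ (-e) / α * (σ / α) ^ (p - 1) := by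
  rw [Real.div_rpow hσ.le hα.le, show p - 1 - e = -e + (p - 1) by ring, Real.rpow_add hσ,
    show -p = -1 - (p - 1) by ring, Real.rpow_sub hα, Real.rpow_neg_one]
  field_simp

/-- Integrals with a factor `|θ| ^ (2 + r)` and a Gaussian factor of scale `σ⁻¹`. -/
theorem exists_norm_integral_le_of_le_rpow {c r : ℝ} (hc : 0 < c) (hc1 : c ≤ 1) (hr0 : 0 < r) :
    ∃ C, 0 < C ∧ ∀ s α σ : ℝ, 1 ≤ s → 0 < α → 0 < σ → σ ≤ α → ∀ f : ℝ → ℂ,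
      (∀ θ, ‖f θ‖ ≤ ‖linFactor α θ‖ ^ (-s) * |θ| ^ (2 + r) * Real.exp (-(c * σ ^ 2 * θ ^ 2))) →
      ‖∫ θ, f θ‖ ≤ C * (σ ^ (-(2 + r)) / α * ((σ / α) ^ (s - 1) + (σ / α) ^ 2)) := by
  obtain ⟨C, hC0, hC⟩ := exists_integral_abs_rpow_mul_exp_le (a₀ := r / 2 - 1) (a₁ := 1 + r)
    (c := c) (by linarith) hc hc1
  refine ⟨C, hC0, fun s α σ hs hα hσ hσα f hf => ?_⟩
  -- `p` is the part of `s` traded for a power of `|θ|`. The cap `3 + r/2` keeps `2 + r - p` above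
  -- `-1`, hence integrability at `0`; when `s` exceeds the cap, `p = 3 + r/2` gives `(σ/α)^(2+r/2)
  -- ≤ (σ/α)^2`.
  have key : ∀ p, 1 ≤ p → p ≤ s → p ≤ 3 + r / 2 →
      ‖∫ θ, f θ‖ ≤ C * (σ ^ (-(2 + r)) / α * (σ / α) ^ (p - 1)) := by
    intro p hp1 hps hp3
    have ha : 2 + r - p ∈ Set.Icc (r / 2 - 1) (1 + r) := ⟨by linarith, by linarith⟩
    have hint := integrable_abs_rpow_mul_exp_neg_mul_sq (a := 2 + r - p) (b := c * σ ^ 2)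
      (by linarith) (by positivity)
    refine (MeasureTheory.norm_integral_le_of_norm_le (hint.const_mul (α ^ (-p))) ?_).trans ?_
    · filter_upwards [MeasureTheory.Measure.ae_ne MeasureTheory.volume (0 : ℝ)] with θ hθ
      refine (hf θ).trans ?_
      have h1 := norm_linFactor_rpow_le_abs hα hθ (zero_le_one.trans hp1) hps
      calc _ ≤ α ^ (-p) * |θ| ^ (-p) * |θ| ^ (2 + r) * Real.exp (-(c * σ ^ 2 * θ ^ 2)) := by gcongr
        _ = _ := by
          have e : |θ| ^ (2 + r - p) = |θ| ^ (-p) * |θ| ^ (2 + r) := by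
            rw [← Real.rpow_add (abs_pos.2 hθ)]; congr 1; ring
          rw [e]; ring
    · rw [MeasureTheory.integral_const_mul]
      calc _ ≤ α ^ (-p) * (C * σ ^ (-(2 + r - p + 1))) := by
            have := hC _ ha σ hσ; gcongr
        _ = C * (α ^ (-p) * σ ^ (p - 1 - (2 + r))) := by
            rw [show -(2 + r - p + 1) = p - 1 - (2 + r) by ring]; ring
        _ = _ := by rw [rpow_scale hα hσ]
  have hx0 : 0 < σ / α := by positivity
  have hx1 : σ / α ≤ 1 := (div_le_one hα).2 hσα
  rcases le_or_gt s (3 + r / 2) with h | h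
  · refine (key s hs le_rfl h).trans ?_
    gcongr
    have : 0 ≤ (σ / α) ^ 2 := by positivity
    linarith
  · refine (key (3 + r / 2) (by linarith) h.le le_rfl).trans ?_
    have h1 : (σ / α) ^ (3 + r / 2 - 1) ≤ (σ / α) ^ 2 := by
      rw [← Real.rpow_natCast]
      exact Real.rpow_le_rpow_of_exponent_ge hx0 hx1 (by push_cast; linarith)
    have h2 : 0 ≤ (σ / α) ^ (s - 1) := by positivity
    gcongr
    linarith

/-- For the case where a factor `|θ|` has consumed one power of `‖u‖`. With `s ≤ 3/2`, the
singularity `|θ|^{-(s-1)}` is at worst `|θ|^{-1/2}`. -/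
theorem exists_norm_integral_le_of_le_exp {c : ℝ} (hc : 0 < c) (hc1 : c ≤ 1) :
    ∃ C, 0 < C ∧ ∀ s α σ : ℝ, 1 ≤ s → s ≤ 3 / 2 → 0 < α → 0 < σ → ∀ f : ℝ → ℂ,
      (∀ θ, ‖f θ‖ ≤ ‖linFactor α θ‖ ^ (-(s - 1)) * Real.exp (-(c * σ ^ 2 * θ ^ 2))) →
      ‖∫ θ, f θ‖ ≤ C * ((σ / α) ^ (s - 1) / σ) := by
  obtain ⟨C, hC0, hC⟩ := exists_integral_abs_rpow_mul_exp_le (a₀ := -1 / 2) (a₁ := 0)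
    (c := c) (by norm_num) hc hc1
  refine ⟨C, hC0, fun s α σ hs hs' hα hσ f hf => ?_⟩
  have ha : -(s - 1) ∈ Set.Icc (-1 / 2 : ℝ) 0 := ⟨by linarith, by linarith⟩
  have hint := integrable_abs_rpow_mul_exp_neg_mul_sq (a := -(s - 1)) (b := c * σ ^ 2)
    (by linarith) (by positivity)
  refine (MeasureTheory.norm_integral_le_of_norm_le (hint.const_mul (α ^ (-(s - 1)))) ?_).trans ?_
  · filter_upwards [MeasureTheory.Measure.ae_ne MeasureTheory.volume (0 : ℝ)] with θ hθ
    refine (hf θ).trans ?_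
    rw [← mul_assoc]
    gcongr
    exact norm_linFactor_rpow_le_abs hα hθ (by linarith) le_rfl
  · rw [MeasureTheory.integral_const_mul]
    calc _ ≤ α ^ (-(s - 1)) * (C * σ ^ (-(-(s - 1) + 1))) := by
          have := hC _ ha σ hσ; gcongr
      _ = _ := by
          rw [Real.div_rpow hσ.le hα.le, show -(-(s - 1) + 1) = (s - 1) - 1 by ring,
            Real.rpow_sub hσ (s - 1), Real.rpow_one, Real.rpow_neg hα.le]
          field_simp

/-- `∫ (1 + t²)^{-3/4} dt` -/
noncomputable def bracketIntegral : ℝ := ∫ t : ℝ, (1 + ‖t‖ ^ 2) ^ (-(3 / 2 : ℝ) / 2)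

theorem norm_linFactor_rpow (α θ s : ℝ) :
    ‖linFactor α θ‖ ^ (-s) = (1 + ‖α * θ‖ ^ 2) ^ (-s / 2) := by
  rw [Real.norm_eq_abs, sq_abs, ← norm_linFactor_sq, ← Real.rpow_natCast,
    ← Real.rpow_mul (norm_nonneg _)]
  congr 1
  push_cast
  ring

theorem integrable_norm_linFactor_rpow {α s : ℝ} (hα : 0 < α) (hs : 1 < s) :
    MeasureTheory.Integrable fun θ => ‖linFactor α θ‖ ^ (-s) := by
  have h := integrable_rpow_neg_one_add_norm_sq (E := ℝ) (μ := MeasureTheory.volume) (r := s)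
    (by simpa using hs)
  have := h.comp_mul_left' hα.ne'
  refine this.congr (Eventually.of_forall fun θ => ?_)
  simp only [norm_linFactor_rpow]

theorem integral_norm_linFactor_rpow {α : ℝ} (hα : 0 < α) :
    ∫ θ, ‖linFactor α θ‖ ^ (-(3 / 2) : ℝ) = bracketIntegral / α := by
  have := MeasureTheory.Measure.integral_comp_mul_left
    (fun t : ℝ => (1 + ‖t‖ ^ 2) ^ (-(3 / 2 : ℝ) / 2)) α
  simp_rw [norm_linFactor_rpow]
  rw [this, abs_of_pos (inv_pos.2 hα), smul_eq_mul, bracketIntegral]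
  ring

theorem bracketIntegral_nonneg : 0 ≤ bracketIntegral :=
  MeasureTheory.integral_nonneg fun t => by positivity

/-- For `s ≥ 3/2` the decay of `‖u‖^{-s}` is integrable by itself, at scale `1/α`, and no Gaussian
factor is needed. -/
theorem norm_integral_le_bracket {α : ℝ} (hα : 0 < α) {f : ℝ → ℂ} {M : ℝ}
    (hf : ∀ θ, ‖f θ‖ ≤ M * ‖linFactor α θ‖ ^ (-(3 / 2) : ℝ)) :
    ‖∫ θ, f θ‖ ≤ M * (bracketIntegral / α) := by
  rw [← integral_norm_linFactor_rpow hα, ← MeasureTheory.integral_const_mul]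
  exact MeasureTheory.norm_integral_le_of_norm_le
    ((integrable_norm_linFactor_rpow hα (by norm_num)).const_mul M) (Eventually.of_forall hf)

/-! ### Regularity of the Gamma densities, uniform in the shape. -/

/-- The density of the Gamma law of shape `s` and scale `1`. -/
noncomputable def gammaDensity (s v : ℝ) : ℝ :=
  if 0 < v then v ^ (s - 1) * Real.exp (-v) / Real.Gamma s else 0

/-- The derivative of `gammaDensity s` on the positive half-line. -/
noncomputable def gammaDensityDeriv (s v : ℝ) : ℝ :=
  ((s - 1) * v ^ (s - 2) - v ^ (s - 1)) * Real.exp (-v) / Real.Gamma s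

theorem gammaDensity_of_pos {s v : ℝ} (hv : 0 < v) :
    gammaDensity s v = v ^ (s - 1) * Real.exp (-v) / Real.Gamma s := if_pos hv

theorem exists_le_Gamma {lo hi : ℝ} (hlo : 0 < lo) :
    ∃ c, 0 < c ∧ ∀ x ∈ Set.Icc lo hi, c ≤ Real.Gamma x := by
  rcases (Set.Icc lo hi).eq_empty_or_nonempty with h | h
  · exact ⟨1, one_pos, by simp [h]⟩
  obtain ⟨x, hx, hmin⟩ := isCompact_Icc.exists_isMinOn h
    (continuousOn_Gamma_Ioi.mono fun x (hx : x ∈ Set.Icc lo hi) => hlo.trans_le hx.1)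
  exact ⟨Real.Gamma x, Real.Gamma_pos_of_pos (hlo.trans_le hx.1), fun y hy => hmin hy⟩

theorem exists_rpow_mul_exp_neg_le (M : ℝ) : ∃ C, 0 < C ∧ ∀ t ∈ Set.Icc (-2) M, ∀ v : ℝ, 1 / 4 ≤ v →
    v ^ t * Real.exp (-v) ≤ C := by
  set n := ⌈M⌉₊
  -- `16 = (1/4)^{-2}` handles negative exponents, `v^n ≤ n! exp v` positive ones. The range starts
  -- at `-2` because `v^(s-3)` occurs in the second derivative with `s ≥ 1`.
  refine ⟨17 + n.factorial, by positivity, fun t ht v hv => ?_⟩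
  have hv0 : 0 < v := by linarith
  have h1 : v ^ t ≤ 16 + v ^ n := by
    have hn : 0 ≤ v ^ n := by positivity
    rcases le_or_gt t 0 with h | h
    · have : v ^ t ≤ (1 / 4 : ℝ) ^ t := Real.rpow_le_rpow_of_nonpos (by norm_num) hv h
      have h2 : (1 / 4 : ℝ) ^ t ≤ (1 / 4 : ℝ) ^ (-2 : ℝ) :=
        Real.rpow_le_rpow_of_exponent_ge (by norm_num) (by norm_num) ht.1
      have h3 : (1 / 4 : ℝ) ^ (-2 : ℝ) = 16 := by
        rw [Real.rpow_neg (by norm_num), Real.rpow_two]; norm_num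
      linarith
    · rcases le_or_gt v 1 with h' | h'
      · have : v ^ t ≤ 1 := Real.rpow_le_one hv0.le h' h.le
        linarith
      · have : v ^ t ≤ v ^ (n : ℝ) :=
          Real.rpow_le_rpow_of_exponent_le h'.le (ht.2.trans (Nat.le_ceil M))
        rw [Real.rpow_natCast] at this
        linarith
  have h2 := Real.pow_div_factorial_le_exp v hv0.le n
  rw [div_le_iff₀ (by positivity)] at h2
  have h3 : 1 ≤ Real.exp v := Real.one_le_exp hv0.le
  rw [Real.exp_neg, ← div_eq_mul_inv, div_le_iff₀ (Real.exp_pos _)]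
  nlinarith

theorem gammaDensity_nonneg {s : ℝ} (hs : 0 < s) (v : ℝ) : 0 ≤ gammaDensity s v := by
  have := Real.Gamma_pos_of_pos hs
  unfold gammaDensity
  split_ifs with h
  · positivity
  · exact le_rfl

theorem measurable_gammaDensity (s : ℝ) : Measurable (gammaDensity s) := by
  unfold gammaDensity
  refine Measurable.ite measurableSet_Ioi (by fun_prop) measurable_const

theorem exists_gammaDensity_le (B : ℝ) : ∃ C, 0 < C ∧ ∀ s ∈ Set.Icc 1 B, ∀ v : ℝ,
    gammaDensity s v ≤ C := by
  obtain ⟨c, hc, hcΓ⟩ := exists_le_Gamma (lo := 1) (hi := B) one_pos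
  obtain ⟨C, hC, hCv⟩ := exists_rpow_mul_exp_neg_le B
  refine ⟨(C + 1) / c, by positivity, fun s hs v => ?_⟩
  unfold gammaDensity
  split_ifs with h
  · have h1 := hcΓ s hs
    have h2 : v ^ (s - 1) * Real.exp (-v) ≤ C + 1 := by
      rcases le_or_gt (1 / 4) v with h' | h'
      · have := hCv (s - 1) ⟨by linarith [hs.1], by linarith [hs.2]⟩ v h'
        linarith
      · have h3 : v ^ (s - 1) ≤ 1 := Real.rpow_le_one h.le (by linarith) (by linarith [hs.1])
        have h4 : Real.exp (-v) ≤ 1 := Real.exp_le_one_iff.2 (by linarith)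
        have : v ^ (s - 1) * Real.exp (-v) ≤ 1 := mul_le_one₀ h3 (Real.exp_pos _).le h4
        linarith
    gcongr
  · positivity

theorem hasDerivAt_gammaDensity (s : ℝ) {v : ℝ} (hv : 0 < v) :
    HasDerivAt (gammaDensity s) (gammaDensityDeriv s v) v := by
  have h : HasDerivAt (fun v : ℝ => v ^ (s - 1) * Real.exp (-v) / Real.Gamma s)
      (gammaDensityDeriv s v) v := by
    have h1 := Real.hasDerivAt_rpow_const (x := v) (p := s - 1) (Or.inl hv.ne')
    have h2 := (hasDerivAt_id v).neg.exp
    refine HasDerivAt.congr_deriv ((h1.mul h2).div_const (Real.Gamma s)) ?_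
    unfold gammaDensityDeriv
    rw [show s - 1 - 1 = s - 2 by ring]
    simp
    ring
  refine h.congr_of_eventuallyEq ?_
  filter_upwards [lt_mem_nhds hv] with w hw using gammaDensity_of_pos hw

theorem hasDerivAt_gammaDensityDeriv (s : ℝ) {v : ℝ} (hv : 0 < v) :
    HasDerivAt (gammaDensityDeriv s) (((s - 1) * (s - 2) * v ^ (s - 3) - 2 * (s - 1) * v ^ (s - 2)
      + v ^ (s - 1)) * Real.exp (-v) / Real.Gamma s) v := by
  have h1 := Real.hasDerivAt_rpow_const (x := v) (p := s - 1) (Or.inl hv.ne')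
  have h3 := Real.hasDerivAt_rpow_const (x := v) (p := s - 2) (Or.inl hv.ne')
  have h2 := (hasDerivAt_id v).neg.exp
  refine HasDerivAt.congr_deriv ((((h3.const_mul (s - 1)).sub h1).mul h2).div_const
    (Real.Gamma s)) ?_
  rw [show s - 1 - 1 = s - 2 by ring, show s - 2 - 1 = s - 3 by ring]
  simp
  ring

theorem exists_abs_gammaDensityDeriv_le (B : ℝ) : ∃ C, 0 < C ∧ ∀ s ∈ Set.Icc 1 B, ∀ v : ℝ,
    1 / 4 ≤ v → |gammaDensityDeriv s v| ≤ C ∧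
      |((s - 1) * (s - 2) * v ^ (s - 3) - 2 * (s - 1) * v ^ (s - 2)
        + v ^ (s - 1)) * Real.exp (-v) / Real.Gamma s| ≤ C := by
  obtain ⟨c, hc, hcΓ⟩ := exists_le_Gamma (lo := 1) (hi := B) one_pos
  obtain ⟨C, hC, hCv⟩ := exists_rpow_mul_exp_neg_le B
  obtain ⟨M, hM⟩ : ∃ M, M = |B| + 2 := ⟨_, rfl⟩
  have hM0 : 0 < M := by rw [hM]; positivity
  refine ⟨(M ^ 2 * C + 2 * M * C + C) / c, by positivity, fun s hs v hv => ?_⟩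
  have hv0 : 0 < v := by linarith
  have hs1 := hs.1
  have hs2 := hs.2
  have hsM : s + 2 ≤ M := by linarith [le_abs_self B]
  have hΓ := hcΓ s hs
  have b1 := hCv (s - 1) ⟨by linarith, by linarith⟩ v hv
  have b2 := hCv (s - 2) ⟨by linarith, by linarith⟩ v hv
  have b3 := hCv (s - 3) ⟨by linarith, by linarith⟩ v hv
  have p1 : 0 ≤ v ^ (s - 1) * Real.exp (-v) := by positivity
  have p2 : 0 ≤ v ^ (s - 2) * Real.exp (-v) := by positivity
  have p3 : 0 ≤ v ^ (s - 3) * Real.exp (-v) := by positivity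
  set e1 := v ^ (s - 1) * Real.exp (-v)
  set e2 := v ^ (s - 2) * Real.exp (-v)
  set e3 := v ^ (s - 3) * Real.exp (-v)
  have hB : |(s - 1) * (s - 2)| ≤ M ^ 2 := by rw [abs_le]; constructor <;> nlinarith
  have q1 : |(s - 1) * e2 - e1| ≤ M ^ 2 * C + 2 * M * C + C := by
    have : |(s - 1) * e2 - e1| ≤ (s - 1) * e2 + e1 := by
      rw [abs_le]; constructor <;> nlinarith
    have h2 : (s - 1) * e2 ≤ 2 * M * C := by
      apply mul_le_mul <;> linarith
    have h3 : 0 ≤ M ^ 2 * C := by positivity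
    linarith
  have q2 : |(s - 1) * (s - 2) * e3 - 2 * (s - 1) * e2 + e1| ≤
      M ^ 2 * C + 2 * M * C + C := by
    refine (abs_add_le _ _).trans (add_le_add ((abs_sub _ _).trans (add_le_add ?_ ?_)) ?_)
    · rw [abs_mul, abs_of_nonneg p3]; gcongr
    · rw [abs_mul, abs_of_nonneg p2, abs_of_nonneg (by linarith)]
      apply mul_le_mul <;> linarith
    · rw [abs_of_nonneg p1]; exact b1
  have hΓ0 : 0 < Real.Gamma s := hc.trans_le hΓ
  constructor
  · rw [show gammaDensityDeriv s v = ((s - 1) * e2 - e1) / Real.Gamma s by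
      unfold gammaDensityDeriv; simp only [e1, e2]; ring, abs_div, abs_of_pos hΓ0]
    exact div_le_div₀ ((abs_nonneg _).trans q1) q1 hc hΓ
  · rw [show ((s - 1) * (s - 2) * v ^ (s - 3) - 2 * (s - 1) * v ^ (s - 2)
        + v ^ (s - 1)) * Real.exp (-v) = (s - 1) * (s - 2) * e3 - 2 * (s - 1) * e2 + e1 by
        simp only [e1, e2, e3]; ring, abs_div, abs_of_pos hΓ0]
    exact div_le_div₀ ((abs_nonneg _).trans q2) q2 hc hΓ

/-- The density need not be smooth at `0` (it jumps there for `s = 1`), but the base point is at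
least `1/2`. For `v ≥ 1/4` the second derivative is bounded; for `v < 1/4` the distance to `y`
exceeds `1/4`, and `1 ≤ 16(v-y)²`, `|v-y| ≤ 4(v-y)²` turn bounded quantities into quadratic ones. -/
theorem exists_gammaDensity_taylor_le (B : ℝ) : ∃ C, 0 < C ∧ ∀ s ∈ Set.Icc 1 B, ∀ y v : ℝ,
    1 / 2 ≤ y → |gammaDensity s v - gammaDensity s y - gammaDensityDeriv s y * (v - y)| ≤
      C * (v - y) ^ 2 := by
  obtain ⟨C₀, hC₀, h₀⟩ := exists_gammaDensity_le B
  obtain ⟨C₁, hC₁, h₁⟩ := exists_abs_gammaDensityDeriv_le B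
  refine ⟨32 * C₀ + 4 * C₁, by positivity, fun s hs y v hy => ?_⟩
  rcases le_or_gt (1 / 4) v with hv | hv
  · have hconv : Convex ℝ (Set.Ici (1 / 4 : ℝ)) := convex_Ici _
    have lip : ∀ w, 1 / 4 ≤ w → |gammaDensityDeriv s w - gammaDensityDeriv s y| ≤ C₁ * |w - y| := by
      intro w hw
      exact hconv.norm_image_sub_le_of_norm_hasDerivWithin_le
        (fun z hz => (hasDerivAt_gammaDensityDeriv s
          (lt_of_lt_of_le (by norm_num) (Set.mem_Ici.1 hz))).hasDerivWithinAt)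
        (fun z hz => (h₁ s hs z hz).2) (show y ∈ Set.Ici (1 / 4 : ℝ) by
          simp only [Set.mem_Ici]; linarith) hw
    have huI : ∀ z ∈ Set.uIcc y v, 1 / 4 ≤ z ∧ |z - y| ≤ |v - y| := fun z hz =>
      ⟨(le_min (by linarith) hv).trans hz.1, Set.abs_sub_left_of_mem_uIcc hz⟩
    have := (convex_uIcc y v).norm_image_sub_le_of_norm_hasDerivWithin_le
      (f := fun z => gammaDensity s z - gammaDensityDeriv s y * z)
      (f' := fun z => gammaDensityDeriv s z - gammaDensityDeriv s y) (C := C₁ * |v - y|)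
      (fun z hz => ((hasDerivAt_gammaDensity s (lt_of_lt_of_le (by norm_num) (huI z hz).1)).sub
        (by simpa using (hasDerivAt_id z).const_mul (gammaDensityDeriv s y))).hasDerivWithinAt)
      (fun z hz => (lip z (huI z hz).1).trans (by
        have := (huI z hz).2
        gcongr)) Set.left_mem_uIcc Set.right_mem_uIcc
    rw [Real.norm_eq_abs, Real.norm_eq_abs, mul_assoc, ← sq, sq_abs] at this
    calc _ = |gammaDensity s v - gammaDensityDeriv s y * v -
          (gammaDensity s y - gammaDensityDeriv s y * y)| := by congr 1; ring
      _ ≤ C₁ * (v - y) ^ 2 := this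
      _ ≤ _ := by
        have : 0 ≤ (v - y) ^ 2 := sq_nonneg _
        nlinarith
  · have g1 := h₀ s hs v
    have g2 := h₀ s hs y
    have g3 := gammaDensity_nonneg (s := s) (by linarith [hs.1]) v
    have g4 := gammaDensity_nonneg (s := s) (by linarith [hs.1]) y
    have g5 := (h₁ s hs y (by linarith)).1
    have hd : 1 / 4 ≤ y - v := by linarith
    have hd2 : (y - v) ≤ 4 * (y - v) ^ 2 := by nlinarith
    have hd3 : 1 ≤ 16 * (y - v) ^ 2 := by nlinarith
    have g6 : |gammaDensityDeriv s y * (v - y)| ≤ C₁ * (y - v) := by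
      rw [abs_mul, abs_sub_comm v y, abs_of_nonneg (by linarith : 0 ≤ y - v)]
      gcongr
    have g7 : |gammaDensity s v - gammaDensity s y| ≤ 2 * C₀ := by
      rw [abs_le]; constructor <;> linarith
    calc _ ≤ 2 * C₀ + C₁ * (y - v) := (abs_sub _ _).trans (add_le_add g7 g6)
      _ ≤ 2 * C₀ * (16 * (y - v) ^ 2) + C₁ * (4 * (y - v) ^ 2) := by
        refine add_le_add (le_mul_of_one_le_right (by positivity) hd3) ?_
        gcongr
      _ = _ := by ring

theorem exists_gammaDensity_lipschitz (B : ℝ) : ∃ C, 0 < C ∧ ∀ s ∈ Set.Icc 1 B, ∀ y v : ℝ,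
    1 / 4 ≤ y → 1 / 4 ≤ v → |gammaDensity s v - gammaDensity s y| ≤ C * |v - y| := by
  obtain ⟨C₁, hC₁, h₁⟩ := exists_abs_gammaDensityDeriv_le B
  refine ⟨C₁, hC₁, fun s hs y v hy hv => ?_⟩
  exact (convex_Ici (1 / 4 : ℝ)).norm_image_sub_le_of_norm_hasDerivWithin_le
    (fun z hz => (hasDerivAt_gammaDensity s
      (lt_of_lt_of_le (by norm_num) (Set.mem_Ici.1 hz))).hasDerivWithinAt)
    (fun z hz => (h₁ s hs z hz).1) hy hv

/-! ### Characteristic function of the Gamma law. -/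

section GammaFourier

open MeasureTheory

theorem norm_exp_neg_linFactor_mul (α t v : ℝ) :
    ‖Complex.exp (-(linFactor α t * v))‖ = Real.exp (-v) := by
  rw [Complex.norm_exp]; simp

theorem integrableOn_gammaKernel {s : ℝ} (hs : 0 < s) (t : ℝ) :
    IntegrableOn (fun v : ℝ => ((v ^ (s - 1) : ℝ) : ℂ) * Complex.exp (-(linFactor 1 t * v)))
      (Set.Ioi 0) := by
  refine Integrable.mono' (Real.GammaIntegral_convergent hs) ?_ ?_
  · exact Measurable.aestronglyMeasurable (by fun_prop)
  · refine (ae_restrict_iff' measurableSet_Ioi).2 (Eventually.of_forall fun v hv => ?_)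
    rw [norm_mul, norm_exp_neg_linFactor_mul, Complex.norm_real,
      Real.norm_of_nonneg (Real.rpow_nonneg (Set.mem_Ioi.1 hv).le _), mul_comm]

/-- The derivative of `v^s exp(-uv)` has integral zero over the half-line. -/
theorem linFactor_mul_integral_gammaKernel {s : ℝ} (hs : 0 < s) (t : ℝ) :
    linFactor 1 t * ∫ v in Set.Ioi (0 : ℝ),
        ((v ^ s : ℝ) : ℂ) * Complex.exp (-(linFactor 1 t * v)) =
      s * ∫ v in Set.Ioi (0 : ℝ),
        ((v ^ (s - 1) : ℝ) : ℂ) * Complex.exp (-(linFactor 1 t * v)) := by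
  have i1 := integrableOn_gammaKernel hs t
  have i2 := integrableOn_gammaKernel (s := s + 1) (by linarith) t
  rw [add_sub_cancel_right] at i2
  have h := integral_Ioi_of_hasDerivAt_of_tendsto (a := 0) (m := (0 : ℂ))
    (f := fun v : ℝ => ((v ^ s : ℝ) : ℂ) * Complex.exp (-(linFactor 1 t * v)))
    (f' := fun v : ℝ => s * (((v ^ (s - 1) : ℝ) : ℂ) * Complex.exp (-(linFactor 1 t * v))) -
      linFactor 1 t * (((v ^ s : ℝ) : ℂ) * Complex.exp (-(linFactor 1 t * v))))
    ?_ ?_ ((i1.const_mul _).sub (i2.const_mul _)) ?_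
  · rw [integral_sub (i1.const_mul _) (i2.const_mul _), integral_const_mul,
      integral_const_mul] at h
    simp only [Complex.ofReal_zero, mul_zero, Real.zero_rpow hs.ne', zero_mul, sub_zero] at h
    exact (sub_eq_zero.1 h).symm
  · have : Continuous fun v : ℝ => v ^ s := Real.continuous_rpow_const hs.le
    exact Continuous.continuousWithinAt (by fun_prop)
  · intro v hv
    have h1 := (Real.hasDerivAt_rpow_const (x := v) (p := s) (Or.inl (Set.mem_Ioi.1 hv).ne')).ofReal_comp
    have h2 := (((hasDerivAt_id v).ofReal_comp.const_mul (linFactor 1 t)).neg).cexp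
    refine (h1.mul h2).congr_deriv ?_
    simp
    ring
  · rw [tendsto_zero_iff_norm_tendsto_zero]
    refine (tendsto_rpow_mul_exp_neg_mul_atTop_nhds_zero s 1 one_pos).congr' ?_
    filter_upwards [eventually_gt_atTop 0] with v hv
    rw [norm_mul, norm_exp_neg_linFactor_mul, Complex.norm_real,
      Real.norm_of_nonneg (Real.rpow_nonneg hv.le _), neg_one_mul]

theorem hasDerivAt_integral_gammaKernel {s : ℝ} (hs : 0 < s) (t : ℝ) :
    HasDerivAt (fun t => ∫ v in Set.Ioi (0 : ℝ),
        ((v ^ (s - 1) : ℝ) : ℂ) * Complex.exp (-(linFactor 1 t * v)))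
      (Complex.I * ∫ v in Set.Ioi (0 : ℝ),
        ((v ^ s : ℝ) : ℂ) * Complex.exp (-(linFactor 1 t * v))) t := by
  have i2 : IntegrableOn (fun v : ℝ => Real.exp (-v) * v ^ s) (Set.Ioi 0) := by
    have := Real.GammaIntegral_convergent (s := s + 1) (by linarith)
    rwa [add_sub_cancel_right] at this
  rw [← integral_const_mul]
  refine (hasDerivAt_integral_of_dominated_loc_of_deriv_le (s := Set.univ)
    (F := fun t v => ((v ^ (s - 1) : ℝ) : ℂ) * Complex.exp (-(linFactor 1 t * v)))
    (F' := fun t v => Complex.I * (((v ^ s : ℝ) : ℂ) * Complex.exp (-(linFactor 1 t * v))))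
    Filter.univ_mem (Eventually.of_forall fun t => (integrableOn_gammaKernel hs t).1)
    (integrableOn_gammaKernel hs t) (Measurable.aestronglyMeasurable (by fun_prop)) ?_ i2 ?_).2
  · refine (ae_restrict_iff' measurableSet_Ioi).2 (Eventually.of_forall fun v hv t _ => ?_)
    rw [norm_mul, norm_mul, norm_exp_neg_linFactor_mul, Complex.norm_real,
      Real.norm_of_nonneg (Real.rpow_nonneg (Set.mem_Ioi.1 hv).le _), mul_comm (v ^ s)]
    simp
  · refine (ae_restrict_iff' measurableSet_Ioi).2 (Eventually.of_forall fun v hv t _ => ?_)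
    have h := ((((hasDerivAt_linFactor (α := 1) t).mul_const (v : ℂ)).neg).cexp).const_mul
      ((v ^ (s - 1) : ℝ) : ℂ)
    refine h.congr_deriv ?_
    have : v ^ s = v ^ (s - 1) * v := by
      rw [Real.rpow_sub_one (Set.mem_Ioi.1 hv).ne']
      field_simp [(Set.mem_Ioi.1 hv).ne']
    rw [this]
    simp only [Pi.neg_apply]
    push_cast
    ring

theorem hasDerivAt_cpow_const_of_mem_slitPlane {f : ℝ → ℂ} {f' : ℂ} {t : ℝ} (hf : HasDerivAt f f' t)
    (ht : f t ∈ Complex.slitPlane) (c : ℂ) :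
    HasDerivAt (fun t => f t ^ c) (c * f t ^ (c - 1) * f') t := by
  have h := (hasDerivAt_id (f t)).cpow_const (c := c) ht
  have := h.comp t hf
  simpa [Function.comp_def] using this

/-- Differentiation under the integral and integration by parts give `Φ' = i s Φ / u`. Hence `Φ u^s`
is constant, and its value at `t = 0` is `Γ(s)`; the principal power is smooth because `u` has real
part `1`. -/
theorem integral_gammaKernel {s : ℝ} (hs : 0 < s) (t : ℝ) :
    ∫ v in Set.Ioi (0 : ℝ), ((v ^ (s - 1) : ℝ) : ℂ) * Complex.exp (-(linFactor 1 t * v)) =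
      Real.Gamma s * linFactor 1 t ^ (-s : ℂ) := by
  set Φ := fun t => ∫ v in Set.Ioi (0 : ℝ),
    ((v ^ (s - 1) : ℝ) : ℂ) * Complex.exp (-(linFactor 1 t * v)) with hΦ
  have hder : ∀ t, HasDerivAt (fun t => Φ t * linFactor 1 t ^ (s : ℂ)) 0 t := by
    intro t
    have h1 := hasDerivAt_integral_gammaKernel hs t
    have h2 := hasDerivAt_cpow_const_of_mem_slitPlane (hasDerivAt_linFactor (α := 1) t)
      (linFactor_mem_slitPlane t) (s : ℂ)
    refine (h1.mul h2).congr_deriv ?_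
    have h3 := linFactor_mul_integral_gammaKernel hs t
    have hu := linFactor_ne_zero (α := 1) t
    rw [Complex.cpow_sub _ _ hu, Complex.cpow_one]
    rw [mul_comm, ← eq_div_iff hu] at h3
    rw [h3]
    push_cast
    field_simp
    ring
  have hconst := is_const_of_deriv_eq_zero (fun t => (hder t).differentiableAt)
    (fun t => (hder t).deriv) t 0
  have h0 : Φ 0 = Real.Gamma s := by
    have : linFactor 1 0 = 1 := by simp [linFactor]
    simp only [hΦ, this]
    rw [Real.Gamma_eq_integral hs, ← integral_complex_ofReal]
    refine setIntegral_congr_fun measurableSet_Ioi fun v _ => ?_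
    push_cast
    rw [one_mul, mul_comm]
  have hu := linFactor_ne_zero (α := 1) t
  change Φ t = _
  have e : Φ t = Φ t * linFactor 1 t ^ (s : ℂ) * linFactor 1 t ^ (-s : ℂ) := by
    rw [mul_assoc, ← Complex.cpow_add _ _ hu]; simp
  rw [e, hconst, h0]
  simp [linFactor]

theorem integral_gammaDensity_mul_exp {s : ℝ} (hs : 0 < s) (t : ℝ) :
    ∫ v, (gammaDensity s v : ℂ) * Complex.exp (Complex.I * t * v) = linFactor 1 t ^ (-s : ℂ) := by
  have hΓ : (Real.Gamma s : ℂ) ≠ 0 := by exact_mod_cast (Real.Gamma_pos_of_pos hs).ne'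
  have h := integral_gammaKernel hs t
  rw [← integral_indicator measurableSet_Ioi] at h
  calc _ = ∫ v, (1 / Real.Gamma s : ℂ) * (Set.Ioi (0 : ℝ)).indicator
        (fun v : ℝ => ((v ^ (s - 1) : ℝ) : ℂ) * Complex.exp (-(linFactor 1 t * v))) v := by
        congr 1
        ext v
        by_cases hv : 0 < v
        · rw [Set.indicator_of_mem (Set.mem_Ioi.2 hv), gammaDensity_of_pos hv]
          have : Complex.exp (-(linFactor 1 t * v)) =
              Complex.exp (-(v : ℂ)) * Complex.exp (Complex.I * t * v) := by
            rw [← Complex.exp_add]; congr 1; simp [linFactor]; ring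
          rw [this]
          push_cast
          field_simp
        · rw [Set.indicator_of_notMem (by simpa using hv), gammaDensity, if_neg hv]
          simp
    _ = _ := by
        rw [integral_const_mul, h]
        field_simp

theorem integrable_gammaDensity {s : ℝ} (hs : 0 < s) : Integrable (gammaDensity s) := by
  have h := (Real.GammaIntegral_convergent hs).const_mul (1 / Real.Gamma s)
  refine ((integrable_indicator_iff measurableSet_Ioi).2 h).congr (Eventually.of_forall fun v => ?_)
  by_cases hv : 0 < v
  · rw [Set.indicator_of_mem (Set.mem_Ioi.2 hv), gammaDensity_of_pos hv]
    ring
  · rw [Set.indicator_of_notMem (by simpa using hv), gammaDensity, if_neg hv]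

end GammaFourier

/-! ### Gaussian smoothing of the Gamma density. -/

section GaussianSmoothing

open MeasureTheory ProbabilityTheory

theorem integral_exp_mul_gaussian {x : ℝ} (hx : 0 < x) (y v : ℝ) :
    ∫ t : ℝ, Complex.exp (Complex.I * t * (v - y)) * Complex.exp (-(x ^ 2 * t ^ 2 / 2)) =
      2 * Real.pi * gaussianPDFReal y (x ^ 2).toNNReal v := by
  have hb : 0 < ((x ^ 2 / 2 : ℝ) : ℂ).re := by rw [Complex.ofReal_re]; positivity
  have h := fourierIntegral_gaussian hb ((v - y : ℝ) : ℂ)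
  have e : ∀ t : ℝ, Complex.exp (Complex.I * t * (v - y)) * Complex.exp (-(x ^ 2 * t ^ 2 / 2)) =
      Complex.exp (Complex.I * ((v - y : ℝ) : ℂ) * t) *
        Complex.exp (-((x ^ 2 / 2 : ℝ) : ℂ) * t ^ 2) := by
    intro t; congr 2 <;> push_cast <;> ring
  simp_rw [e]
  rw [h, gaussianPDFReal_def]
  have hv : ((x ^ 2).toNNReal : ℝ) = x ^ 2 := Real.coe_toNNReal _ (sq_nonneg _)
  simp only [hv]
  have e1 : ((Real.pi : ℂ) / ((x ^ 2 / 2 : ℝ) : ℂ)) ^ (1 / 2 : ℂ) =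
      ((√(2 * Real.pi) / x : ℝ) : ℂ) := by
    rw [show (Real.pi : ℂ) / ((x ^ 2 / 2 : ℝ) : ℂ) = ((2 * Real.pi / x ^ 2 : ℝ) : ℂ) by
      push_cast; field_simp, show (1 / 2 : ℂ) = ((1 / 2 : ℝ) : ℂ) by push_cast; ring,
      ← Complex.ofReal_cpow (by positivity), ← Real.sqrt_eq_rpow, Real.sqrt_div (by positivity),
      Real.sqrt_sq hx.le]
  rw [e1]
  have e2 : √(2 * Real.pi * x ^ 2) = √(2 * Real.pi) * x := by
    rw [Real.sqrt_mul (by positivity), Real.sqrt_sq hx.le]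
  rw [e2]
  have e3 : Complex.exp (-((v - y : ℝ) : ℂ) ^ 2 / (4 * ((x ^ 2 / 2 : ℝ) : ℂ))) =
      ((Real.exp (-(v - y) ^ 2 / (2 * x ^ 2)) : ℝ) : ℂ) := by
    push_cast; congr 1; field_simp; ring
  rw [e3]
  norm_cast
  have hs : 0 < √(2 * Real.pi) := by positivity
  have hs2 : √(2 * Real.pi) ^ 2 = 2 * Real.pi := Real.sq_sqrt (by positivity)
  field_simp
  rw [hs2]

theorem integrable_exp_neg_sq {x : ℝ} (hx : 0 < x) :
    Integrable fun t : ℝ => Real.exp (-(x ^ 2 * t ^ 2 / 2)) := by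
  refine (integrable_exp_neg_mul_sq (b := x ^ 2 / 2) (by positivity)).congr
    (Eventually.of_forall fun t => ?_)
  simp only
  congr 1; ring

/-- Parseval by Fubini: writing `u^{-s}` as the transform of the Gamma density, the inner integral
in `t` is `2π` times the Gaussian density with mean `y` and variance `x²`. -/
theorem integral_linFactor_cpow_mul_gaussian {s x : ℝ} (hs : 0 < s) (hx : 0 < x) (y : ℝ) :
    ∫ t : ℝ, Complex.exp (-(Complex.I * y * t)) * linFactor 1 t ^ (-s : ℂ) *
        Complex.exp (-(x ^ 2 * t ^ 2 / 2)) =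
      2 * Real.pi * ∫ v, gammaDensity s v ∂gaussianReal y (x ^ 2).toNNReal := by
  have hv0 : (x ^ 2).toNNReal ≠ 0 := by
    rw [Ne, Real.toNNReal_eq_zero]; have := sq_pos_of_pos hx; linarith
  rw [integral_gaussianReal_eq_integral_smul hv0, ← integral_complex_ofReal]
  have hint : Integrable (Function.uncurry fun (t v : ℝ) =>
      Complex.exp (-(Complex.I * y * t)) * ((gammaDensity s v : ℂ) *
        Complex.exp (Complex.I * t * v)) * Complex.exp (-(x ^ 2 * t ^ 2 / 2)))
      (volume.prod volume) := by
    refine Integrable.mono' ((integrable_exp_neg_sq hx).mul_prod (integrable_gammaDensity hs)) ?_ ?_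
    · have := measurable_gammaDensity s
      refine Measurable.aestronglyMeasurable ?_
      unfold Function.uncurry
      fun_prop
    · refine Eventually.of_forall fun z => ?_
      simp only [Function.uncurry]
      rw [norm_mul, norm_mul, norm_mul, Complex.norm_exp, Complex.norm_exp, Complex.norm_exp,
        Complex.norm_real, Real.norm_of_nonneg (gammaDensity_nonneg hs _)]
      have : (-((x : ℂ) ^ 2 * (z.1 : ℂ) ^ 2 / 2)).re = -(x ^ 2 * z.1 ^ 2 / 2) := by
        rw [show (-((x : ℂ) ^ 2 * (z.1 : ℂ) ^ 2 / 2)) = ((-(x ^ 2 * z.1 ^ 2 / 2) : ℝ) : ℂ) by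
          push_cast; ring, Complex.ofReal_re]
      rw [this]
      simp [mul_comm]
  have hswap := integral_integral_swap hint
  calc _ = ∫ t : ℝ, ∫ v : ℝ, Complex.exp (-(Complex.I * y * t)) * ((gammaDensity s v : ℂ) *
        Complex.exp (Complex.I * t * v)) * Complex.exp (-(x ^ 2 * t ^ 2 / 2)) := by
        congr 1; ext t
        rw [integral_mul_const, integral_const_mul, integral_gammaDensity_mul_exp hs]
    _ = _ := hswap
    _ = ∫ v : ℝ, 2 * Real.pi *
        ((gaussianPDFReal y (x ^ 2).toNNReal v • gammaDensity s v : ℝ) : ℂ) := by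
        congr 1; ext v
        have e : ∀ t : ℝ, Complex.exp (-(Complex.I * y * t)) * ((gammaDensity s v : ℂ) *
            Complex.exp (Complex.I * t * v)) * Complex.exp (-(x ^ 2 * t ^ 2 / 2)) =
            gammaDensity s v * (Complex.exp (Complex.I * t * (v - y)) *
              Complex.exp (-(x ^ 2 * t ^ 2 / 2))) := by
          intro t
          have : Complex.exp (Complex.I * t * (v - y)) =
              Complex.exp (-(Complex.I * y * t)) * Complex.exp (Complex.I * t * v) := by
            rw [← Complex.exp_add]; congr 1; ring
          rw [this]; ring
        simp_rw [e]
        rw [integral_const_mul, integral_exp_mul_gaussian hx, smul_eq_mul]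
        push_cast; ring
    _ = _ := by rw [integral_const_mul]

theorem integral_linFactor_cpow_mul_gaussian_scaled {s α τ : ℝ} (hs : 0 < s) (hα : 0 < α)
    (hτ : 0 < τ) (y : ℝ) :
    ∫ θ : ℝ, Complex.exp (-(Complex.I * y * α * θ)) * linFactor α θ ^ (-s : ℂ) *
        Complex.exp (-(τ ^ 2 * θ ^ 2 / 2)) =
      2 * Real.pi / α * ∫ v, gammaDensity s v ∂gaussianReal y ((τ / α) ^ 2).toNNReal := by
  have h := integral_linFactor_cpow_mul_gaussian hs (div_pos hτ hα) y
  have h2 := Measure.integral_comp_mul_left (fun t : ℝ => Complex.exp (-(Complex.I * y * t)) *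
    linFactor 1 t ^ (-s : ℂ) * Complex.exp (-(((τ / α : ℝ) : ℂ) ^ 2 * t ^ 2 / 2))) α
  rw [h] at h2
  have hα' : (α : ℂ) ≠ 0 := by exact_mod_cast hα.ne'
  calc _ = _ := by
        congr 1; ext θ
        congr 2
        · congr 2; push_cast; ring
        · congr 1; unfold linFactor; push_cast; ring
        · push_cast; field_simp
    _ = _ := h2
    _ = _ := by
        rw [abs_of_pos (inv_pos.2 hα), Complex.real_smul]
        push_cast
        field_simp

theorem abs_integral_gammaDensity_le {s C : ℝ} (hs : 0 < s) (hC : ∀ v, gammaDensity s v ≤ C)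
    (y : ℝ) (w : NNReal) : |∫ v, gammaDensity s v ∂gaussianReal y w| ≤ C := by
  have := norm_integral_le_of_norm_le_const (μ := gaussianReal y w) (f := gammaDensity s) (C := C)
    (Eventually.of_forall fun v => by
      rw [Real.norm_of_nonneg (gammaDensity_nonneg hs v)]; exact hC v)
  simpa using this

/-- The linear Taylor term has mean zero under a Gaussian centred at `y`, so the error is the
variance and not the standard deviation. This is the source of `(σ/α)^2` in the error rate. -/
theorem abs_integral_gammaDensity_sub_le {s C y : ℝ} (hs : 0 < s) (hCb : ∃ M, ∀ v, gammaDensity s v ≤ M)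
    (hC : ∀ v, |gammaDensity s v - gammaDensity s y - gammaDensityDeriv s y * (v - y)| ≤
      C * (v - y) ^ 2) (w : NNReal) :
    |∫ v, gammaDensity s v ∂gaussianReal y w - gammaDensity s y| ≤ C * w := by
  obtain ⟨M, hM⟩ := hCb
  have i0 : Integrable (gammaDensity s) (gaussianReal y w) :=
    Integrable.of_bound (measurable_gammaDensity s).aestronglyMeasurable M
      (Eventually.of_forall fun v => by
        rw [Real.norm_of_nonneg (gammaDensity_nonneg hs v)]; exact hM v)
  have i1 : Integrable (fun v => v - y) (gaussianReal y w) :=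
    ((memLp_id_gaussianReal 1).integrable le_rfl).sub (integrable_const y)
  have i2 : Integrable (fun v => (v - y) ^ 2) (gaussianReal y w) :=
    ((memLp_id_gaussianReal 2).sub (memLp_const y)).integrable_sq
  have e1 : ∫ v, (v - y) ∂gaussianReal y w = 0 := by
    rw [integral_sub (f := fun v => v) ((memLp_id_gaussianReal 1).integrable le_rfl)
      (integrable_const y)]
    simp
  have e2 : ∫ v, (v - y) ^ 2 ∂gaussianReal y w = w := by
    have h := variance_fun_id_gaussianReal (μ := y) (v := w)
    rw [variance_eq_integral (by fun_prop)] at h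
    simpa using h
  have e : ∫ v, gammaDensity s v ∂gaussianReal y w - gammaDensity s y =
      ∫ v, (gammaDensity s v - gammaDensity s y - gammaDensityDeriv s y * (v - y))
        ∂gaussianReal y w := by
    rw [integral_sub (f := fun v => gammaDensity s v - gammaDensity s y)
      (i0.sub (integrable_const _)) (i1.const_mul _),
      integral_sub i0 (integrable_const _), integral_const_mul, e1]
    simp
  rw [e, ← e2, ← integral_const_mul]
  exact norm_integral_le_of_norm_le (i2.const_mul C)
    (Eventually.of_forall fun v => (Real.norm_eq_abs _).trans_le (hC v))

end GaussianSmoothing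

/-! ### Integration by parts against the oscillation. -/

section LocalLimit

open MeasureTheory

theorem norm_integral_le_mul {b : ℝ → ℝ} {D : ℝ}
    (H : ∀ f : ℝ → ℂ, (∀ θ, ‖f θ‖ ≤ b θ) → ‖∫ θ, f θ‖ ≤ D) {M : ℝ} (hM : 0 ≤ M) {f : ℝ → ℂ}
    (hf : ∀ θ, ‖f θ‖ ≤ M * b θ) : ‖∫ θ, f θ‖ ≤ M * D := by
  rcases hM.eq_or_lt with rfl | hM
  · have : f = fun _ => 0 := by
      ext θ
      have := hf θ
      rw [zero_mul] at this
      simpa using this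
    simp [this]
  · have h := H (fun θ => (M : ℂ)⁻¹ * f θ) fun θ => by
      rw [norm_mul, norm_inv, Complex.norm_real, Real.norm_of_nonneg hM.le,
        inv_mul_le_iff₀ hM]
      exact hf θ
    rw [integral_const_mul, norm_mul, norm_inv, Complex.norm_real, Real.norm_of_nonneg hM.le,
      inv_mul_le_iff₀ hM] at h
    exact h

theorem intervalIntegral_pi_eq (f : ℝ → ℂ) :
    ∫ θ in (-Real.pi)..Real.pi, f θ = ∫ θ, (Set.Ioc (-Real.pi) Real.pi).indicator f θ := by
  rw [intervalIntegral.integral_of_le (by linarith [Real.pi_pos]),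
    integral_indicator measurableSet_Ioc]

theorem norm_intervalIntegral_le_mul {b : ℝ → ℝ} {D : ℝ} (hb : ∀ θ, 0 ≤ b θ)
    (H : ∀ f : ℝ → ℂ, (∀ θ, ‖f θ‖ ≤ b θ) → ‖∫ θ, f θ‖ ≤ D) {M : ℝ} (hM : 0 ≤ M) {f : ℝ → ℂ}
    (hf : ∀ θ, |θ| ≤ Real.pi → ‖f θ‖ ≤ M * b θ) :
    ‖∫ θ in (-Real.pi)..Real.pi, f θ‖ ≤ M * D := by
  rw [intervalIntegral_pi_eq]
  refine norm_integral_le_mul H hM fun θ => ?_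
  by_cases hθ : θ ∈ Set.Ioc (-Real.pi) Real.pi
  · rw [Set.indicator_of_mem hθ]
    exact hf θ (abs_le.2 ⟨hθ.1.le, hθ.2⟩)
  · rw [Set.indicator_of_notMem hθ, norm_zero]
    exact mul_nonneg hM (hb θ)

theorem norm_exp_neg_I_mul (y α θ : ℝ) : ‖Complex.exp (-(Complex.I * y * α * θ))‖ = 1 := by
  rw [show -(Complex.I * y * α * θ) = ((-(y * α * θ) : ℝ) : ℂ) * Complex.I by push_cast; ring]
  exact Complex.norm_exp_ofReal_mul_I _

theorem norm_linFactor_cpow (α θ s : ℝ) : ‖linFactor α θ ^ (-s : ℂ)‖ = ‖linFactor α θ‖ ^ (-s) := by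
  rw [← Complex.ofReal_neg, Complex.norm_cpow_real]

theorem norm_sub_one_le_of_deriv_le {h : ℝ → ℂ} {K : ℝ} (hd : Differentiable ℝ h) (h0 : h 0 = 1)
    (hK : ∀ θ, |θ| ≤ Real.pi → ‖deriv h θ‖ ≤ K) {θ : ℝ} (hθ : |θ| ≤ Real.pi) :
    ‖h θ - 1‖ ≤ K * |θ| := by
  have hpi := Real.pi_pos
  have := (convex_Icc (-Real.pi) Real.pi).norm_image_sub_le_of_norm_deriv_le (f := h) (C := K)
    (fun z _ => hd z) (fun z hz => hK z (abs_le.2 hz)) (x := 0) (y := θ)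
    ⟨by linarith, hpi.le⟩ (abs_le.1 hθ)
  rwa [h0, sub_zero, Real.norm_eq_abs] at this

theorem mul_exp_neg_half_le (z : ℝ) : z * Real.exp (-(z / 2)) ≤ 2 := by
  have := Real.add_one_le_exp (z / 2)
  rw [Real.exp_neg, ← div_eq_mul_inv, div_le_iff₀ (Real.exp_pos _)]
  linarith

/-- The antiderivative of `exp(-iyαθ)` is at most `2/α`, which gains one factor `1/α`. The other
comes from the integral of `‖u‖^{-3/2}` and, in the boundary terms, from `‖u‖^{-s} ≤ 1/(α|θ|)`. -/
theorem norm_integral_oscillatory_le {h : ℝ → ℂ} {K s α τ y B : ℝ} (hK0 : 0 ≤ K)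
    (hd : Differentiable ℝ h) (h0 : h 0 = 1) (hK : ∀ θ, |θ| ≤ Real.pi → ‖deriv h θ‖ ≤ K)
    (hs : 3 / 2 ≤ s) (hsB : s ≤ B) (hα : 1 ≤ α) (hy : 1 / 2 ≤ y) :
    ‖∫ θ in (-Real.pi)..Real.pi, linFactor α θ ^ (-s : ℂ) * (h θ - 1) *
        Complex.exp (-(τ ^ 2 * θ ^ 2 / 2)) * Complex.exp (-(Complex.I * y * α * θ))‖ ≤
      (4 * K + 2 * K * (B + 3) * bracketIntegral) / α ^ 2 := by
  have hα0 : 0 < α := by linarith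
  have hy0 : 0 < y := by linarith
  have hB0 : 0 ≤ B + 3 := by linarith
  set c : ℂ := -(Complex.I * y * α) with hc
  have hc0 : c ≠ 0 := by simp [hc, hy0.ne', hα0.ne']
  have hcn : ‖c‖⁻¹ ≤ 2 / α := by
    have : ‖c‖ = y * α := by simp [hc, abs_of_pos hy0, abs_of_pos hα0]
    rw [this, inv_le_comm₀ (by positivity) (by positivity), inv_div]
    nlinarith
  set W : ℝ → ℂ := fun θ => linFactor α θ ^ (-s : ℂ) * (h θ - 1) *
        Complex.exp (-(τ ^ 2 * θ ^ 2 / 2)) with hW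
  set v : ℝ → ℂ := fun θ => c⁻¹ * Complex.exp (c * θ) with hv
  set W' : ℝ → ℂ := fun θ =>
    ((-s : ℂ) * linFactor α θ ^ (-s - 1 : ℂ) * (-(Complex.I * α)) * (h θ - 1) +
      linFactor α θ ^ (-s : ℂ) * deriv h θ) * Complex.exp (-(τ ^ 2 * θ ^ 2 / 2)) +
    linFactor α θ ^ (-s : ℂ) * (h θ - 1) *
      (Complex.exp (-(τ ^ 2 * θ ^ 2 / 2)) * (-(τ ^ 2 * θ))) with hW'
  have hvn : ∀ θ, ‖v θ‖ ≤ 2 / α := by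
    intro θ
    have e : c * θ = -(Complex.I * y * α * θ) := by rw [hc]; ring
    simp only [hv]
    rw [norm_mul, e, norm_exp_neg_I_mul, mul_one, norm_inv]
    exact hcn
  have hWd : ∀ θ, HasDerivAt W (W' θ) θ := by
    intro θ
    have h1 := hasDerivAt_cpow_const_of_mem_slitPlane (hasDerivAt_linFactor (α := α) θ)
      (linFactor_mem_slitPlane θ) (-s : ℂ)
    have h2 := (hd θ).hasDerivAt.sub_const 1
    have h3 : HasDerivAt (fun θ : ℝ => Complex.exp (-(τ ^ 2 * θ ^ 2 / 2)))
        (Complex.exp (-(τ ^ 2 * θ ^ 2 / 2)) * (-(τ ^ 2 * θ))) θ := by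
      have h4 := ((((hasDerivAt_id θ).pow 2).const_mul (τ ^ 2)).div_const 2).neg.ofReal_comp.cexp
      have e : ∀ z : ℝ, (((-fun x : ℝ => τ ^ 2 * (id ^ 2 : ℝ → ℝ) x / 2) z : ℝ) : ℂ) =
          -(τ ^ 2 * z ^ 2 / 2) := by
        intro z; simp
      simp only [e] at h4
      refine h4.congr_deriv ?_
      simp
      ring
    exact (h1.mul h2).mul h3
  have hvd : ∀ θ : ℝ, HasDerivAt v (Complex.exp (c * θ)) θ := by
    intro θ
    have h4 := (((hasDerivAt_id θ).ofReal_comp.const_mul c).cexp).const_mul c⁻¹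
    refine h4.congr_deriv ?_
    simp
    field_simp
  have hEn : ∀ θ : ℝ, ‖Complex.exp (-((τ : ℂ) ^ 2 * (θ : ℂ) ^ 2 / 2))‖ = Real.exp (-(τ ^ 2 * θ ^ 2 / 2)) := by
    intro θ
    rw [show (-((τ : ℂ) ^ 2 * (θ : ℂ) ^ 2 / 2)) = ((-(τ ^ 2 * θ ^ 2 / 2) : ℝ) : ℂ) by
          push_cast; ring, Complex.norm_exp_ofReal]
  have hE1 : ∀ θ : ℝ, Real.exp (-(τ ^ 2 * θ ^ 2 / 2)) ≤ 1 := fun θ =>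
    Real.exp_le_one_iff.2 (neg_nonpos.2 (by positivity))
  -- `B + 3` is `s + 1 + 2`: differentiating `u^{-s}` gives `sK` since `α|θ| ≤ ‖u‖`, differentiating
  -- `h` gives `K`, and differentiating the Gaussian gives `2K` since `z exp(-z/2) ≤ 2` for `z =
  -- τ²θ²`.
  have hW'n : ∀ θ, |θ| ≤ Real.pi → ‖W' θ‖ ≤ K * (B + 3) * ‖linFactor α θ‖ ^ (-(3 / 2) : ℝ) := by
    intro θ hθ
    have hh := norm_sub_one_le_of_deriv_le hd h0 hK hθ
    have hu := norm_linFactor_pos (α := α) θ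
    have hule := abs_le_norm_linFactor (α := α) θ
    have hs32 := norm_linFactor_rpow_le (α := α) θ hs
    have hu1 : ‖linFactor α θ ^ (-s - 1 : ℂ)‖ = ‖linFactor α θ‖ ^ (-s) / ‖linFactor α θ‖ := by
      rw [← Real.rpow_sub_one hu.ne', ← Complex.norm_cpow_real]; push_cast; rfl
    set U := ‖linFactor α θ‖ with hU
    have t1 : ‖(-s : ℂ) * linFactor α θ ^ (-s - 1 : ℂ) * (-(Complex.I * α)) * (h θ - 1)‖ ≤
        U ^ (-s) * (s * K) := by
      rw [norm_mul, norm_mul, norm_mul, hu1, norm_neg, norm_neg, norm_mul, Complex.norm_I, one_mul,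
        Complex.norm_real, Complex.norm_real, Real.norm_of_nonneg (by linarith : 0 ≤ s),
        Real.norm_of_nonneg hα0.le]
      calc _ ≤ s * (U ^ (-s) / U) * α * (K * |θ|) := by gcongr
        _ = s * (U ^ (-s) / U) * K * (α * |θ|) := by ring
        _ ≤ s * (U ^ (-s) / U) * K * U := by
          have : 0 ≤ s := by linarith
          gcongr
        _ = _ := by field_simp
    have t2 : ‖linFactor α θ ^ (-s : ℂ) * deriv h θ‖ ≤ U ^ (-s) * K := by
      rw [norm_mul, norm_linFactor_cpow]
      have := hK θ hθ
      gcongr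
    have t3 : ‖linFactor α θ ^ (-s : ℂ) * (h θ - 1) *
        (Complex.exp (-(τ ^ 2 * θ ^ 2 / 2)) * (-(τ ^ 2 * θ)))‖ ≤ U ^ (-s) * (K * 2) := by
      have e4 : ‖-((τ : ℂ) ^ 2 * (θ : ℂ))‖ = τ ^ 2 * |θ| := by
        rw [norm_neg, norm_mul, norm_pow, Complex.norm_real, Complex.norm_real, Real.norm_eq_abs,
          Real.norm_eq_abs, sq_abs]
      rw [norm_mul, norm_mul, norm_mul, norm_linFactor_cpow, hEn, e4]
      calc _ ≤ U ^ (-s) * (K * |θ|) * (Real.exp (-(τ ^ 2 * θ ^ 2 / 2)) * (τ ^ 2 * |θ|)) := by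
            gcongr
        _ = U ^ (-s) * (K * (τ ^ 2 * |θ| ^ 2 * Real.exp (-(τ ^ 2 * θ ^ 2 / 2)))) := by ring
        _ ≤ _ := by
          have := mul_exp_neg_half_le (τ ^ 2 * θ ^ 2)
          rw [sq_abs]
          gcongr
    simp only [hW']
    refine (norm_add_le _ _).trans ?_
    rw [norm_mul, hEn]
    have t12 := (norm_add_le _ _).trans (add_le_add t1 t2)
    have hUs : 0 ≤ U ^ (-s) := by positivity
    calc _ ≤ (U ^ (-s) * (s * K) + U ^ (-s) * K) * 1 + U ^ (-s) * (K * 2) := by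
          refine add_le_add (mul_le_mul t12 (hE1 θ) (Real.exp_pos _).le ?_) t3
          have : 0 ≤ s := by linarith
          positivity
      _ = K * (s + 3) * U ^ (-s) := by ring
      _ ≤ _ := by gcongr
  have hWb : ∀ θ, |θ| = Real.pi → ‖W θ‖ ≤ K / α := by
    intro θ hθ
    have hh := norm_sub_one_le_of_deriv_le hd h0 hK hθ.le
    have hθ0 : θ ≠ 0 := by
      rintro rfl; rw [abs_zero] at hθ; exact Real.pi_ne_zero hθ.symm
    have h1 := norm_linFactor_rpow_le_abs hα0 hθ0 zero_le_one (by linarith : (1 : ℝ) ≤ s)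
    rw [Real.rpow_neg_one, Real.rpow_neg_one] at h1
    simp only [hW]
    rw [norm_mul, norm_mul, norm_linFactor_cpow, hEn]
    calc _ ≤ α⁻¹ * |θ|⁻¹ * (K * |θ|) * 1 := by
          have := hE1 θ
          gcongr
      _ = _ := by
          have : 0 < |θ| := abs_pos.2 hθ0
          field_simp
  -- `deriv h` may be discontinuous, so integrability comes from measurability of derivatives and
  -- the domination just proved.
  have hWI : IntervalIntegrable W' volume (-Real.pi) Real.pi := by
    rw [intervalIntegrable_iff_integrableOn_Ioc_of_le (by linarith [Real.pi_pos])]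
    refine Integrable.mono' (((integrable_norm_linFactor_rpow hα0 (by norm_num)).const_mul
      (K * (B + 3))).integrableOn) ?_
      ((ae_restrict_iff' measurableSet_Ioc).2 (Eventually.of_forall fun θ hθ =>
        hW'n θ (abs_le.2 ⟨hθ.1.le, hθ.2⟩)))
    have m1 := (continuous_linFactor_cpow (α := α) (-s : ℂ)).measurable
    have m2 := (continuous_linFactor_cpow (α := α) (-s - 1 : ℂ)).measurable
    have m3 := hd.continuous.measurable
    have m4 := measurable_deriv h
    exact Measurable.aestronglyMeasurable (by fun_prop)
  have hparts := intervalIntegral.integral_mul_deriv_eq_deriv_mul (a := -Real.pi) (b := Real.pi)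
    (u := W) (v := v) (fun θ _ => hWd θ) (fun θ _ => hvd θ) hWI
    (Continuous.intervalIntegrable (u := fun θ : ℝ => Complex.exp (c * θ)) (by fun_prop) _ _)
  have e : ∀ θ : ℝ, linFactor α θ ^ (-s : ℂ) * (h θ - 1) *
        Complex.exp (-(τ ^ 2 * θ ^ 2 / 2)) * Complex.exp (-(Complex.I * y * α * θ)) =
        W θ * Complex.exp (c * θ) := by
    intro θ; simp only [hW, hc]; congr 2; ring
  simp_rw [e]
  rw [hparts]
  have hpi := Real.pi_pos
  have b1 := hWb Real.pi (abs_of_pos hpi)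
  have b2 := hWb (-Real.pi) (by rw [abs_neg, abs_of_pos hpi])
  have b3 : ‖∫ θ in (-Real.pi)..Real.pi, W' θ * v θ‖ ≤
      K * (B + 3) * (2 / α) * (1 * (bracketIntegral / α)) := by
    refine norm_intervalIntegral_le_mul (b := fun θ => 1 * ‖linFactor α θ‖ ^ (-(3 / 2) : ℝ))
      (fun θ => by positivity) (fun f hf => norm_integral_le_bracket hα0 hf) (by positivity) ?_
    intro θ hθ
    rw [norm_mul, one_mul]
    calc _ ≤ K * (B + 3) * ‖linFactor α θ‖ ^ (-(3 / 2) : ℝ) * (2 / α) := by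
          have := hW'n θ hθ
          have := hvn θ
          gcongr
      _ = _ := by ring
  calc _ ≤ ‖W Real.pi * v Real.pi‖ + ‖W (-Real.pi) * v (-Real.pi)‖ +
        ‖∫ θ in (-Real.pi)..Real.pi, W' θ * v θ‖ :=
        (norm_sub_le _ _).trans (add_le_add_left (norm_sub_le _ _) _)
    _ ≤ K / α * (2 / α) + K / α * (2 / α) +
        K * (B + 3) * (2 / α) * (1 * (bracketIntegral / α)) := by
        refine add_le_add (add_le_add ?_ ?_) b3
        · exact (norm_mul_le _ _).trans (mul_le_mul b1 (hvn _) (norm_nonneg _) (by positivity))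
        · exact (norm_mul_le _ _).trans (mul_le_mul b2 (hvn _) (norm_nonneg _) (by positivity))
    _ = _ := by field_simp; ring

end LocalLimit

/-! ### The local limit estimate at scale `α`. -/

section LocalLimit

open MeasureTheory

/-- The scales of a heavy traffic regime: `α` is the scale of the saturated queues, `σ` the
standard deviation of the others, `τ` a comparable standard deviation, `L` a Lyapounov ratio. -/
structure HeavyScales (r c α σ τ L : ℝ) : Prop where
  r_pos : 0 < r
  r_le : r ≤ 1
  c_pos : 0 < c
  c_le : c ≤ 1 / 8
  one_le_alpha : 1 ≤ α
  one_le_sigma : 1 ≤ σ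
  sigma_le : σ ≤ α
  le_one : L ≤ 1
  rpow_le : σ ^ (-r) ≤ 4 * L
  half_le : σ / 2 ≤ τ
  tau_le : τ ≤ σ

namespace HeavyScales

variable {r c α σ τ L : ℝ} (H : HeavyScales r c α σ τ L)
include H

theorem alpha_pos : 0 < α := one_pos.trans_le H.one_le_alpha

theorem sigma_pos : 0 < σ := one_pos.trans_le H.one_le_sigma

theorem tau_pos : 0 < τ := lt_of_lt_of_le (half_pos H.sigma_pos) H.half_le

theorem L_nonneg : 0 ≤ L := by
  have := H.rpow_le
  have := Real.rpow_nonneg H.sigma_pos.le (-r)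
  linarith

theorem ratio_pos : 0 < σ / α := div_pos H.sigma_pos H.alpha_pos

theorem ratio_le_one : σ / α ≤ 1 := (div_le_one H.alpha_pos).2 H.sigma_le

/-- This is where `r ≤ 1` and `σ ≥ 1` turn the bound on `σ^{-r}` into one on `1/σ`. -/
theorem inv_sigma_le : 1 / σ ≤ 4 * L := by
  refine le_trans ?_ H.rpow_le
  rw [one_div, ← Real.rpow_neg_one]
  exact Real.rpow_le_rpow_of_exponent_le H.one_le_sigma (by linarith [H.r_le])

theorem rpow_two_add_le : σ ^ (-(2 + r)) ≤ 4 * L :=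
  (Real.rpow_le_rpow_of_exponent_le H.one_le_sigma (by linarith)).trans H.rpow_le

theorem sq_le_heavyError (s : ℝ) : (σ / α) ^ 2 ≤ heavyError α σ L r s := by
  have := H.L_nonneg
  have := H.ratio_pos
  have := H.alpha_pos
  unfold heavyError
  have h1 : 0 ≤ 1 / α := by positivity
  have h2 : 0 ≤ L * (σ / α) ^ (2 + r) := by positivity
  have h3 : 0 ≤ L * (σ / α) ^ (s - 1) := by positivity
  linarith

theorem inv_le_heavyError (s : ℝ) : 1 / α ≤ heavyError α σ L r s := by
  have := H.L_nonneg
  have := H.ratio_pos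
  unfold heavyError
  have h1 : 0 ≤ (σ / α) ^ 2 := by positivity
  have h2 : 0 ≤ L * (σ / α) ^ (2 + r) := by positivity
  have h3 : 0 ≤ L * (σ / α) ^ (s - 1) := by positivity
  linarith

theorem rpow_le_heavyError (s : ℝ) : L * (σ / α) ^ (s - 1) ≤ heavyError α σ L r s := by
  have := H.L_nonneg
  have := H.ratio_pos
  have := H.alpha_pos
  unfold heavyError
  have h1 : 0 ≤ 1 / α := by positivity
  have h2 : 0 ≤ L * (σ / α) ^ (2 + r) := by positivity
  have h3 : 0 ≤ (σ / α) ^ 2 := by positivity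
  linarith

theorem heavyError_pos (s : ℝ) : 0 < heavyError α σ L r s :=
  (one_div_pos.2 H.alpha_pos).trans_le (H.inv_le_heavyError s)

theorem lyap_le_heavyError (s : ℝ) :
    L * ((σ / α) ^ (s - 1) + (σ / α) ^ 2) ≤ 2 * heavyError α σ L r s := by
  have h1 := H.rpow_le_heavyError s
  have h2 := H.sq_le_heavyError s
  have h3 : L * (σ / α) ^ 2 ≤ (σ / α) ^ 2 := mul_le_of_le_one_left (sq_nonneg _) H.le_one
  linarith

theorem heavyError_le {s : ℝ} (hs : 1 ≤ s) : heavyError α σ L r s ≤ 4 := by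
  have hx := H.ratio_pos.le
  have hx1 := H.ratio_le_one
  have h1 : (σ / α) ^ 2 ≤ 1 := pow_le_one₀ hx hx1
  have h2 : 1 / α ≤ 1 := by rw [div_le_one H.alpha_pos]; exact H.one_le_alpha
  have h3 : L * (σ / α) ^ (2 + r) ≤ 1 :=
    mul_le_one₀ H.le_one (by positivity) (Real.rpow_le_one hx hx1 (by linarith [H.r_pos]))
  have h4 : L * (σ / α) ^ (s - 1) ≤ 1 :=
    mul_le_one₀ H.le_one (by positivity) (Real.rpow_le_one hx hx1 (by linarith))
  unfold heavyError
  linarith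

theorem heavyError_anti {s s' : ℝ} (hs : s ≤ s') :
    heavyError α σ L r s' ≤ heavyError α σ L r s := by
  unfold heavyError
  have := H.L_nonneg
  have := Real.rpow_le_rpow_of_exponent_ge H.ratio_pos H.ratio_le_one (by linarith : s - 1 ≤ s' - 1)
  gcongr

/-- `c ≤ 1/8` and `τ ≥ σ/2` are matched so that the comparison Gaussian decays at least as fast as
the bound available for the true transform. -/
theorem exp_neg_le (θ : ℝ) :
    Real.exp (-(τ ^ 2 * θ ^ 2 / 2)) ≤ Real.exp (-(c * σ ^ 2 * θ ^ 2)) := by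
  refine Real.exp_le_exp.2 (neg_le_neg ?_)
  have h1 : (σ / 2) ^ 2 ≤ τ ^ 2 := pow_le_pow_left₀ (half_pos H.sigma_pos).le H.half_le 2
  have h2 := H.c_le
  calc c * σ ^ 2 * θ ^ 2 ≤ 1 / 8 * σ ^ 2 * θ ^ 2 := by gcongr
    _ = (σ / 2) ^ 2 * θ ^ 2 / 2 := by ring
    _ ≤ _ := by gcongr

end HeavyScales

theorem norm_cexp_neg_sq (τ θ : ℝ) : ‖Complex.exp (-((τ : ℂ) ^ 2 * (θ : ℂ) ^ 2 / 2))‖ =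
    Real.exp (-(τ ^ 2 * θ ^ 2 / 2)) := by
  rw [show (-((τ : ℂ) ^ 2 * (θ : ℂ) ^ 2 / 2)) = ((-(τ ^ 2 * θ ^ 2 / 2) : ℝ) : ℂ) by
        push_cast; ring, Complex.norm_exp_ofReal]

/-- Replacing the characteristic function of the non-saturated queues by a Gaussian one. -/
theorem exists_replace_gaussian_le {K c r : ℝ} (hK0 : 0 ≤ K) (hc : 0 < c) (hc8 : c ≤ 1 / 8)
    (hr : 0 < r) : ∃ C, 0 ≤ C ∧ ∀ s α σ τ L y : ℝ, HeavyScales r c α σ τ L → 1 ≤ s →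
      ∀ h φ : ℝ → ℂ, (∀ θ, |θ| ≤ Real.pi → ‖h θ‖ ≤ K) →
      (∀ θ, |θ| ≤ Real.pi → ‖φ θ - Complex.exp (-(τ ^ 2 * θ ^ 2 / 2))‖ ≤
        K * (L * σ ^ (2 + r) * |θ| ^ (2 + r) * Real.exp (-(c * σ ^ 2 * θ ^ 2)))) →
      ‖∫ θ in (-Real.pi)..Real.pi, Complex.exp (-(Complex.I * y * α * θ)) *
          linFactor α θ ^ (-s : ℂ) * h θ * (φ θ - Complex.exp (-(τ ^ 2 * θ ^ 2 / 2)))‖ ≤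
        C / α * heavyError α σ L r s := by
  obtain ⟨C, hC0, hC⟩ := exists_norm_integral_le_of_le_rpow (c := c) (r := r) hc (by linarith) hr
  refine ⟨2 * K ^ 2 * C, by positivity, fun s α σ τ L y H hs h φ hh hφ => ?_⟩
  have hα := H.alpha_pos
  have hσ := H.sigma_pos
  have hL := H.L_nonneg
  have hx := H.ratio_pos
  refine (norm_intervalIntegral_le_mul (M := K ^ 2 * (L * σ ^ (2 + r)))
    (fun θ => by positivity) (hC s α σ hs hα hσ H.sigma_le) (by positivity) ?_).trans ?_
  · intro θ hθ
    rw [norm_mul, norm_mul, norm_mul, norm_exp_neg_I_mul, norm_linFactor_cpow, one_mul]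
    have h1 := hh θ hθ
    have h2 := hφ θ hθ
    calc _ ≤ ‖linFactor α θ‖ ^ (-s) * K *
          (K * (L * σ ^ (2 + r) * |θ| ^ (2 + r) * Real.exp (-(c * σ ^ 2 * θ ^ 2)))) := by gcongr
      _ = _ := by ring
  · have e : σ ^ (2 + r) * σ ^ (-(2 + r)) = 1 := by rw [← Real.rpow_add hσ]; simp
    calc _ = K ^ 2 * C / α * (L * ((σ / α) ^ (s - 1) + (σ / α) ^ 2)) *
          (σ ^ (2 + r) * σ ^ (-(2 + r))) := by ring
      _ ≤ K ^ 2 * C / α * (2 * heavyError α σ L r s) * 1 := by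
          rw [e]
          have := H.lyap_le_heavyError s
          gcongr
      _ = _ := by ring

/-- The tail of the Gaussian integral. -/
theorem exists_gaussian_tail_le {c r : ℝ} (hc : 0 < c) (hc8 : c ≤ 1 / 8)
    (hr : 0 < r) : ∃ C, 0 ≤ C ∧ ∀ s α σ τ L y : ℝ, HeavyScales r c α σ τ L → 1 ≤ s →
      ‖(∫ θ in (-Real.pi)..Real.pi, Complex.exp (-(Complex.I * y * α * θ)) *
          linFactor α θ ^ (-s : ℂ) * Complex.exp (-(τ ^ 2 * θ ^ 2 / 2))) -
        ∫ θ : ℝ, Complex.exp (-(Complex.I * y * α * θ)) *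
          linFactor α θ ^ (-s : ℂ) * Complex.exp (-(τ ^ 2 * θ ^ 2 / 2))‖ ≤
        C / α * heavyError α σ L r s := by
  obtain ⟨C, hC0, hC⟩ := exists_norm_integral_le_of_le_rpow (c := c) (r := r) hc (by linarith) hr
  refine ⟨8 * C, by positivity, fun s α σ τ L y H hs => ?_⟩
  have hα := H.alpha_pos
  have hσ := H.sigma_pos
  have hL := H.L_nonneg
  have hx := H.ratio_pos
  set f : ℝ → ℂ := fun θ => Complex.exp (-(Complex.I * y * α * θ)) *
    linFactor α θ ^ (-s : ℂ) * Complex.exp (-(τ ^ 2 * θ ^ 2 / 2)) with hf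
  have hfn : ∀ θ, ‖f θ‖ = ‖linFactor α θ‖ ^ (-s) * Real.exp (-(τ ^ 2 * θ ^ 2 / 2)) := by
    intro θ
    rw [norm_mul, norm_mul, norm_exp_neg_I_mul, norm_linFactor_cpow, one_mul, norm_cexp_neg_sq]
  have hfi : Integrable f := by
    refine Integrable.mono' (integrable_exp_neg_sq H.tau_pos) ?_ (Eventually.of_forall fun θ => ?_)
    · have := continuous_linFactor_cpow (α := α) (-s : ℂ)
      exact Continuous.aestronglyMeasurable (by fun_prop)
    · rw [hfn]
      refine mul_le_of_le_one_left (Real.exp_pos _).le ?_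
      exact Real.rpow_le_one_of_one_le_of_nonpos (one_le_norm_linFactor θ) (by linarith)
  rw [intervalIntegral_pi_eq, ← integral_sub (hfi.indicator measurableSet_Ioc) hfi]
  refine (hC s α σ hs hα hσ H.sigma_le _ fun θ => ?_).trans ?_
  · by_cases hθ : θ ∈ Set.Ioc (-Real.pi) Real.pi
    · rw [Set.indicator_of_mem hθ, sub_self, norm_zero]
      positivity
    · rw [Set.indicator_of_notMem hθ, zero_sub, norm_neg, hfn]
      -- Outside `[-π, π]` the factor `|θ|^(2+r)` is at least `1` and can be inserted freely;
      -- `σ^{-(2+r)} ≤ 4L` then gives the tail a factor `L`.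
      have h1 : 1 ≤ |θ| := by
        have hpi := Real.pi_gt_three
        by_contra hlt
        rw [not_le, abs_lt] at hlt
        exact hθ ⟨by linarith, by linarith⟩
      have h2 : 1 ≤ |θ| ^ (2 + r) := Real.one_le_rpow h1 (by linarith)
      have h3 := H.exp_neg_le θ
      gcongr
      exact le_mul_of_one_le_right (by positivity) h2
  · have h1 := H.rpow_two_add_le
    have h2 := H.lyap_le_heavyError s
    calc _ ≤ C * (4 * L / α * ((σ / α) ^ (s - 1) + (σ / α) ^ 2)) := by gcongr
      _ = 4 * C / α * (L * ((σ / α) ^ (s - 1) + (σ / α) ^ 2)) := by ring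
      _ ≤ 4 * C / α * (2 * heavyError α σ L r s) := by gcongr
      _ = _ := by ring

/-- Removing a factor `h` with `h 0 = 1` and bounded derivative. -/
theorem exists_remove_factor_le {K c r B : ℝ} (hK0 : 0 ≤ K) (hB : 0 ≤ B) (hc : 0 < c)
    (hc8 : c ≤ 1 / 8) : ∃ C, 0 ≤ C ∧ ∀ s α σ τ L y : ℝ, HeavyScales r c α σ τ L → 1 ≤ s → s ≤ B →
      ∀ h : ℝ → ℂ, Differentiable ℝ h → h 0 = 1 → (∀ θ, |θ| ≤ Real.pi → ‖deriv h θ‖ ≤ K) →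
      (1 / 2 ≤ y → ‖∫ θ in (-Real.pi)..Real.pi, Complex.exp (-(Complex.I * y * α * θ)) *
          linFactor α θ ^ (-s : ℂ) * (h θ - 1) * Complex.exp (-(τ ^ 2 * θ ^ 2 / 2))‖ ≤
        C / α * heavyError α σ L r s) ∧
      ‖∫ θ in (-Real.pi)..Real.pi, Complex.exp (-(Complex.I * y * α * θ)) *
          linFactor α θ ^ (-s : ℂ) * (h θ - 1) * Complex.exp (-(τ ^ 2 * θ ^ 2 / 2))‖ ≤ C / α := by
  obtain ⟨C, hC0, hC⟩ := exists_norm_integral_le_of_le_exp (c := c) hc (by linarith)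
  have hbr := bracketIntegral_nonneg
  set C₁ := 16 * K * C with hC₁
  set C₂ := 4 * K + 2 * K * (B + 3) * bracketIntegral
  set C₃ := K * Real.pi * bracketIntegral
  have hpi := Real.pi_pos
  have p1 : 0 ≤ C₁ := by positivity
  have p2 : 0 ≤ C₂ := by positivity
  have p3 : 0 ≤ C₃ := by positivity
  refine ⟨C₁ + C₂ + C₃, by positivity, fun s α σ τ L y H hs hsB h hd h0 hK => ?_⟩
  have hα := H.alpha_pos
  have hσ := H.sigma_pos
  have hL := H.L_nonneg
  have hx := H.ratio_pos
  have hh := fun θ hθ => norm_sub_one_le_of_deriv_le (θ := θ) hd h0 hK hθ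
  have hHE := (H.heavyError_pos s).le
  -- For `s ≤ 3/2` absolute values suffice: `‖h - 1‖ ≤ K|θ| ≤ (K/α)‖u‖`, and the resulting `1/σ` is
  -- at most `4L`. For larger `s` the oscillation is used, which requires `y` away from `0`; without
  -- that, the integrable decay of `‖u‖^{-3/2}` still gives `C/α`.
  rcases le_or_gt s (3 / 2) with hs' | hs'
  · have key : ‖∫ θ in (-Real.pi)..Real.pi, Complex.exp (-(Complex.I * y * α * θ)) *
          linFactor α θ ^ (-s : ℂ) * (h θ - 1) * Complex.exp (-(τ ^ 2 * θ ^ 2 / 2))‖ ≤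
        4 * K * C / α * heavyError α σ L r s := by
      refine (norm_intervalIntegral_le_mul (M := K / α) (fun θ => by positivity)
        (hC s α σ hs hs' hα hσ) (by positivity) ?_).trans ?_
      · intro θ hθ
        rw [norm_mul, norm_mul, norm_mul, norm_exp_neg_I_mul, norm_linFactor_cpow, one_mul,
          norm_cexp_neg_sq]
        have h1 := hh θ hθ
        have h2 := H.exp_neg_le θ
        have hu := norm_linFactor_pos (α := α) θ
        have h3 : ‖linFactor α θ‖ ^ (-s) * (α * |θ|) ≤ ‖linFactor α θ‖ ^ (-(s - 1)) := by
          rw [show -(s - 1) = -s + 1 by ring, Real.rpow_add hu, Real.rpow_one]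
          have := abs_le_norm_linFactor (α := α) θ
          gcongr
        calc _ ≤ ‖linFactor α θ‖ ^ (-s) * (K * |θ|) * Real.exp (-(c * σ ^ 2 * θ ^ 2)) := by gcongr
          _ = K / α * ((‖linFactor α θ‖ ^ (-s) * (α * |θ|)) * Real.exp (-(c * σ ^ 2 * θ ^ 2))) := by
            field_simp
          _ ≤ _ := by gcongr
      · have h1 := H.inv_sigma_le
        have h2 := H.rpow_le_heavyError s
        calc _ = K * C / α * ((σ / α) ^ (s - 1) * (1 / σ)) := by ring
          _ ≤ K * C / α * ((σ / α) ^ (s - 1) * (4 * L)) := by gcongr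
          _ = 4 * K * C / α * (L * (σ / α) ^ (s - 1)) := by ring
          _ ≤ _ := by gcongr
    constructor
    · intro _
      refine key.trans ?_
      gcongr
      have : 0 ≤ K * C := by positivity
      linarith
    · refine key.trans ?_
      have := H.heavyError_le hs
      calc _ ≤ 4 * K * C / α * 4 := by gcongr
        _ = C₁ / α := by rw [hC₁]; ring
        _ ≤ _ := by gcongr; linarith
  · constructor
    · intro hy
      have h1 := norm_integral_oscillatory_le (τ := τ) hK0 hd h0 hK hs'.le hsB H.one_le_alpha hy
      have e : ∀ θ : ℝ, Complex.exp (-(Complex.I * y * α * θ)) *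
          linFactor α θ ^ (-s : ℂ) * (h θ - 1) * Complex.exp (-(τ ^ 2 * θ ^ 2 / 2)) =
          linFactor α θ ^ (-s : ℂ) * (h θ - 1) *
            Complex.exp (-(τ ^ 2 * θ ^ 2 / 2)) * Complex.exp (-(Complex.I * y * α * θ)) := by
        intro θ; ring
      simp_rw [e]
      refine h1.trans ?_
      have h2 := H.inv_le_heavyError s
      calc _ = C₂ / α * (1 / α) := by rw [div_mul_div_comm, mul_one, ← sq]
        _ ≤ (C₁ + C₂ + C₃) / α * heavyError α σ L r s := by gcongr; linarith
    · refine (norm_intervalIntegral_le_mul (M := K * Real.pi)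
        (b := fun θ => 1 * ‖linFactor α θ‖ ^ (-(3 / 2) : ℝ)) (fun θ => by positivity)
        (fun f hf => norm_integral_le_bracket hα hf) (by positivity) ?_).trans ?_
      · intro θ hθ
        rw [norm_mul, norm_mul, norm_mul, norm_exp_neg_I_mul, norm_linFactor_cpow, one_mul,
          norm_cexp_neg_sq]
        have h1 := hh θ hθ
        have h2 : Real.exp (-(τ ^ 2 * θ ^ 2 / 2)) ≤ 1 :=
          Real.exp_le_one_iff.2 (neg_nonpos.2 (by positivity))
        have h3 := norm_linFactor_rpow_le (α := α) θ hs'.le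
        calc _ ≤ ‖linFactor α θ‖ ^ (-(3 / 2) : ℝ) * (K * Real.pi) * 1 := by
              have : K * |θ| ≤ K * Real.pi := by gcongr
              have := h1.trans this
              gcongr
          _ = _ := by ring
      · calc _ = C₃ / α := by simp only [C₃]; ring
          _ ≤ _ := by gcongr; linarith

/-- The integrand splits as `P h (φ - E) + P (h - 1) E + P E`, with `P` the phase times `u^{-s}` and
`E` the Gaussian; the last part is the smoothed Gamma density up to its tail. The bound without
restriction on `y` serves evaluation points too far left for the expansion. -/
theorem exists_local_limit_le {B K c r : ℝ} (hB : 0 ≤ B) (hK0 : 0 ≤ K) (hc : 0 < c)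
    (hc8 : c ≤ 1 / 8) (hr : 0 < r) : ∃ C, 0 ≤ C ∧ ∀ s α σ τ L y : ℝ, HeavyScales r c α σ τ L →
      1 ≤ s → s ≤ B →
      ∀ h φ : ℝ → ℂ, Differentiable ℝ h → h 0 = 1 → (∀ θ, |θ| ≤ Real.pi → ‖deriv h θ‖ ≤ K) →
      Continuous φ →
      (∀ θ, |θ| ≤ Real.pi → ‖φ θ - Complex.exp (-(τ ^ 2 * θ ^ 2 / 2))‖ ≤
        K * (L * σ ^ (2 + r) * |θ| ^ (2 + r) * Real.exp (-(c * σ ^ 2 * θ ^ 2)))) →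
      (1 / 2 ≤ y → ‖(∫ θ in (-Real.pi)..Real.pi, Complex.exp (-(Complex.I * y * α * θ)) *
          linFactor α θ ^ (-s : ℂ) * h θ * φ θ) - 2 * Real.pi / α * gammaDensity s y‖ ≤
        C / α * heavyError α σ L r s) ∧
      ‖∫ θ in (-Real.pi)..Real.pi, Complex.exp (-(Complex.I * y * α * θ)) *
          linFactor α θ ^ (-s : ℂ) * h θ * φ θ‖ ≤ C / α := by
  have hpi := Real.pi_pos
  obtain ⟨C₁, hC₁0, hC₁⟩ := exists_replace_gaussian_le (K := 1 + K * Real.pi + K) (by positivity)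
    hc hc8 hr
  obtain ⟨C₂, hC₂0, hC₂⟩ := exists_remove_factor_le (r := r) hK0 hB hc hc8
  obtain ⟨C₃, hC₃0, hC₃⟩ := exists_gaussian_tail_le hc hc8 hr
  obtain ⟨C₄, hC₄0, hC₄⟩ := exists_gammaDensity_le B
  obtain ⟨C₅, hC₅0, hC₅⟩ := exists_gammaDensity_taylor_le B
  refine ⟨4 * C₁ + C₂ + 4 * C₃ + 2 * Real.pi * (C₄ + C₅), by positivity,
    fun s α σ τ L y H hs hsB h φ hd h0 hK hφc hφ => ?_⟩
  have hα := H.alpha_pos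
  have hσ := H.sigma_pos
  have hL := H.L_nonneg
  have hs0 : 0 < s := by linarith
  have hh : ∀ θ, |θ| ≤ Real.pi → ‖h θ‖ ≤ 1 + K * Real.pi + K := by
    intro θ hθ
    have h1 := norm_sub_one_le_of_deriv_le hd h0 hK hθ
    have h2 : K * |θ| ≤ K * Real.pi := by gcongr
    have h3 := norm_add_le (h θ - 1) 1
    rw [sub_add_cancel, norm_one] at h3
    linarith
  set P : ℝ → ℂ := fun θ => Complex.exp (-(Complex.I * y * α * θ)) * linFactor α θ ^ (-s : ℂ)
    with hP
  set E : ℝ → ℂ := fun θ => Complex.exp (-(τ ^ 2 * θ ^ 2 / 2)) with hE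
  have hPc : Continuous P := by
    have := continuous_linFactor_cpow (α := α) (-s : ℂ)
    fun_prop
  have hEc : Continuous E := by fun_prop
  have hhc := hd.continuous
  have r1 := hC₁ s α σ τ L y H hs h φ hh fun θ hθ => (hφ θ hθ).trans (by
    gcongr
    have : 0 ≤ K * Real.pi := by positivity
    linarith)
  obtain ⟨r2, r2'⟩ := hC₂ s α σ τ L y H hs hsB h hd h0 hK
  have r3 := hC₃ s α σ τ L y H hs
  rw [integral_linFactor_cpow_mul_gaussian_scaled hs0 hα H.tau_pos] at r3
  set g := ∫ v, gammaDensity s v ∂ProbabilityTheory.gaussianReal y ((τ / α) ^ 2).toNNReal with hg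
  have hsplit : ∫ θ in (-Real.pi)..Real.pi, P θ * h θ * φ θ =
      (∫ θ in (-Real.pi)..Real.pi, P θ * h θ * (φ θ - E θ)) +
      ((∫ θ in (-Real.pi)..Real.pi, P θ * (h θ - 1) * E θ) +
      ∫ θ in (-Real.pi)..Real.pi, P θ * E θ) := by
    rw [← intervalIntegral.integral_add, ← intervalIntegral.integral_add]
    · congr 1; ext θ; ring
    all_goals exact Continuous.intervalIntegrable (by fun_prop) _ _
  change (1 / 2 ≤ y → ‖(∫ θ in (-Real.pi)..Real.pi, P θ * h θ * φ θ) - _‖ ≤ _) ∧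
    ‖∫ θ in (-Real.pi)..Real.pi, P θ * h θ * φ θ‖ ≤ _
  rw [hsplit]
  change ‖∫ θ in (-Real.pi)..Real.pi, P θ * h θ * (φ θ - E θ)‖ ≤ _ at r1
  change _ → ‖∫ θ in (-Real.pi)..Real.pi, P θ * (h θ - 1) * E θ‖ ≤ _ at r2
  change ‖∫ θ in (-Real.pi)..Real.pi, P θ * (h θ - 1) * E θ‖ ≤ _ at r2'
  change ‖(∫ θ in (-Real.pi)..Real.pi, P θ * E θ) - _‖ ≤ _ at r3
  set I₁ := ∫ θ in (-Real.pi)..Real.pi, P θ * h θ * (φ θ - E θ)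
  set I₂ := ∫ θ in (-Real.pi)..Real.pi, P θ * (h θ - 1) * E θ
  set I₃ := ∫ θ in (-Real.pi)..Real.pi, P θ * E θ
  have hε := H.heavyError_pos s
  have hε4 := H.heavyError_le hs
  set ε := heavyError α σ L r s
  have hn : ‖(2 * Real.pi / α : ℂ)‖ = 2 * Real.pi / α := by
    rw [norm_div, norm_mul, Complex.norm_real, Complex.norm_real, Real.norm_of_nonneg hpi.le,
      Real.norm_of_nonneg hα.le]
    simp
  constructor
  · intro hy
    have r4 : ‖(2 * Real.pi / α : ℂ) * ((g - gammaDensity s y : ℝ) : ℂ)‖ ≤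
        2 * Real.pi / α * (C₅ * ε) := by
      rw [norm_mul, hn, Complex.norm_real]
      have h1 := abs_integral_gammaDensity_sub_le hs0 ⟨C₄, hC₄ s ⟨hs, hsB⟩⟩
        (fun v => hC₅ s ⟨hs, hsB⟩ y v hy) ((τ / α) ^ 2).toNNReal
      rw [Real.coe_toNNReal _ (sq_nonneg _), ← hg] at h1
      have h2 : (τ / α) ^ 2 ≤ (σ / α) ^ 2 := by
        have := H.tau_pos
        have := H.tau_le
        gcongr
      have h3 := H.sq_le_heavyError s
      have h4 : C₅ * (τ / α) ^ 2 ≤ C₅ * ε := by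
        have := h2.trans h3
        gcongr
      rw [Real.norm_eq_abs]
      have := h1.trans h4
      gcongr
    have e : I₁ + (I₂ + I₃) - 2 * Real.pi / α * gammaDensity s y =
        I₁ + I₂ + (I₃ - 2 * Real.pi / α * g) +
          (2 * Real.pi / α : ℂ) * ((g - gammaDensity s y : ℝ) : ℂ) := by push_cast; ring
    rw [e]
    have hb := norm_add₄_le (a := I₁) (b := I₂) (c := I₃ - 2 * Real.pi / α * g)
      (d := (2 * Real.pi / α : ℂ) * ((g - gammaDensity s y : ℝ) : ℂ))
    calc _ ≤ C₁ / α * ε + C₂ / α * ε + C₃ / α * ε + 2 * Real.pi / α * (C₅ * ε) := by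
          have := r2 hy
          linarith
      _ = (C₁ + C₂ + C₃ + 2 * Real.pi * C₅) / α * ε := by ring
      _ ≤ _ := by
          gcongr
          · linarith
          · linarith
          · linarith
  · have r4 : ‖(2 * Real.pi / α : ℂ) * (g : ℂ)‖ ≤ 2 * Real.pi / α * C₄ := by
      rw [norm_mul, hn, Complex.norm_real, Real.norm_eq_abs]
      have := abs_integral_gammaDensity_le hs0 (hC₄ s ⟨hs, hsB⟩) y ((τ / α) ^ 2).toNNReal
      gcongr
    have e : I₁ + (I₂ + I₃) =
        I₁ + I₂ + (I₃ - 2 * Real.pi / α * g) + (2 * Real.pi / α : ℂ) * (g : ℂ) := by ring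
    rw [e]
    have hb := norm_add₄_le (a := I₁) (b := I₂) (c := I₃ - 2 * Real.pi / α * g)
      (d := (2 * Real.pi / α : ℂ) * (g : ℂ))
    have q1 : C₁ / α * ε ≤ C₁ / α * 4 := by gcongr
    have q3 : C₃ / α * ε ≤ C₃ / α * 4 := by gcongr
    calc _ ≤ C₁ / α * 4 + C₂ / α + C₃ / α * 4 + 2 * Real.pi / α * C₄ := by linarith
      _ = (4 * C₁ + C₂ + 4 * C₃ + 2 * Real.pi * C₄) / α := by ring
      _ ≤ _ := by
          gcongr
          linarith

end LocalLimit

/-! ### Factors varying on the scale of `1`. -/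

/-- `f` is differentiable with `f 0 = 1` and `‖f'‖ ≤ (M - 1) / (2π)` on `[-π, π]`; with this
normalization the constants are multiplicative. -/
structure IsTilt (M : ℝ) (f : ℝ → ℂ) : Prop where
  differentiable : Differentiable ℝ f
  map_zero : f 0 = 1
  norm_deriv_le : ∀ θ, |θ| ≤ Real.pi → ‖deriv f θ‖ ≤ (M - 1) / (2 * Real.pi)

namespace IsTilt

variable {M M' : ℝ} {f g : ℝ → ℂ}

theorem one_le (hf : IsTilt M f) : 1 ≤ M := by
  have h := (norm_nonneg _).trans (hf.norm_deriv_le 0 (by simp [Real.pi_pos.le]))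
  rw [le_div_iff₀ (by positivity)] at h
  linarith

theorem norm_le (hf : IsTilt M f) {θ : ℝ} (hθ : |θ| ≤ Real.pi) : ‖f θ‖ ≤ (M + 1) / 2 := by
  have h1 := norm_sub_one_le_of_deriv_le hf.differentiable hf.map_zero hf.norm_deriv_le hθ
  have h2 := norm_add_le (f θ - 1) 1
  rw [sub_add_cancel, norm_one] at h2
  have h3 : (M - 1) / (2 * Real.pi) * |θ| ≤ (M - 1) / (2 * Real.pi) * Real.pi := by
    have : 0 ≤ (M - 1) / (2 * Real.pi) := div_nonneg (by linarith [hf.one_le]) (by positivity)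
    gcongr
  have h4 : (M - 1) / (2 * Real.pi) * Real.pi = (M - 1) / 2 := by
    have := Real.pi_ne_zero; field_simp
  linarith

theorem mono (hf : IsTilt M f) (h : M ≤ M') : IsTilt M' f :=
  ⟨hf.differentiable, hf.map_zero, fun θ hθ => (hf.norm_deriv_le θ hθ).trans (by gcongr)⟩

theorem mul (hf : IsTilt M f) (hg : IsTilt M' g) : IsTilt (M * M') (fun θ => f θ * g θ) := by
  refine ⟨hf.differentiable.mul hg.differentiable, by simp [hf.map_zero, hg.map_zero],
    fun θ hθ => ?_⟩
  rw [deriv_fun_mul (hf.differentiable θ) (hg.differentiable θ)]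
  have h1 := hf.norm_deriv_le θ hθ
  have h2 := hg.norm_deriv_le θ hθ
  have h3 := hf.norm_le hθ
  have h4 := hg.norm_le hθ
  have h5 := hf.one_le
  have h6 := hg.one_le
  have h7 : 0 ≤ (M - 1) / (2 * Real.pi) := div_nonneg (by linarith) (by positivity)
  calc _ ≤ ‖deriv f θ‖ * ‖g θ‖ + ‖f θ‖ * ‖deriv g θ‖ := by
        refine (norm_add_le _ _).trans ?_; rw [norm_mul, norm_mul]
    _ ≤ (M - 1) / (2 * Real.pi) * ((M' + 1) / 2) + (M + 1) / 2 * ((M' - 1) / (2 * Real.pi)) := by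
        gcongr
    _ = _ := by field_simp; ring

theorem one : IsTilt 1 fun _ => 1 := ⟨by fun_prop, rfl, fun θ _ => by simp⟩

theorem prod {ι : Type*} {T : Finset ι} {f : ι → ℝ → ℂ} (hf : ∀ k ∈ T, IsTilt M (f k)) :
    IsTilt (M ^ T.card) fun θ => ∏ k ∈ T, f k θ := by
  classical
  induction T using Finset.induction_on with
  | empty => simpa using one
  | insert i T hi ih =>
    simp only [Finset.mem_insert, forall_eq_or_imp] at hf
    have := hf.1.mul (ih hf.2)
    rw [Finset.card_insert_of_notMem hi, pow_succ']
    simpa only [Finset.prod_insert hi] using this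

theorem of_deriv_le {K : ℝ} (hd : Differentiable ℝ f) (h0 : f 0 = 1)
    (hK : ∀ θ, |θ| ≤ Real.pi → ‖deriv f θ‖ ≤ K) : IsTilt (1 + 2 * Real.pi * K) f :=
  ⟨hd, h0, fun θ hθ => (hK θ hθ).trans (le_of_eq (by have := Real.pi_ne_zero; field_simp; ring))⟩

theorem exp (η : ℝ) : IsTilt (1 + 2 * Real.pi * |η|) fun θ => Complex.exp (Complex.I * η * θ) := by
  have hd : ∀ θ : ℝ, HasDerivAt (fun θ : ℝ => Complex.exp (Complex.I * η * θ))
      (Complex.exp (Complex.I * η * θ) * (Complex.I * η)) θ := by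
    intro θ
    have h := (((hasDerivAt_id θ).ofReal_comp.const_mul (Complex.I * η)).cexp)
    refine h.congr_deriv ?_
    simp
  refine of_deriv_le (fun θ => (hd θ).differentiableAt) (by simp) fun θ _ => ?_
  rw [(hd θ).deriv, norm_mul, show Complex.I * η * θ = ((η * θ : ℝ) : ℂ) * Complex.I by
    push_cast; ring, Complex.norm_exp_ofReal_mul_I]
  simp

end IsTilt

/-! ### Comparison of `ω` with `(1 - iαθ)⁻¹`. -/

section Omega

variable {ρ : ℝ} (hρ0 : 0 < ρ) (hρ1 : ρ < 1)
include hρ0 hρ1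

theorem heavyScale_pos : 0 < heavyScale ρ := div_pos hρ0 (by linarith)

omit hρ0 in
theorem heavyOmega_eq_inv (θ : ℝ) : heavyOmega ρ θ =
    (1 + heavyScale ρ - heavyScale ρ * Complex.exp (Complex.I * θ))⁻¹ := by
  have h : (1 - (ρ : ℂ)) ≠ 0 := by
    have : ((1 - ρ : ℝ) : ℂ) ≠ 0 := by exact_mod_cast (by linarith : (1 - ρ) ≠ 0)
    simpa using this
  have e : (1 + (heavyScale ρ : ℂ) - heavyScale ρ * Complex.exp (Complex.I * θ)) =
      (1 - ρ * Complex.exp (Complex.I * θ)) / (1 - ρ) := by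
    unfold heavyScale
    push_cast
    field_simp
    ring
  rw [e, inv_div, heavyOmega]

omit hρ0 hρ1 in
theorem normSq_omega_inv (θ : ℝ) :
    ‖(1 + heavyScale ρ - heavyScale ρ * Complex.exp (Complex.I * θ) : ℂ)‖ ^ 2 =
      1 + 2 * heavyScale ρ * (1 + heavyScale ρ) * (1 - Real.cos θ) := by
  rw [← Complex.normSq_eq_norm_sq, mul_comm Complex.I, Complex.exp_mul_I, ← Complex.ofReal_cos,
      ← Complex.ofReal_sin, Complex.normSq_apply]
  simp only [Complex.add_re, Complex.add_im, Complex.sub_re, Complex.sub_im, Complex.mul_re,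
    Complex.mul_im, Complex.ofReal_re, Complex.ofReal_im, Complex.I_re, Complex.I_im,
    Complex.one_re, Complex.one_im]
  linear_combination heavyScale ρ ^ 2 * Real.sin_sq_add_cos_sq θ

theorem one_le_re_omega_inv (θ : ℝ) :
    1 ≤ (1 + heavyScale ρ - heavyScale ρ * Complex.exp (Complex.I * θ) : ℂ).re := by
  have ha := heavyScale_pos hρ0 hρ1
  rw [mul_comm Complex.I, Complex.exp_mul_I, ← Complex.ofReal_cos, ← Complex.ofReal_sin]
  simp only [Complex.add_re, Complex.add_im, Complex.sub_re, Complex.mul_re,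
    Complex.mul_im, Complex.ofReal_re, Complex.ofReal_im, Complex.I_re, Complex.I_im,
    Complex.one_re]
  nlinarith [Real.cos_le_one θ]

theorem heavyOmega_mem_slitPlane (θ : ℝ) : heavyOmega ρ θ ∈ Complex.slitPlane := by
  left
  have h := one_le_re_omega_inv hρ0 hρ1 θ
  rw [heavyOmega_eq_inv hρ1, Complex.inv_re]
  refine div_pos (by linarith) (Complex.normSq_pos.2 fun h0 => ?_)
  rw [h0] at h
  norm_num at h

theorem heavyOmega_ne_zero (θ : ℝ) : heavyOmega ρ θ ≠ 0 :=
  Complex.slitPlane_ne_zero (heavyOmega_mem_slitPlane hρ0 hρ1 θ)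

theorem hasDerivAt_heavyOmega (θ : ℝ) : HasDerivAt (heavyOmega ρ)
    (Complex.I * heavyScale ρ * Complex.exp (Complex.I * θ) * heavyOmega ρ θ ^ 2) θ := by
  have h0 : (1 + heavyScale ρ - heavyScale ρ * Complex.exp (Complex.I * θ) : ℂ) ≠ 0 := by
    have := heavyOmega_ne_zero hρ0 hρ1 θ
    rw [heavyOmega_eq_inv hρ1] at this
    exact fun h => this (by rw [h, inv_zero])
  have h1 := ((((hasDerivAt_id θ).ofReal_comp.const_mul Complex.I).cexp.const_mul
    (heavyScale ρ : ℂ)).const_sub (1 + heavyScale ρ : ℂ)).inv h0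
  have h2 : HasDerivAt (heavyOmega ρ) _ θ :=
    h1.congr_of_eventuallyEq (Eventually.of_forall fun t => heavyOmega_eq_inv hρ1 t)
  refine h2.congr_deriv ?_
  rw [heavyOmega_eq_inv hρ1]
  simp
  field_simp

/-- `|ω|^{-2} = 1 + 2α(1+α)(1 - cos θ)` with `1 - cos θ ≥ θ²/8` on `[-π, π]`, which is at least a
quarter of `1 + α²θ²`. -/
theorem norm_heavyOmega_mul_le {θ : ℝ} (hθ : |θ| ≤ Real.pi) :
    ‖heavyOmega ρ θ‖ * ‖linFactor (heavyScale ρ) θ‖ ≤ 2 := by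
  have ha := heavyScale_pos hρ0 hρ1
  have h1 := normSq_omega_inv (ρ := ρ) θ
  have h2 := norm_linFactor_sq (α := heavyScale ρ) θ
  have hc := Real.cos_le_one_sub_mul_cos_sq hθ
  rw [heavyOmega_eq_inv hρ1, norm_inv]
  set N := ‖(1 + heavyScale ρ - heavyScale ρ * Complex.exp (Complex.I * θ) : ℂ)‖ with hN
  set a := heavyScale ρ
  have hpi : 1 / 8 ≤ 2 / Real.pi ^ 2 := by
    rw [div_le_div_iff₀ (by norm_num) (by positivity)]
    nlinarith [Real.pi_le_four, Real.pi_pos]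
  have hcc : 1 / 8 * θ ^ 2 ≤ 1 - Real.cos θ := by
    have : 1 / 8 * θ ^ 2 ≤ 2 / Real.pi ^ 2 * θ ^ 2 := by gcongr
    linarith
  have h3 : 1 + a ^ 2 * θ ^ 2 / 4 ≤ N ^ 2 := by
    rw [h1]
    have : 2 * a * (1 + a) * (1 / 8 * θ ^ 2) ≤ 2 * a * (1 + a) * (1 - Real.cos θ) := by gcongr
    nlinarith [mul_nonneg ha.le (sq_nonneg θ)]
  have hN0 : 0 < N := by
    refine (norm_nonneg _).lt_of_ne fun h => ?_
    rw [← hN] at h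
    rw [← h] at h3
    nlinarith [mul_nonneg (sq_nonneg a) (sq_nonneg θ)]
  rw [inv_mul_le_iff₀ hN0]
  refine abs_le_of_sq_le_sq' ?_ (by positivity) |>.2
  rw [h2]
  nlinarith

/-- The logarithmic derivative of `ωu` is `iα ω u⁻¹ (exp(iθ) u - ω⁻¹)`, and this controls the last
factor. It equals `(exp(iθ) - 1) + α (exp(iθ)(1 - iθ) - 1)`, of order `|θ| + αθ²`. -/
theorem norm_exp_mul_linFactor_sub_le (θ : ℝ) :
    ‖Complex.exp (Complex.I * θ) * linFactor (heavyScale ρ) θ -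
      (1 + heavyScale ρ - heavyScale ρ * Complex.exp (Complex.I * θ))‖ ≤
      6 * |θ| * ‖linFactor (heavyScale ρ) θ‖ := by
  have ha := heavyScale_pos hρ0 hρ1
  set a := heavyScale ρ
  have h1 : ‖Complex.exp (Complex.I * θ) - 1‖ ≤ |θ| := by
    have := Real.norm_exp_I_mul_ofReal_sub_one_le (x := θ)
    simpa using this
  have hexp : ‖Complex.exp (Complex.I * θ)‖ = 1 := by
    rw [mul_comm]; exact Complex.norm_exp_ofReal_mul_I θ
  have h2 : ‖Complex.exp (Complex.I * θ) * (1 - Complex.I * θ) - 1‖ ≤ 5 * |θ| ^ 2 := by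
    have h3 := norm_exp_I_mul_sub_taylor_le le_rfl zero_le_one (-θ)
    have e : Complex.exp (Complex.I * θ) * (1 - Complex.I * θ) - 1 =
        -(Complex.exp (Complex.I * θ) *
          ((Complex.exp (Complex.I * (-θ : ℝ)) - 1 - Complex.I * (-θ : ℝ) +
            ((-θ : ℝ) : ℂ) ^ 2 / 2) - (θ : ℂ) ^ 2 / 2)) := by
      have : Complex.exp (Complex.I * θ) * Complex.exp (Complex.I * (-θ : ℝ)) = 1 := by
        rw [← Complex.exp_add]; simp
      push_cast at this ⊢
      linear_combination this
    rw [e, norm_neg, norm_mul, hexp, one_mul]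
    refine (norm_sub_le _ _).trans ?_
    rw [add_zero, abs_neg, Real.rpow_two] at h3
    have h4 : ‖(θ : ℂ) ^ 2 / 2‖ = |θ| ^ 2 / 2 := by simp
    rw [h4]
    nlinarith [sq_nonneg |θ|]
  have e : Complex.exp (Complex.I * θ) * linFactor a θ -
      (1 + a - a * Complex.exp (Complex.I * θ)) = (Complex.exp (Complex.I * θ) - 1) +
        a * (Complex.exp (Complex.I * θ) * (1 - Complex.I * θ) - 1) := by
    unfold linFactor; ring
  rw [e]
  have h5 := one_le_norm_linFactor (α := a) θ
  have h6 := abs_le_norm_linFactor (α := a) θ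
  calc _ ≤ |θ| + a * (5 * |θ| ^ 2) := by
        refine (norm_add_le _ _).trans (add_le_add h1 ?_)
        rw [norm_mul, Complex.norm_real, Real.norm_of_nonneg ha.le]
        gcongr
    _ = |θ| * (1 + 5 * (a * |θ|)) := by ring
    _ ≤ |θ| * (6 * ‖linFactor a θ‖) := by
        gcongr
        linarith
    _ = _ := by ring

theorem norm_heavyOmega_cpow_le {s B : ℝ} (hs : 0 ≤ s) (hsB : s ≤ B) {θ : ℝ} (hθ : |θ| ≤ Real.pi) :
    ‖heavyOmega ρ θ ^ (s : ℂ)‖ ≤ 2 ^ B * ‖linFactor (heavyScale ρ) θ‖ ^ (-s) := by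
  have hu := norm_linFactor_pos (α := heavyScale ρ) θ
  have h := norm_heavyOmega_mul_le hρ0 hρ1 hθ
  rw [Complex.norm_cpow_real, Real.rpow_neg hu.le, ← div_eq_mul_inv,
    le_div_iff₀ (Real.rpow_pos_of_pos hu _), ← Real.mul_rpow (norm_nonneg _) hu.le]
  calc _ ≤ (2 : ℝ) ^ s := Real.rpow_le_rpow (by positivity) h hs
    _ ≤ _ := Real.rpow_le_rpow_of_exponent_le (by norm_num) hsB

/-- Uniformity in `α` is the point: the factor `α` of the logarithmic derivative meets a `|θ|`, and
`α|θ| ≤ ‖u‖`. The constant collects `s ≤ B`, the `6` and `2` of the preceding bounds and `|ωu|^s ≤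
2^B`. -/
theorem isTilt_omega_mul_linFactor {s B : ℝ} (hs : 0 ≤ s) (hsB : s ≤ B) :
    IsTilt (1 + 2 * Real.pi * (12 * B * 2 ^ B)) fun θ =>
      heavyOmega ρ θ ^ (s : ℂ) * linFactor (heavyScale ρ) θ ^ (s : ℂ) := by
  have ha := heavyScale_pos hρ0 hρ1
  set a := heavyScale ρ
  have hd : ∀ θ : ℝ, HasDerivAt
      (fun θ => heavyOmega ρ θ ^ (s : ℂ) * linFactor a θ ^ (s : ℂ))
      (s * Complex.I * a * (heavyOmega ρ θ ^ (s : ℂ) * linFactor a θ ^ (s : ℂ)) *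
        (Complex.exp (Complex.I * θ) * linFactor a θ -
          (1 + a - a * Complex.exp (Complex.I * θ))) * heavyOmega ρ θ * (linFactor a θ)⁻¹) θ := by
    intro θ
    have hω := heavyOmega_ne_zero hρ0 hρ1 θ
    have hu := linFactor_ne_zero (α := a) θ
    have h1 := hasDerivAt_cpow_const_of_mem_slitPlane (hasDerivAt_heavyOmega hρ0 hρ1 θ)
      (heavyOmega_mem_slitPlane hρ0 hρ1 θ) (s : ℂ)
    have h2 := hasDerivAt_cpow_const_of_mem_slitPlane (hasDerivAt_linFactor (α := a) θ)
      (linFactor_mem_slitPlane θ) (s : ℂ)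
    refine (h1.mul h2).congr_deriv ?_
    have hinv : (1 + a - a * Complex.exp (Complex.I * θ) : ℂ) = (heavyOmega ρ θ)⁻¹ := by
      rw [heavyOmega_eq_inv hρ1, inv_inv]
    rw [hinv, Complex.cpow_sub _ _ hω, Complex.cpow_sub _ _ hu, Complex.cpow_one, Complex.cpow_one]
    field_simp
    ring
  refine IsTilt.of_deriv_le (fun θ => (hd θ).differentiableAt) ?_ fun θ hθ => ?_
  · have h1 : (1 : ℂ) - ρ ≠ 0 := by
      have : ((1 - ρ : ℝ) : ℂ) ≠ 0 := by exact_mod_cast (by linarith : (1 - ρ) ≠ 0)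
      simpa using this
    simp [heavyOmega, linFactor, div_self h1]
  · rw [(hd θ).deriv]
    have hu := norm_linFactor_pos (α := a) θ
    have h1 := norm_heavyOmega_cpow_le hρ0 hρ1 hs hsB hθ
    have h2 := norm_exp_mul_linFactor_sub_le hρ0 hρ1 θ
    have h3 := norm_heavyOmega_mul_le hρ0 hρ1 hθ
    have h4 := abs_le_norm_linFactor (α := a) θ
    have h5 : ‖heavyOmega ρ θ ^ (s : ℂ) * linFactor a θ ^ (s : ℂ)‖ ≤ 2 ^ B := by
      rw [norm_mul, Complex.norm_cpow_real (linFactor a θ)]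
      calc _ ≤ 2 ^ B * ‖linFactor a θ‖ ^ (-s) * ‖linFactor a θ‖ ^ s := by gcongr
        _ = 2 ^ B := by
          rw [mul_assoc, ← Real.rpow_add hu]; simp
    have hB : 0 ≤ B := hs.trans hsB
    rw [norm_mul, norm_mul, norm_mul, norm_mul, norm_mul, norm_mul, norm_inv, Complex.norm_I,
      Complex.norm_real, Complex.norm_real, Real.norm_of_nonneg hs, Real.norm_of_nonneg ha.le]
    set U := ‖linFactor a θ‖ with hU
    have h3' : ‖heavyOmega ρ θ‖ ≤ 2 / U := by rwa [le_div_iff₀ hu]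
    calc _ ≤ B * 1 * a * 2 ^ B * (6 * |θ| * U) * (2 / U) * U⁻¹ := by gcongr
      _ = 12 * B * 2 ^ B * ((a * |θ|) / U) := by field_simp; ring
      _ ≤ 12 * B * 2 ^ B * 1 := by
          gcongr
          rw [div_le_one hu]
          exact h4
      _ = _ := mul_one _

end Omega

/-! ### The closed network as a conditioned open network. -/

noncomputable section

/-- `∑ ∏ a_k(q_k)` over the `q` with `∑ q_k = N`: the coefficient of order `N` of the product of
the generating functions of the sequences `a_k`. -/
def convCoeff {ι : Type*} [Fintype ι] [DecidableEq ι] (a : ι → ℕ → ℝ) (N : ℕ) : ℝ :=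
  ∑ q ∈ Finset.piAntidiag Finset.univ N, ∏ k, a k (q k)

/-- The mean of a law on `ℕ`. -/
def lawMean (p : ℕ → ℝ) : ℝ := ∑' x : ℕ, (x : ℝ) * p x

namespace ClosedNetwork

variable {n : ℕ} (C : ClosedNetwork n) {lam : ℝ}

theorem rateProd_pos (k : Fin n) (q : ℕ) : 0 < C.rateProd k q :=
  Finset.prod_pos fun i _ => C.serviceRate_pos k (i + 1) i.succ_pos

theorem openWeight_nonneg (hlam : 0 < lam) (k : Fin n) (x : ℕ) : 0 ≤ C.openWeight lam k x :=
  div_nonneg (pow_nonneg (mul_nonneg hlam.le (C.visit_nonneg k)) x) (C.rateProd_pos k x).le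

theorem openWeight_zero (k : Fin n) : C.openWeight lam k 0 = 1 := by
  simp [openWeight, rateProd]

theorem HasMoment.summable_openWeight {C : ClosedNetwork n} (hlam : 0 < lam) {k : Fin n}
    (h : C.HasMoment lam k 2) : Summable (C.openWeight lam k) := by
  -- The term `x = 0` is dropped: the moment weight `x²` vanishes there and is at least `1`
  -- afterwards.
  refine (summable_nat_add_iff 1).1 (Summable.of_nonneg_of_le
    (fun x => C.openWeight_nonneg hlam k _) (fun x => ?_) ((summable_nat_add_iff 1).2 h))
  refine le_mul_of_one_le_left (C.openWeight_nonneg hlam k _) ?_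
  exact Real.one_le_rpow (by push_cast; linarith [(Nat.cast_nonneg x : (0 : ℝ) ≤ x)]) zero_le_two

theorem HasMoment.tsum_openWeight_pos {C : ClosedNetwork n} (hlam : 0 < lam) {k : Fin n}
    (h : C.HasMoment lam k 2) : 0 < ∑' x, C.openWeight lam k x :=
  (h.summable_openWeight hlam).tsum_pos (fun x => C.openWeight_nonneg hlam k x) 0
    (by rw [openWeight_zero]; exact one_pos)

theorem HasMoment.isSqLaw {C : ClosedNetwork n} (hlam : 0 < lam) {k : Fin n}
    (h : C.HasMoment lam k 2) : IsSqLaw (C.openProb lam k) where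
  nonneg x := div_nonneg (C.openWeight_nonneg hlam k x) (h.tsum_openWeight_pos hlam).le
  hasSum := by
    have := (h.summable_openWeight hlam).hasSum.div_const (∑' x, C.openWeight lam k x)
    rwa [div_self (h.tsum_openWeight_pos hlam).ne'] at this
  summable_sq := by
    refine (h.div_const (∑' x, C.openWeight lam k x)).congr fun x => ?_
    rw [Real.rpow_two, openProb, mul_div_assoc]

theorem HasMoment.summable_abs_sub {C : ClosedNetwork n} (hlam : 0 < lam) {k : Fin n} {s : ℝ}
    (hs : 0 < s) (h2 : C.HasMoment lam k 2) (h : C.HasMoment lam k s) (m : ℝ) :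
    Summable fun x : ℕ => |(x : ℝ) - m| ^ s * C.openProb lam k x := by
  have hp := h2.isSqLaw hlam
  have h1 : Summable fun x : ℕ => (x : ℝ) ^ s * C.openProb lam k x :=
    (Summable.div_const h (∑' x, C.openWeight lam k x)).congr fun x => by
      rw [openProb, mul_div_assoc]
  refine Summable.of_nonneg_of_le (fun x => mul_nonneg (by positivity) (hp.nonneg x)) (fun x => ?_)
    ((h1.add (hp.hasSum.summable.mul_left (|m| ^ s))).mul_left (2 ^ s))
  rw [← add_mul, ← mul_assoc]
  refine mul_le_mul_of_nonneg_right ?_ (hp.nonneg x)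
  have hx : (0 : ℝ) ≤ x := x.cast_nonneg
  have hb : |(x : ℝ) - m| ≤ x + |m| := by
    have := abs_sub (x : ℝ) m
    rwa [abs_of_nonneg hx] at this
  rcases le_total (x : ℝ) |m| with hc | hc
  · calc |(x : ℝ) - m| ^ s ≤ (2 * |m|) ^ s :=
          Real.rpow_le_rpow (abs_nonneg _) (by linarith) hs.le
      _ = 2 ^ s * |m| ^ s := Real.mul_rpow zero_le_two (abs_nonneg _)
      _ ≤ _ := by
        have : (0 : ℝ) ≤ (x : ℝ) ^ s := by positivity
        gcongr
        linarith
  · calc |(x : ℝ) - m| ^ s ≤ (2 * x) ^ s :=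
          Real.rpow_le_rpow (abs_nonneg _) (by linarith) hs.le
      _ = 2 ^ s * (x : ℝ) ^ s := Real.mul_rpow zero_le_two hx
      _ ≤ _ := by
        have : (0 : ℝ) ≤ |m| ^ s := by positivity
        gcongr
        linarith

/-- On the states the power of `lam` is the constant `lam^m`, so the open law restricted to total
`m` is proportional to the closed one. -/
theorem prod_openProb (q : Fin n → ℕ) (hq : ∑ k, q k = C.clients) :
    ∏ k, C.openProb lam k (q k) =
      C.weight q * (lam ^ C.clients / ∏ k, ∑' x, C.openWeight lam k x) := by
  unfold openProb weight openWeight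
  rw [Finset.prod_div_distrib, ← hq, ← Finset.prod_pow_eq_pow_sum, ← mul_div_assoc,
    ← Finset.prod_mul_distrib]
  congr 1
  refine Finset.prod_congr rfl fun k _ => ?_
  rw [mul_pow]
  ring

theorem convCoeff_openProb : convCoeff (C.openProb lam) C.clients =
    C.normConst * (lam ^ C.clients / ∏ k, ∑' x, C.openWeight lam k x) := by
  rw [normConst, Finset.sum_mul]
  refine Finset.sum_congr rfl fun q hq => C.prod_openProb q ?_
  exact (Finset.mem_piAntidiag.1 hq).1

theorem normConst_pos : 0 < C.normConst := by
  obtain ⟨k, -, hk⟩ := Finset.exists_ne_zero_of_sum_ne_zero (s := Finset.univ) (f := C.visit)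
    (by rw [C.visit_sum]; exact one_ne_zero)
  have hk0 : 0 < C.visit k := lt_of_le_of_ne (C.visit_nonneg k) (Ne.symm hk)
  have hnn : ∀ q, 0 ≤ C.weight q := fun q => Finset.prod_nonneg fun k _ =>
    div_nonneg (pow_nonneg (C.visit_nonneg k) _) (C.rateProd_pos k _).le
  -- Positive weight is exhibited by placing all clients in one queue of positive visit probability;
  -- the other visit probabilities may vanish.
  refine Finset.sum_pos' (fun q _ => hnn q) ⟨Pi.single k C.clients, ?_, ?_⟩
  · simp [states]
  · refine Finset.prod_pos fun j _ => div_pos ?_ (C.rateProd_pos j _)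
    by_cases hj : j = k
    · subst hj; exact pow_pos hk0 _
    · simp [hj]

section

variable (hlam : 0 < lam) (hmom : ∀ k, C.HasMoment lam k 2)
include hlam hmom

theorem factor_pos : 0 < lam ^ C.clients / ∏ k, ∑' x, C.openWeight lam k x :=
  div_pos (pow_pos hlam _) (Finset.prod_pos fun k _ => (hmom k).tsum_openWeight_pos hlam)

theorem convCoeff_openProb_pos : 0 < convCoeff (C.openProb lam) C.clients := by
  rw [convCoeff_openProb]
  exact mul_pos C.normConst_pos (C.factor_pos hlam hmom)

theorem closedProb_eq (q : Fin n → ℕ) (hq : ∑ k, q k = C.clients) :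
    C.closedProb q = (∏ k, C.openProb lam k (q k)) / convCoeff (C.openProb lam) C.clients := by
  rw [closedProb, if_pos hq, prod_openProb C q hq, convCoeff_openProb,
    mul_div_mul_right _ _ (C.factor_pos hlam hmom).ne']

/-- The constraint on `A` is absorbed into the sequences by killing all values but `q k`, so the
numerator is a convolution coefficient again. -/
theorem closedMarginal_eq (A : Finset (Fin n)) (q : Fin n → ℕ) :
    C.closedMarginal A q =
      convCoeff (fun k x => if k ∈ A ∧ x ≠ q k then 0 else C.openProb lam k x) C.clients /
        convCoeff (C.openProb lam) C.clients := by
  rw [closedMarginal, Finset.sum_filter, convCoeff, Finset.sum_div]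
  refine Finset.sum_congr rfl fun s hs => ?_
  rw [C.closedProb_eq hlam hmom s (Finset.mem_piAntidiag.1 hs).1]
  split_ifs with h
  · congr 1
    refine Finset.prod_congr rfl fun k _ => ?_
    rw [if_neg]
    rintro ⟨hk, hne⟩
    exact hne (h k hk)
  · push Not at h
    obtain ⟨k, hk, hne⟩ := h
    symm
    rw [div_eq_zero_iff]
    exact Or.inl (Finset.prod_eq_zero (Finset.mem_univ k) (if_pos ⟨hk, hne⟩))

theorem closedMean_eq (j : Fin n) :
    C.closedMean j =
      convCoeff (fun k x => if k = j then (x : ℝ) * C.openProb lam k x else C.openProb lam k x)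
        C.clients / convCoeff (C.openProb lam) C.clients := by
  rw [closedMean, convCoeff, Finset.sum_div]
  refine Finset.sum_congr rfl fun s hs => ?_
  rw [C.closedProb_eq hlam hmom s (Finset.mem_piAntidiag.1 hs).1, ← mul_div_assoc]
  congr 1
  have e : ∀ k, (if k = j then ((s k : ℕ) : ℝ) * C.openProb lam k (s k) else C.openProb lam k (s k))
      = (if k = j then ((s k : ℕ) : ℝ) else 1) * C.openProb lam k (s k) := by
    intro k; split_ifs <;> simp
  simp_rw [e]
  rw [Finset.prod_mul_distrib]
  simp

end

theorem hasSum_closedMarginal (j : Fin n) :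
    HasSum (fun x : ℕ => (x : ℝ) * C.closedMarginal {j} fun _ => x) (C.closedMean j) := by
  have e : C.closedMean j = ∑ x ∈ Finset.range (C.clients + 1),
      (x : ℝ) * C.closedMarginal {j} fun _ => x := by
    rw [closedMean]
    rw [← Finset.sum_fiberwise_of_maps_to (s := C.states) (t := Finset.range (C.clients + 1))
      (g := fun s => s j)]
    · refine Finset.sum_congr rfl fun x _ => ?_
      rw [closedMarginal, Finset.mul_sum]
      simp only [Finset.mem_singleton, forall_eq]
      refine Finset.sum_congr rfl fun s hs => ?_
      rw [(Finset.mem_filter.1 hs).2]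
    · intro s hs
      have := (Finset.mem_piAntidiag.1 hs).1
      have h2 : s j ≤ C.clients :=
        (Finset.single_le_sum (f := s) (fun _ _ => Nat.zero_le _) (Finset.mem_univ j)).trans_eq this
      rw [Finset.mem_range]
      omega
  rw [e]
  refine hasSum_sum_of_ne_finset_zero fun x hx => ?_
  rw [closedMarginal, Finset.filter_false_of_mem, Finset.sum_empty, mul_zero]
  intro s hs h
  have := (Finset.mem_piAntidiag.1 hs).1
  have h2 : s j ≤ C.clients :=
    (Finset.single_le_sum (f := s) (fun _ _ => Nat.zero_le _) (Finset.mem_univ j)).trans_eq this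
  have h3 := h j (Finset.mem_singleton_self j)
  rw [Finset.mem_range] at hx
  omega

end ClosedNetwork

end

/-! ### Saturable systems: removing a few variables. -/

noncomputable section

section SaturableSystem

variable {ι : Type*} [Fintype ι] [DecidableEq ι]

/-- The standard deviation of the sum of the variables outside `F`. -/
def sigmaOutside (p : ι → ℕ → ℝ) (F : Finset ι) : ℝ :=
  √(∑ k ∈ Fᶜ, absMoment (p k) (lawMean (p k)) 2)

/-- The Lyapounov ratio of the variables outside `F`. -/
def lyapOutside (p : ι → ℕ → ℝ) (F : Finset ι) (r : ℝ) : ℝ :=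
  (∑ k ∈ Fᶜ, absMoment (p k) (lawMean (p k)) (2 + r)) / sigmaOutside p F ^ (2 + r)

theorem sigmaOutside_sq {p : ι → ℕ → ℝ} (F : Finset ι) (hp : ∀ k, IsSqLaw (p k)) :
    sigmaOutside p F ^ 2 = ∑ k ∈ Fᶜ, absMoment (p k) (lawMean (p k)) 2 :=
  Real.sq_sqrt (Finset.sum_nonneg fun k _ => (hp k).absMoment_nonneg _ _)

theorem sigmaOutside_rpow_neg_le {p : ι → ℕ → ℝ} {F : Finset ι} {r : ℝ} (hp : ∀ k, IsSqLaw (p k))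
    (hr : 0 < r) (hr1 : r ≤ 1)
    (hmom : ∀ k ∉ F, Summable fun x : ℕ => |(x : ℝ) - lawMean (p k)| ^ (2 + r) * p k x)
    (hσ : 0 < sigmaOutside p F) : sigmaOutside p F ^ (-r) ≤ 4 * lyapOutside p F r := by
  have h1 : sigmaOutside p F ^ 2 ≤ 4 * (lyapOutside p F r * sigmaOutside p F ^ (2 + r)) := by
    rw [sigmaOutside_sq F hp, lyapOutside,
      div_mul_cancel₀ _ (Real.rpow_pos_of_pos hσ _).ne', Finset.mul_sum]
    exact Finset.sum_le_sum fun k hk => (hp k).variance_le rfl hr hr1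
      (hmom k (Finset.mem_compl.1 hk))
  have h2 : sigmaOutside p F ^ (2 + r) = sigmaOutside p F ^ 2 * sigmaOutside p F ^ r := by
    rw [Real.rpow_add hσ, Real.rpow_two]
  rw [Real.rpow_neg hσ.le, ← one_div, div_le_iff₀ (Real.rpow_pos_of_pos hσ _)]
  have h3 : 0 < sigmaOutside p F ^ 2 := by positivity
  rw [h2] at h1
  refine le_of_mul_le_mul_left ?_ h3
  linarith

theorem lyapOutside_nonneg {p : ι → ℕ → ℝ} (F : Finset ι) (r : ℝ) (hp : ∀ k, IsSqLaw (p k)) :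
    0 ≤ lyapOutside p F r :=
  div_nonneg (Finset.sum_nonneg fun k _ => (hp k).absMoment_nonneg _ _)
    (Real.rpow_nonneg (Real.sqrt_nonneg _) _)

/-- A family of laws on `ℕ`, those of `F` being saturable at scale `heavyScale ρ`, in the heavy
traffic regime. -/
structure SaturableSystem (p : ι → ℕ → ℝ) (F : Finset ι) (ξ : ι → ℝ) (ψ : ι → ℝ → ℂ)
    (ρ K r B κ : ℝ) : Prop where
  law : ∀ k, IsSqLaw (p k)
  moment : ∀ k ∉ F, Summable fun x : ℕ => |(x : ℝ) - lawMean (p k)| ^ (2 + r) * p k x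
  nonempty : F.Nonempty
  char_eq : ∀ k ∈ F, ∀ θ : ℝ,
    charSeries (fun x => (p k x : ℂ)) θ = heavyOmega ρ θ ^ (ξ k : ℂ) * ψ k θ
  differentiable : ∀ k ∈ F, Differentiable ℝ (ψ k)
  deriv_le : ∀ k ∈ F, ∀ θ, ‖deriv (ψ k) θ‖ ≤ K
  one_le : ∀ k ∈ F, 1 ≤ ξ k
  rho_pos : 0 < ρ
  rho_lt : ρ < 1
  r_pos : 0 < r
  r_le : r ≤ 1
  two_le : 2 ≤ κ
  sum_le : ∑ k ∈ F, ξ k ≤ B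
  one_le_alpha : 1 ≤ heavyScale ρ
  one_le_sigma : 1 ≤ sigmaOutside p F
  sigma_le_alpha : sigmaOutside p F ≤ heavyScale ρ
  lyap_le_one : lyapOutside p F r ≤ 1
  sigma_le_gamma : sigmaOutside p F ≤ κ * √(∑ k ∈ Fᶜ, pairSum (p k))

theorem charSeries_eq_centeredChar (p : ℕ → ℝ) (m θ : ℝ) : charSeries (fun x => (p x : ℂ)) θ =
    Complex.exp (Complex.I * m * θ) * centeredChar p m θ := by
  rw [centeredChar, charSeries, ← tsum_mul_left]
  refine tsum_congr fun x => ?_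
  rw [mul_left_comm, ← Complex.exp_add]
  congr 2
  push_cast
  ring

theorem hasDerivAt_charSeries {a : ℕ → ℂ} (ha : Summable fun x => ‖a x‖)
    (ha' : Summable fun x : ℕ => ‖(x : ℂ) * a x‖) (θ : ℝ) :
    HasDerivAt (charSeries a) (Complex.I * charSeries (fun x => x * a x) θ) θ := by
  have h := hasDerivAt_tsum (g := fun (x : ℕ) (θ : ℝ) => a x * Complex.exp (Complex.I * x * θ))
    (g' := fun (x : ℕ) (θ : ℝ) => a x * (Complex.exp (Complex.I * x * θ) * (Complex.I * x)))
    (y₀ := 0) ha' (fun x t => by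
      have h := (((hasDerivAt_id t).ofReal_comp.const_mul (Complex.I * x)).cexp).const_mul (a x)
      refine h.congr_deriv ?_
      simp) (fun x t => by
      rw [norm_mul, norm_mul, norm_exp_I_nat_mul, norm_mul, norm_mul, Complex.norm_I, one_mul,
        one_mul, mul_comm]) (hasSum_charSeries ha 0).summable θ
  refine h.congr_deriv ?_
  rw [charSeries, ← tsum_mul_left]
  exact tsum_congr fun x => by ring

namespace IsSqLaw

variable {p : ℕ → ℝ} (hp : IsSqLaw p)
include hp

theorem summable_norm : Summable fun x => ‖(p x : ℂ)‖ :=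
  hp.hasSum.summable.congr fun x => by
    rw [Complex.norm_real, Real.norm_of_nonneg (hp.nonneg x)]

theorem summable_norm_mul : Summable fun x : ℕ => ‖(x : ℂ) * (p x : ℂ)‖ :=
  hp.summable_mul.congr fun x => by
    rw [norm_mul, Complex.norm_real, Real.norm_of_nonneg (hp.nonneg x), Complex.norm_natCast]

theorem charSeries_zero : charSeries (fun x => (p x : ℂ)) 0 = 1 := by
  have h := Complex.hasSum_ofReal.2 hp.hasSum
  simpa [charSeries] using h.tsum_eq

theorem charSeries_mul_zero : charSeries (fun x => (x : ℂ) * (p x : ℂ)) 0 = lawMean p := by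
  have h := (Complex.hasSum_ofReal.2 hp.summable_mul.hasSum).tsum_eq
  simpa [charSeries, lawMean] using h

theorem lawMean_nonneg : 0 ≤ lawMean p := tsum_nonneg fun x => mul_nonneg x.cast_nonneg (hp.nonneg x)

theorem continuous_centeredChar (m : ℝ) : Continuous (centeredChar p m) := by
  refine continuous_tsum (fun x => by fun_prop) hp.hasSum.summable fun x θ => ?_
  rw [norm_mul, show Complex.I * (((x : ℝ) - m : ℝ) : ℂ) * (θ : ℂ) =
    ((((x : ℝ) - m) * θ : ℝ) : ℂ) * Complex.I by push_cast; ring,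
    Complex.norm_exp_ofReal_mul_I]
  simp [abs_of_nonneg (hp.nonneg x)]

end IsSqLaw

namespace SaturableSystem

variable {p : ι → ℕ → ℝ} {F : Finset ι} {ξ : ι → ℝ} {ψ : ι → ℝ → ℂ} {ρ K r B κ : ℝ}
  (H : SaturableSystem p F ξ ψ ρ K r B κ)
include H

theorem sigma_pos : 0 < sigmaOutside p F := one_pos.trans_le H.one_le_sigma

theorem alpha_pos : 0 < heavyScale ρ := one_pos.trans_le H.one_le_alpha

theorem sigma_sq : sigmaOutside p F ^ 2 = ∑ k ∈ Fᶜ, absMoment (p k) (lawMean (p k)) 2 :=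
  sigmaOutside_sq F H.law

theorem beta_eq : ∑ k ∈ Fᶜ, absMoment (p k) (lawMean (p k)) (2 + r) =
    lyapOutside p F r * sigmaOutside p F ^ (2 + r) := by
  rw [lyapOutside, div_mul_cancel₀ _ (Real.rpow_pos_of_pos H.sigma_pos _).ne']

theorem rpow_neg_le : sigmaOutside p F ^ (-r) ≤ 4 * lyapOutside p F r :=
  sigmaOutside_rpow_neg_le H.law H.r_pos H.r_le H.moment H.sigma_pos

theorem lyap_nonneg : 0 ≤ lyapOutside p F r := lyapOutside_nonneg F r H.law

/-- Lyapounov's inequality for one variable against the total moment: no single variance is a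
sizeable share of `σ²` when `L` is small. -/
theorem variance_le_of_notMem {k : ι} (hk : k ∉ F) : absMoment (p k) (lawMean (p k)) 2 ≤
    lyapOutside p F r ^ (2 / (2 + r)) * sigmaOutside p F ^ 2 := by
  have hr := H.r_pos
  have h1 := (H.law k).variance_rpow_le hr (H.moment k hk)
  have h2 : absMoment (p k) (lawMean (p k)) (2 + r) ≤
      lyapOutside p F r * sigmaOutside p F ^ (2 + r) := by
    rw [← H.beta_eq]
    exact Finset.single_le_sum (f := fun k => absMoment (p k) (lawMean (p k)) (2 + r))
      (fun j _ => (H.law j).absMoment_nonneg _ _) (Finset.mem_compl.2 hk)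
  have h3 := Real.rpow_le_rpow (Real.rpow_nonneg ((H.law k).absMoment_nonneg _ _) _)
    (h1.trans h2) (by positivity : 0 ≤ 2 / (2 + r))
  rw [← Real.rpow_mul ((H.law k).absMoment_nonneg _ _),
    Real.mul_rpow H.lyap_nonneg (Real.rpow_nonneg H.sigma_pos.le _),
    ← Real.rpow_mul H.sigma_pos.le] at h3
  have e1 : (1 + r / 2) * (2 / (2 + r)) = 1 := by field_simp
  have e2 : (2 + r) * (2 / (2 + r)) = (2 : ℕ) := by push_cast; field_simp
  rwa [e1, e2, Real.rpow_one, Real.rpow_natCast] at h3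

variable {ℓ : ℕ} {A : Finset ι} (hA : A ⊆ Fᶜ) (hAℓ : A.card ≤ ℓ)
include hA hAℓ

/-- Leaving out at most `ℓ` variables removes at most three quarters of the variance, so the
standard deviation `τ` of the remaining ones is at least `σ/2`. The scale `σ` and the ratio `L`
remain those of the full system. -/
theorem heavyScales (hℓ : ℓ * lyapOutside p F r ^ (2 / (2 + r)) ≤ 3 / 4) :
    HeavyScales r (2 / Real.pi ^ 2 / κ ^ 2) (heavyScale ρ) (sigmaOutside p F)
      (√(∑ k ∈ Fᶜ \ A, absMoment (p k) (lawMean (p k)) 2)) (lyapOutside p F r) where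
  r_pos := H.r_pos
  r_le := H.r_le
  c_pos := by
    have := H.two_le
    positivity
  c_le := by
    have h1 : 2 ^ 2 ≤ κ ^ 2 := pow_le_pow_left₀ zero_le_two H.two_le 2
    have h2 : (8 : ℝ) ≤ Real.pi ^ 2 := by nlinarith [Real.pi_gt_three]
    rw [div_div, div_le_div_iff₀ (by positivity) (by norm_num)]
    nlinarith
  one_le_alpha := H.one_le_alpha
  one_le_sigma := H.one_le_sigma
  sigma_le := H.sigma_le_alpha
  le_one := H.lyap_le_one
  rpow_le := H.rpow_neg_le
  half_le := by
    refine Real.le_sqrt_of_sq_le ?_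
    have h1 := Finset.sum_sdiff (f := fun k => absMoment (p k) (lawMean (p k)) 2) hA
    rw [← H.sigma_sq] at h1
    have h2 : ∑ k ∈ A, absMoment (p k) (lawMean (p k)) 2 ≤ 3 / 4 * sigmaOutside p F ^ 2 := by
      calc _ ≤ ∑ _k ∈ A, lyapOutside p F r ^ (2 / (2 + r)) * sigmaOutside p F ^ 2 :=
            Finset.sum_le_sum fun k hk => H.variance_le_of_notMem (Finset.mem_compl.1 (hA hk))
        _ = A.card * (lyapOutside p F r ^ (2 / (2 + r)) * sigmaOutside p F ^ 2) := by
            rw [Finset.sum_const, nsmul_eq_mul]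
        _ ≤ ℓ * (lyapOutside p F r ^ (2 / (2 + r)) * sigmaOutside p F ^ 2) := by
            have := H.lyap_nonneg
            gcongr
        _ = (ℓ * lyapOutside p F r ^ (2 / (2 + r))) * sigmaOutside p F ^ 2 := by ring
        _ ≤ _ := by gcongr
    linarith
  tau_le := by
    refine Real.sqrt_le_sqrt ?_
    exact Finset.sum_le_sum_of_subset_of_nonneg Finset.sdiff_subset
      fun k _ _ => (H.law k).absMoment_nonneg _ _

/-- Each omitted variable takes at most `1/4` from the sum of the `γ_k²`, so over `|θ| ≤ π` the loss
is at most the factor `exp(ℓ/2)`. -/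
theorem exp_pairSum_le {θ : ℝ} (hθ : |θ| ≤ Real.pi) :
    Real.exp (-(2 / Real.pi ^ 2 * (∑ k ∈ Fᶜ \ A, pairSum (p k)) * θ ^ 2)) ≤
      Real.exp (ℓ / 2) *
        Real.exp (-(2 / Real.pi ^ 2 / κ ^ 2 * sigmaOutside p F ^ 2 * θ ^ 2)) := by
  rw [← Real.exp_add]
  refine Real.exp_le_exp.2 ?_
  have hκ : 0 < κ := lt_of_lt_of_le two_pos H.two_le
  have h1 := Finset.sum_sdiff (f := fun k => pairSum (p k)) hA
  have h2 : ∑ k ∈ A, pairSum (p k) ≤ ℓ * (1 / 4) := by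
    calc _ ≤ ∑ _k ∈ A, (1 / 4 : ℝ) := Finset.sum_le_sum fun k _ => (H.law k).pairSum_le_quarter
      _ = A.card * (1 / 4) := by rw [Finset.sum_const, nsmul_eq_mul]
      _ ≤ _ := by gcongr
  have h3 : sigmaOutside p F ^ 2 / κ ^ 2 ≤ ∑ k ∈ Fᶜ, pairSum (p k) := by
    rw [div_le_iff₀ (by positivity)]
    have h4 := pow_le_pow_left₀ H.sigma_pos.le H.sigma_le_gamma 2
    rw [mul_pow, Real.sq_sqrt (Finset.sum_nonneg fun k _ => (H.law k).pairSum_nonneg)] at h4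
    linarith
  have h5 : θ ^ 2 ≤ Real.pi ^ 2 := sq_le_sq' (by linarith [abs_le.1 hθ]) (abs_le.1 hθ).2
  have h6 : 2 / Real.pi ^ 2 * (ℓ * (1 / 4)) * θ ^ 2 ≤ ℓ / 2 := by
    calc _ ≤ 2 / Real.pi ^ 2 * (ℓ * (1 / 4)) * Real.pi ^ 2 := by gcongr
      _ = _ := by field_simp; ring
  have h7 : 2 / Real.pi ^ 2 * (sigmaOutside p F ^ 2 / κ ^ 2 - ℓ * (1 / 4)) * θ ^ 2 ≤
      2 / Real.pi ^ 2 * (∑ k ∈ Fᶜ \ A, pairSum (p k)) * θ ^ 2 := by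
    gcongr
    linarith
  have e : 2 / Real.pi ^ 2 / κ ^ 2 * sigmaOutside p F ^ 2 * θ ^ 2 =
      2 / Real.pi ^ 2 * (sigmaOutside p F ^ 2 / κ ^ 2) * θ ^ 2 := by ring
  rw [e]
  linarith

theorem norm_prod_char_le {θ : ℝ} (hθ : |θ| ≤ Real.pi) :
    ‖∏ k ∈ Fᶜ \ A, centeredChar (p k) (lawMean (p k)) θ‖ ≤ Real.exp (ℓ / 2) *
      Real.exp (-(2 / Real.pi ^ 2 / κ ^ 2 * sigmaOutside p F ^ 2 * θ ^ 2)) :=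
  (norm_prod_centeredChar_le (fun k _ => H.law k) hθ).trans (H.exp_pairSum_le hA hAℓ hθ)

theorem norm_prod_char_sub_le {θ : ℝ} (hθ : |θ| ≤ Real.pi) :
    ‖∏ k ∈ Fᶜ \ A, centeredChar (p k) (lawMean (p k)) θ - Complex.exp
        (-((√(∑ k ∈ Fᶜ \ A, absMoment (p k) (lawMean (p k)) 2) : ℝ) ^ 2 * θ ^ 2 / 2))‖ ≤
      5 * Real.exp (1 / 2) * Real.exp (ℓ / 2) * (lyapOutside p F r * sigmaOutside p F ^ (2 + r) *
        |θ| ^ (2 + r) * Real.exp (-(2 / Real.pi ^ 2 / κ ^ 2 * sigmaOutside p F ^ 2 * θ ^ 2))) := by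
  have h1 := norm_prod_centeredChar_sub_le (T := Fᶜ \ A) (p := p) (m := fun k => lawMean (p k))
    H.r_pos H.r_le (fun k _ => H.law k) (fun k _ => rfl)
    (fun k hk => H.moment k (Finset.mem_compl.1 (Finset.mem_sdiff.1 hk).1)) hθ
  have h2 : (Complex.exp
      (-((√(∑ k ∈ Fᶜ \ A, absMoment (p k) (lawMean (p k)) 2) : ℝ) ^ 2 * θ ^ 2 / 2) : ℂ)) =
      (Real.exp (-((∑ k ∈ Fᶜ \ A, absMoment (p k) (lawMean (p k)) 2) * θ ^ 2 / 2)) : ℂ) := by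
    rw [← Complex.ofReal_pow, Real.sq_sqrt
      (Finset.sum_nonneg fun k _ => (H.law k).absMoment_nonneg _ _)]
    push_cast
    rfl
  rw [h2]
  refine h1.trans ?_
  have h3 : ∑ k ∈ Fᶜ \ A, absMoment (p k) (lawMean (p k)) (2 + r) ≤
      lyapOutside p F r * sigmaOutside p F ^ (2 + r) := by
    rw [← H.beta_eq]
    exact Finset.sum_le_sum_of_subset_of_nonneg Finset.sdiff_subset
      fun k _ _ => (H.law k).absMoment_nonneg _ _
  have h4 := H.exp_pairSum_le hA hAℓ hθ
  have h5 := H.lyap_nonneg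
  have h6 := H.sigma_pos
  calc _ ≤ 5 * Real.exp (1 / 2) * (lyapOutside p F r * sigmaOutside p F ^ (2 + r)) *
        |θ| ^ (2 + r) * (Real.exp (ℓ / 2) *
          Real.exp (-(2 / Real.pi ^ 2 / κ ^ 2 * sigmaOutside p F ^ 2 * θ ^ 2))) := by gcongr
    _ = _ := by ring

end SaturableSystem

end SaturableSystem

end

/-! ### Local limit for a saturable system. -/

noncomputable section

section LocalLimit

variable {ι : Type} [Fintype ι] [DecidableEq ι]

/-- The integrand of the inversion formula for a saturable system, at order `y * heavyScale ρ`
and up to a shift `η`; the variables of `A` are left out. -/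
def localIntegrand (p : ι → ℕ → ℝ) (F A : Finset ι) (ψ : ι → ℝ → ℂ) (ρ s η y θ : ℝ) : ℂ :=
  Complex.exp (Complex.I * (η - y * heavyScale ρ) * θ) * heavyOmega ρ θ ^ (s : ℂ) *
    (∏ k ∈ F, ψ k θ) * ∏ k ∈ Fᶜ \ A, centeredChar (p k) (lawMean (p k)) θ

/-- A bound for the factors of `localIntegrand` that vary on the scale of `1`. -/
def tiltConst (B K : ℝ) : ℝ :=
  (1 + 2 * Real.pi * (B * K + 1)) * (1 + 2 * Real.pi * (12 * (B + 1) * 2 ^ (B + 1))) *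
    (1 + 2 * Real.pi * K) ^ ⌊B⌋₊

theorem one_le_tiltConst {B K : ℝ} (hB : 0 ≤ B) (hK : 0 ≤ K) : 1 ≤ tiltConst B K := by
  have h1 : 1 ≤ 1 + 2 * Real.pi * (B * K + 1) := le_add_of_nonneg_right (by positivity)
  have h2 : 1 ≤ 1 + 2 * Real.pi * (12 * (B + 1) * 2 ^ (B + 1)) :=
    le_add_of_nonneg_right (by positivity)
  have h3 : 1 ≤ (1 + 2 * Real.pi * K) ^ ⌊B⌋₊ :=
    one_le_pow₀ (le_add_of_nonneg_right (by positivity))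
  exact one_le_mul_of_one_le_of_one_le (one_le_mul_of_one_le_of_one_le h1 h2) h3

theorem heavyOmega_zero {ρ : ℝ} (hρ : ρ < 1) : heavyOmega ρ 0 = 1 := by
  have : (1 - (ρ : ℂ)) ≠ 0 := by
    rw [← Complex.ofReal_one, ← Complex.ofReal_sub, Complex.ofReal_ne_zero]
    linarith
  simp [heavyOmega, this]

namespace SaturableSystem

variable {p : ι → ℕ → ℝ} {F : Finset ι} {ξ : ι → ℝ} {ψ : ι → ℝ → ℂ} {ρ K r B κ : ℝ}
  (H : SaturableSystem p F ξ ψ ρ K r B κ)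
include H

theorem psi_zero {k : ι} (hk : k ∈ F) : ψ k 0 = 1 := by
  have h := H.char_eq k hk 0
  rw [(H.law k).charSeries_zero, heavyOmega_zero H.rho_lt, Complex.one_cpow, one_mul] at h
  exact h.symm

theorem K_nonneg : 0 ≤ K := by
  obtain ⟨k, hk⟩ := H.nonempty
  exact (norm_nonneg _).trans (H.deriv_le k hk 0)

/-- Exponents at least `1` with bounded sum mean boundedly many saturable queues, so the product of
the `ψ k` is a tilt with a uniform constant. -/
theorem card_le_sum : (F.card : ℝ) ≤ ∑ k ∈ F, ξ k := by
  calc (F.card : ℝ) = ∑ _k ∈ F, (1 : ℝ) := by simp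
    _ ≤ _ := Finset.sum_le_sum H.one_le

theorem one_le_sum : 1 ≤ ∑ k ∈ F, ξ k := by
  refine le_trans ?_ H.card_le_sum
  exact_mod_cast Finset.card_pos.2 H.nonempty

theorem one_le_B : 1 ≤ B := H.one_le_sum.trans H.sum_le

/-- Differentiation of the saturable form of the transform. The main term has one more power of `ω`
and a factor `α`; the other contains `ψ'` and no `α`. -/
theorem charSeries_mul {k : ι} (hk : k ∈ F) (θ : ℝ) :
    charSeries (fun x => (x : ℂ) * (p k x : ℂ)) θ =
      ξ k * heavyScale ρ * Complex.exp (Complex.I * θ) *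
        heavyOmega ρ θ ^ ((ξ k + 1 : ℝ) : ℂ) * ψ k θ -
      Complex.I * heavyOmega ρ θ ^ (ξ k : ℂ) * deriv (ψ k) θ := by
  have h1 := hasDerivAt_charSeries (H.law k).summable_norm (H.law k).summable_norm_mul θ
  have h2 := (hasDerivAt_cpow_const_of_mem_slitPlane
    (hasDerivAt_heavyOmega H.rho_pos H.rho_lt θ)
    (heavyOmega_mem_slitPlane H.rho_pos H.rho_lt θ) (ξ k : ℂ)).mul
    ((H.differentiable k hk) θ).hasDerivAt
  have h3 : charSeries (fun x => (p k x : ℂ)) =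
      (fun θ => heavyOmega ρ θ ^ (ξ k : ℂ)) * ψ k := funext (H.char_eq k hk)
  rw [← h3] at h2
  have h4 := h1.unique h2
  have hω := heavyOmega_ne_zero H.rho_pos H.rho_lt θ
  have e : heavyOmega ρ θ ^ ((ξ k : ℂ) - 1) * heavyOmega ρ θ ^ 2 =
      heavyOmega ρ θ ^ ((ξ k + 1 : ℝ) : ℂ) := by
    rw [← Complex.cpow_ofNat, ← Complex.cpow_add _ _ hω]
    congr 1
    push_cast
    ring
  rw [← e]
  refine mul_left_cancel₀ Complex.I_ne_zero (h4.trans ?_)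
  linear_combination (heavyOmega ρ θ ^ (ξ k : ℂ) * deriv (ψ k) θ) * Complex.I_sq

theorem abs_mean_sub_le {k : ι} (hk : k ∈ F) : |lawMean (p k) - ξ k * heavyScale ρ| ≤ K := by
  have h := H.charSeries_mul hk 0
  rw [(H.law k).charSeries_mul_zero, heavyOmega_zero H.rho_lt, H.psi_zero hk] at h
  simp only [Complex.one_cpow, Complex.ofReal_zero, mul_zero, Complex.exp_zero, mul_one] at h
  have h2 : ((lawMean (p k) - ξ k * heavyScale ρ : ℝ) : ℂ) = -(Complex.I * deriv (ψ k) 0) := by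
    push_cast
    rw [h]
    ring
  rw [← Real.norm_eq_abs, ← Complex.norm_real, h2, norm_neg, norm_mul, Complex.norm_I, one_mul]
  exact H.deriv_le k hk 0

/-- The derivative at `θ = 0` gives each saturable mean as `ξ_k α` up to `K`. The total discrepancy
becomes the phase shift `η` of `localIntegrand`. -/
theorem abs_sum_mean_sub_le :
    |(∑ k ∈ F, ξ k) * heavyScale ρ - ∑ k ∈ F, lawMean (p k)| ≤ B * K := by
  rw [Finset.sum_mul, ← Finset.sum_sub_distrib]
  calc _ ≤ ∑ k ∈ F, |ξ k * heavyScale ρ - lawMean (p k)| := Finset.abs_sum_le_sum_abs _ _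
    _ ≤ ∑ _k ∈ F, K := Finset.sum_le_sum fun k hk => by
        rw [abs_sub_comm]
        exact H.abs_mean_sub_le hk
    _ = F.card * K := by rw [Finset.sum_const, nsmul_eq_mul]
    _ ≤ B * K := mul_le_mul_of_nonneg_right (H.card_le_sum.trans H.sum_le) H.K_nonneg

theorem prod_omega (θ : ℝ) : ∏ k ∈ F, heavyOmega ρ θ ^ (ξ k : ℂ) =
    heavyOmega ρ θ ^ ((∑ k ∈ F, ξ k : ℝ) : ℂ) := by
  have hω := heavyOmega_ne_zero H.rho_pos H.rho_lt θ
  push_cast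
  rw [Complex.cpow_def_of_ne_zero hω, Finset.mul_sum, Complex.exp_sum]
  exact Finset.prod_congr rfl fun k _ => Complex.cpow_def_of_ne_zero hω _

theorem isTilt_psi {k : ι} (hk : k ∈ F) : IsTilt (1 + 2 * Real.pi * K) (ψ k) :=
  IsTilt.of_deriv_le (H.differentiable k hk) (H.psi_zero hk) fun θ _ => H.deriv_le k hk θ

/-- The extra `1` allowed on `s` and on `η` is for the size-biased integrand, with its additional
factors `ω` and `exp(iθ)`. -/
theorem isTilt {s η : ℝ} (hs : 0 ≤ s) (hsB : s ≤ B + 1) (hη : |η| ≤ B * K + 1) :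
    IsTilt (tiltConst B K) fun θ => Complex.exp (Complex.I * η * θ) *
      (heavyOmega ρ θ ^ (s : ℂ) * linFactor (heavyScale ρ) θ ^ (s : ℂ)) * ∏ k ∈ F, ψ k θ := by
  have hB := H.one_le_B
  have hK := H.K_nonneg
  refine (IsTilt.mul (M := (1 + 2 * Real.pi * (B * K + 1)) *
    (1 + 2 * Real.pi * (12 * (B + 1) * 2 ^ (B + 1)))) ?_ ?_).mono le_rfl
  · exact ((IsTilt.exp η).mono (by gcongr)).mul
      (isTilt_omega_mul_linFactor H.rho_pos H.rho_lt hs hsB)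
  · refine (IsTilt.prod fun k hk => H.isTilt_psi hk).mono ?_
    exact pow_le_pow_right₀ (le_add_of_nonneg_right (by positivity))
      (Nat.le_floor (H.card_le_sum.trans H.sum_le))

theorem continuous_psi {k : ι} (hk : k ∈ F) : Continuous (ψ k) := (H.differentiable k hk).continuous

theorem continuous_omega_cpow (s : ℂ) : Continuous fun θ => heavyOmega ρ θ ^ s :=
  continuous_iff_continuousAt.2 fun θ => (hasDerivAt_cpow_const_of_mem_slitPlane
    (hasDerivAt_heavyOmega H.rho_pos H.rho_lt θ)
    (heavyOmega_mem_slitPlane H.rho_pos H.rho_lt θ) s).continuousAt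

theorem continuous_prod_char (A : Finset ι) :
    Continuous fun θ => ∏ k ∈ Fᶜ \ A, centeredChar (p k) (lawMean (p k)) θ :=
  continuous_finsetProd _ fun k _ => (H.law k).continuous_centeredChar _

theorem continuous_localIntegrand (A : Finset ι) (s η y : ℝ) :
    Continuous (localIntegrand p F A ψ ρ s η y) := by
  unfold localIntegrand
  have h1 := H.continuous_omega_cpow s
  have h2 := H.continuous_prod_char A
  have h3 : Continuous fun θ => ∏ k ∈ F, ψ k θ :=
    continuous_finsetProd _ fun k hk => H.continuous_psi hk
  fun_prop

omit H in
theorem localIntegrand_eq (A : Finset ι) (s η y θ : ℝ) : localIntegrand p F A ψ ρ s η y θ =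
    Complex.exp (-(Complex.I * y * heavyScale ρ * θ)) * linFactor (heavyScale ρ) θ ^ (-(s : ℂ)) *
      (Complex.exp (Complex.I * η * θ) *
        (heavyOmega ρ θ ^ (s : ℂ) * linFactor (heavyScale ρ) θ ^ (s : ℂ)) * ∏ k ∈ F, ψ k θ) *
      ∏ k ∈ Fᶜ \ A, centeredChar (p k) (lawMean (p k)) θ := by
  have h1 : linFactor (heavyScale ρ) θ ^ (s : ℂ) ≠ 0 := by
    simp [Complex.cpow_eq_zero_iff, linFactor_ne_zero]
  have h2 : Complex.exp (Complex.I * (η - y * heavyScale ρ) * θ) =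
      Complex.exp (-(Complex.I * y * heavyScale ρ * θ)) * Complex.exp (Complex.I * η * θ) := by
    rw [← Complex.exp_add]
    ring_nf
  rw [localIntegrand, h2, Complex.cpow_neg]
  field_simp

end SaturableSystem

/-- The constant precedes the index type, hence is uniform in `n`. The Gamma density is wanted at
the unshifted point `y`, the displacement `d/α` being part of the error. -/
theorem exists_integral_localIntegrand_le {B K r κ : ℝ} (hB : 1 ≤ B) (hK : 0 ≤ K) (hr : 0 < r)
    (hκ : 2 ≤ κ) (ℓ : ℕ) : ∃ C, 0 ≤ C ∧ ∀ {ι : Type} [Fintype ι] [DecidableEq ι]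
      {p : ι → ℕ → ℝ} {F A : Finset ι} {ξ : ι → ℝ} {ψ : ι → ℝ → ℂ} {ρ : ℝ},
      SaturableSystem p F ξ ψ ρ K r B κ → A ⊆ Fᶜ → A.card ≤ ℓ →
      ℓ * lyapOutside p F r ^ (2 / (2 + r)) ≤ 3 / 4 →
      ∀ s η y d : ℝ, 1 ≤ s → s ≤ B + 1 → |η| ≤ B * K + 1 → 1 ≤ y →
      ‖(∫ θ in (-Real.pi)..Real.pi, localIntegrand p F A ψ ρ s η (y + d / heavyScale ρ) θ) -
          2 * Real.pi / heavyScale ρ * gammaDensity s y‖ ≤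
        C / heavyScale ρ * (heavyError (heavyScale ρ) (sigmaOutside p F) (lyapOutside p F r) r s +
          |d| / heavyScale ρ) := by
  have hc8 : 2 / Real.pi ^ 2 / κ ^ 2 ≤ 1 / 8 := by
    have h1 : 2 ^ 2 ≤ κ ^ 2 := pow_le_pow_left₀ zero_le_two hκ 2
    have h2 : (8 : ℝ) ≤ Real.pi ^ 2 := by nlinarith [Real.pi_gt_three]
    rw [div_div, div_le_div_iff₀ (by positivity) (by norm_num)]
    nlinarith
  have hM := one_le_tiltConst (zero_le_one.trans hB) hK
  set K' := tiltConst B K + 5 * Real.exp (1 / 2) * Real.exp (ℓ / 2) with hK'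
  have hK1 : 0 ≤ K' := by positivity
  obtain ⟨C, hC, hcore⟩ := exists_local_limit_le (B := B + 1) (K := K')
    (c := 2 / Real.pi ^ 2 / κ ^ 2) (by linarith) hK1 (by positivity) hc8 hr
  obtain ⟨G, hG, hGle⟩ := exists_gammaDensity_le (B + 1)
  obtain ⟨D, hD, hLip⟩ := exists_gammaDensity_lipschitz (B + 1)
  have hπ := Real.pi_pos
  refine ⟨2 * C + 2 * Real.pi * D + 4 * Real.pi * G, by positivity, ?_⟩
  intro ι _ _ p F A ξ ψ ρ H hA hAℓ hℓ s η y d hs hsB hη hy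
  have hα := H.alpha_pos
  have hT := H.isTilt (zero_le_one.trans hs) hsB hη
  have hS := H.heavyScales hA hAℓ hℓ
  have hε := (hS.heavyError_pos s).le
  have hsB' : s ∈ Set.Icc 1 (B + 1) := ⟨hs, hsB⟩
  obtain ⟨h1, h2⟩ := hcore s _ _ _ _ (y + d / heavyScale ρ) hS hs hsB _ _ hT.differentiable
    hT.map_zero (fun θ hθ => (hT.norm_deriv_le θ hθ).trans (by
      rw [div_le_iff₀ (by positivity)]
      have : 0 ≤ 5 * Real.exp (1 / 2) * Real.exp ((ℓ : ℝ) / 2) := by positivity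
      nlinarith [Real.pi_gt_three])) (H.continuous_prod_char A)
    (fun θ hθ => (H.norm_prod_char_sub_le hA hAℓ hθ).trans (by
      have := H.lyap_nonneg
      have := H.sigma_pos
      refine mul_le_mul_of_nonneg_right ?_ (by positivity)
      linarith))
  simp only [← SaturableSystem.localIntegrand_eq] at h1 h2
  set J := ∫ θ in (-Real.pi)..Real.pi, localIntegrand p F A ψ ρ s η (y + d / heavyScale ρ) θ
  set α := heavyScale ρ
  set ε := heavyError α (sigmaOutside p F) (lyapOutside p F r) r s
  have hd : |d / α| = |d| / α := by rw [abs_div, abs_of_pos hα]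
  have hx : 0 ≤ |d| / α := by positivity
  have key : ∀ v : ℝ, ‖(2 * Real.pi / α * v : ℂ)‖ = 2 * Real.pi / α * |v| := fun v => by
    rw [norm_mul, norm_div, norm_mul, Complex.norm_real, Complex.norm_real, Complex.norm_real,
      Real.norm_of_nonneg hα.le, Real.norm_of_nonneg hπ.le, Complex.norm_ofNat, Real.norm_eq_abs]
  rcases le_or_gt (1 / 2) (y + d / α) with hy2 | hy2
  · have h3 := hLip s hsB' y (y + d / α) (by linarith) (by linarith)
    rw [add_sub_cancel_left, hd] at h3
    calc _ = ‖(J - 2 * Real.pi / α * gammaDensity s (y + d / α)) +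
          2 * Real.pi / α * ((gammaDensity s (y + d / α) - gammaDensity s y : ℝ) : ℂ)‖ := by
          congr 1
          push_cast
          ring
      _ ≤ C / α * ε + 2 * Real.pi / α * (D * (|d| / α)) := by
          refine (norm_add_le _ _).trans (add_le_add (h1 hy2) ?_)
          rw [key]
          gcongr
      _ = 1 / α * (C * ε + 2 * Real.pi * D * (|d| / α)) := by ring
      _ ≤ 1 / α * ((2 * C + 2 * Real.pi * D + 4 * Real.pi * G) * (ε + |d| / α)) := by
          gcongr
          have e1 := mul_nonneg hC hε
          have e2 : 0 ≤ 2 * Real.pi * D * ε := by positivity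
          have e3 : 0 ≤ 4 * Real.pi * G * (ε + |d| / α) := by positivity
          have e4 := mul_nonneg hC hx
          linarith
      _ = _ := by ring
  -- The displaced point may be near `0` or negative. Since `y ≥ 1`, the allowed error is then
  -- already of order `1/α`, and the crude bound suffices.
  · have h3 : 1 / 2 ≤ |d| / α := by
      rw [← hd]
      linarith [neg_abs_le (d / α)]
    calc _ ≤ C / α + 2 * Real.pi / α * G := by
          refine (norm_sub_le _ _).trans (add_le_add h2 ?_)
          rw [key, abs_of_nonneg (gammaDensity_nonneg (by linarith) _)]
          gcongr
          exact hGle s hsB' y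
      _ = 1 / α * ((2 * C + 4 * Real.pi * G) * (1 / 2)) := by ring
      _ ≤ 1 / α * ((2 * C + 2 * Real.pi * D + 4 * Real.pi * G) * (ε + |d| / α)) := by
          gcongr
          · have : 0 ≤ 2 * Real.pi * D := by positivity
            linarith
          · linarith
      _ = _ := by ring

end LocalLimit

end

/-! ### The denominator and the marginal numerators. -/

noncomputable section

section Numerators

theorem convCoeff_eq_integral {ι : Type*} [Fintype ι] [DecidableEq ι] {a : ι → ℕ → ℝ}
    (ha : ∀ k, Summable fun x => ‖(a k x : ℂ)‖) (N : ℕ) : (convCoeff a N : ℂ) =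
      (1 / (2 * Real.pi) : ℝ) * ∫ θ in (-Real.pi)..Real.pi, Complex.exp (-(Complex.I * N * θ)) *
        ∏ k, charSeries (fun x => (a k x : ℂ)) θ := by
  rw [← sum_piAntidiag_prod_eq_integral _ ha, convCoeff]
  push_cast
  rfl

/-- A Fourier coefficient is bounded by the supremum of the function. This crude bound is what
serves for the finitely many small `n`. -/
theorem abs_convCoeff_le {ι : Type*} [Fintype ι] [DecidableEq ι] {a : ι → ℕ → ℝ} {s : ι → ℝ}
    (ha : ∀ k, HasSum (fun x => ‖(a k x : ℂ)‖) (s k)) (N : ℕ) : |convCoeff a N| ≤ ∏ k, s k := by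
  rw [← Real.norm_eq_abs, ← Complex.norm_real, convCoeff_eq_integral fun k => (ha k).summable,
    norm_mul, Complex.norm_real, Real.norm_of_nonneg (by positivity)]
  have h := intervalIntegral.norm_integral_le_of_norm_le_const (a := -Real.pi) (b := Real.pi)
    (f := fun θ : ℝ => Complex.exp (-(Complex.I * N * θ)) *
        ∏ k, charSeries (fun x => (a k x : ℂ)) θ) (C := ∏ k, s k) fun θ _ => by
    rw [norm_mul, show -(Complex.I * N * θ) = ((-(N * θ) : ℝ) : ℂ) * Complex.I by push_cast; ring,
      Complex.norm_exp_ofReal_mul_I, one_mul, norm_prod]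
    exact Finset.prod_le_prod (fun _ _ => norm_nonneg _) fun k _ => norm_charSeries_le (ha k) θ
  rw [sub_neg_eq_add, ← two_mul, abs_of_pos (by positivity)] at h
  calc _ ≤ 1 / (2 * Real.pi) * ((∏ k, s k) * (2 * Real.pi)) := by gcongr
    _ = _ := by field_simp

variable {ι : Type} [DecidableEq ι]

/-- The sequences whose convolution is the joint law of the variables of `A`, at `q`, and of the
sum of all variables. -/
def marginalWeight (p : ι → ℕ → ℝ) (A : Finset ι) (q : ι → ℕ) (k : ι) (x : ℕ) : ℝ :=
  if k ∈ A ∧ x ≠ q k then 0 else p k x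

/-- The sequences whose convolution is the expectation of the variable `j` on the values of the
sum of all variables. -/
def sizeBiasedWeight (p : ι → ℕ → ℝ) (j k : ι) (x : ℕ) : ℝ :=
  if k = j then x * p k x else p k x

theorem marginalWeight_empty (p : ι → ℕ → ℝ) (q : ι → ℕ) : marginalWeight p ∅ q = p := by
  ext k x
  simp [marginalWeight]

theorem hasSum_norm_marginalWeight {p : ι → ℕ → ℝ} (hp : ∀ k, IsSqLaw (p k)) (A : Finset ι)
    (q : ι → ℕ) (k : ι) : HasSum (fun x => ‖(marginalWeight p A q k x : ℂ)‖)
      (if k ∈ A then p k (q k) else 1) := by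
  split_ifs with hk
  · have h : (fun x => ‖(marginalWeight p A q k x : ℂ)‖) =
        fun x => if x = q k then p k (q k) else 0 := by
      ext x
      by_cases hx : x = q k
      · subst hx
        simp [marginalWeight, abs_of_nonneg ((hp k).nonneg _)]
      · simp [marginalWeight, hk, hx]
    rw [h]
    exact hasSum_ite_eq _ _
  · refine (hp k).hasSum.congr_fun fun x => ?_
    simp [marginalWeight, hk, abs_of_nonneg ((hp k).nonneg _)]

theorem hasSum_norm_sizeBiasedWeight {p : ι → ℕ → ℝ} (hp : ∀ k, IsSqLaw (p k)) (j k : ι) :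
    HasSum (fun x => ‖(sizeBiasedWeight p j k x : ℂ)‖) (if k = j then lawMean (p k) else 1) := by
  split_ifs with hk
  · refine (hp k).summable_mul.hasSum.congr_fun fun x => ?_
    simp [sizeBiasedWeight, hk, abs_of_nonneg ((hp j).nonneg _)]
  · refine (hp k).hasSum.congr_fun fun x => ?_
    simp [sizeBiasedWeight, hk, abs_of_nonneg ((hp k).nonneg _)]

theorem charSeries_marginalWeight (p : ι → ℕ → ℝ) {A : Finset ι} (q : ι → ℕ) {k : ι} (hk : k ∈ A)
    (θ : ℝ) : charSeries (fun x => (marginalWeight p A q k x : ℂ)) θ =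
      p k (q k) * Complex.exp (Complex.I * q k * θ) := by
  rw [charSeries, tsum_eq_single (q k) fun x hx => by simp [marginalWeight, hk, hx]]
  simp [marginalWeight]

theorem marginalWeight_of_notMem (p : ι → ℕ → ℝ) {A : Finset ι} (q : ι → ℕ) {k : ι}
    (hk : k ∉ A) : marginalWeight p A q k = p k := by
  ext x
  simp [marginalWeight, hk]

variable [Fintype ι]

/-- Centring: as all means sum to `N`, the phases of the non-saturable variables cancel against
`exp(-iNθ)`, leaving the means over `F` and the deviations on `A`. -/
theorem exp_mul_prod_charSeries {p : ι → ℕ → ℝ} {F A : Finset ι} (hA : A ⊆ Fᶜ) {N : ℕ}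
    (hN : ∑ k, lawMean (p k) = N) (q : ι → ℕ) (θ : ℝ) :
    Complex.exp (-(Complex.I * N * θ)) * (∏ k ∈ A, Complex.exp (Complex.I * q k * θ)) *
        ∏ k ∈ Fᶜ \ A, charSeries (fun x => (p k x : ℂ)) θ =
      Complex.exp (-(Complex.I * ((∑ k ∈ F, lawMean (p k) +
        ∑ k ∈ A, (lawMean (p k) - q k) : ℝ) : ℂ) * θ)) *
        ∏ k ∈ Fᶜ \ A, centeredChar (p k) (lawMean (p k)) θ := by
  have h1 : ∑ k ∈ F, lawMean (p k) + (∑ k ∈ Fᶜ \ A, lawMean (p k) + ∑ k ∈ A, lawMean (p k)) =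
      (N : ℝ) := by rw [Finset.sum_sdiff hA, Finset.sum_add_sum_compl, hN]
  rw [Finset.prod_congr rfl fun k _ => charSeries_eq_centeredChar (p k) (lawMean (p k)) θ,
    Finset.prod_mul_distrib, ← mul_assoc, ← Complex.exp_sum, ← Complex.exp_sum, ← Complex.exp_add,
    ← Complex.exp_add, ← Finset.sum_mul, ← Finset.mul_sum, ← Finset.sum_mul, ← Finset.mul_sum]
  congr 2
  rw [Finset.sum_sub_distrib, ← Complex.ofReal_natCast, ← h1]
  push_cast
  ring

namespace SaturableSystem

variable {p : ι → ℕ → ℝ} {F : Finset ι} {ξ : ι → ℝ} {ψ : ι → ℝ → ℂ} {ρ K r B κ : ℝ}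
  (H : SaturableSystem p F ξ ψ ρ K r B κ)
include H

theorem prod_charSeries (θ : ℝ) : ∏ k ∈ F, charSeries (fun x => (p k x : ℂ)) θ =
    heavyOmega ρ θ ^ ((∑ k ∈ F, ξ k : ℝ) : ℂ) * ∏ k ∈ F, ψ k θ := by
  rw [← H.prod_omega, ← Finset.prod_mul_distrib]
  exact Finset.prod_congr rfl fun k hk => H.char_eq k hk θ

/-- Writing the remaining phase as `η - yα` with `y = Ξ + d/α` forces `η = Ξα - ∑_F m_k`, a bounded
quantity, and `d = ∑_A (m_k - q_k)`. -/
theorem integrand_marginalWeight {A : Finset ι} (hA : A ⊆ Fᶜ) {N : ℕ}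
    (hN : ∑ k, lawMean (p k) = N) (q : ι → ℕ) (θ : ℝ) :
    Complex.exp (-(Complex.I * N * θ)) *
        ∏ k, charSeries (fun x => (marginalWeight p A q k x : ℂ)) θ =
      ((∏ k ∈ A, p k (q k) : ℝ) : ℂ) * localIntegrand p F A ψ ρ (∑ k ∈ F, ξ k)
        ((∑ k ∈ F, ξ k) * heavyScale ρ - ∑ k ∈ F, lawMean (p k))
        (∑ k ∈ F, ξ k + (∑ k ∈ A, (lawMean (p k) - q k)) / heavyScale ρ) θ := by
  have hα := H.alpha_pos.ne'
  rw [← Finset.prod_mul_prod_compl F, ← Finset.prod_sdiff hA,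
    Finset.prod_congr rfl fun k hk => charSeries_marginalWeight p q hk θ,
    Finset.prod_mul_distrib]
  have h1 : ∏ k ∈ F, charSeries (fun x => (marginalWeight p A q k x : ℂ)) θ =
      ∏ k ∈ F, charSeries (fun x => (p k x : ℂ)) θ := Finset.prod_congr rfl fun k hk => by
    rw [marginalWeight_of_notMem p q fun hkA => Finset.mem_compl.1 (hA hkA) hk]
  have h2 : ∏ k ∈ Fᶜ \ A, charSeries (fun x => (marginalWeight p A q k x : ℂ)) θ =
      ∏ k ∈ Fᶜ \ A, charSeries (fun x => (p k x : ℂ)) θ := Finset.prod_congr rfl fun k hk => by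
    rw [marginalWeight_of_notMem p q (Finset.mem_sdiff.1 hk).2]
  rw [h1, h2, H.prod_charSeries, localIntegrand]
  have h3 := exp_mul_prod_charSeries hA hN q θ
  have h4 : Complex.I * ((((∑ k ∈ F, ξ k) * heavyScale ρ - ∑ k ∈ F, lawMean (p k) : ℝ) : ℂ) -
      ((∑ k ∈ F, ξ k + (∑ k ∈ A, (lawMean (p k) - q k)) / heavyScale ρ : ℝ) : ℂ) *
        heavyScale ρ) * θ = -(Complex.I * ((∑ k ∈ F, lawMean (p k) +
        ∑ k ∈ A, (lawMean (p k) - q k) : ℝ) : ℂ) * θ) := by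
    rw [← Complex.ofReal_mul, add_mul, div_mul_cancel₀ _ hα]
    push_cast
    ring
  rw [h4]
  push_cast at h3 ⊢
  linear_combination (heavyOmega ρ θ ^ (∑ k ∈ F, ξ k : ℂ) * (∏ k ∈ F, ψ k θ) *
    ∏ k ∈ A, (p k (q k) : ℂ)) * h3

/-- The two terms of `charSeries_mul`. In the first, the extra `ω` raises the shape to `Ξ + 1` and
`exp(iθ)` adds `1` to the shift, while the evaluation point remains `Ξ`. -/
theorem integrand_sizeBiasedWeight {j : ι} (hj : j ∈ F) {N : ℕ}
    (hN : ∑ k, lawMean (p k) = N) (θ : ℝ) :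
    Complex.exp (-(Complex.I * N * θ)) *
        ∏ k, charSeries (fun x => (sizeBiasedWeight p j k x : ℂ)) θ =
      ξ j * heavyScale ρ * localIntegrand p F ∅ ψ ρ (∑ k ∈ F, ξ k + 1)
        (1 + (∑ k ∈ F, ξ k) * heavyScale ρ - ∑ k ∈ F, lawMean (p k)) (∑ k ∈ F, ξ k) θ -
      Complex.I * Complex.exp (-(Complex.I * ((∑ k ∈ F, lawMean (p k) : ℝ) : ℂ) * θ)) *
        heavyOmega ρ θ ^ ((∑ k ∈ F, ξ k : ℝ) : ℂ) *
        (deriv (ψ j) θ * ∏ k ∈ F.erase j, ψ k θ) *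
        ∏ k ∈ Fᶜ \ ∅, centeredChar (p k) (lawMean (p k)) θ := by
  have hω := heavyOmega_ne_zero H.rho_pos H.rho_lt θ
  rw [← Finset.prod_mul_prod_compl F, ← Finset.mul_prod_erase F _ hj]
  have h1 : ∏ k ∈ F.erase j, charSeries (fun x => (sizeBiasedWeight p j k x : ℂ)) θ =
      ∏ k ∈ F.erase j, (heavyOmega ρ θ ^ (ξ k : ℂ) * ψ k θ) := Finset.prod_congr rfl fun k hk => by
    rw [← H.char_eq k (Finset.mem_of_mem_erase hk)]
    simp [sizeBiasedWeight, Finset.ne_of_mem_erase hk]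
  have h2 : ∏ k ∈ Fᶜ, charSeries (fun x => (sizeBiasedWeight p j k x : ℂ)) θ =
      ∏ k ∈ Fᶜ \ ∅, charSeries (fun x => (p k x : ℂ)) θ := by
    rw [Finset.sdiff_empty]
    refine Finset.prod_congr rfl fun k hk => ?_
    have : k ≠ j := fun h => Finset.mem_compl.1 hk (h ▸ hj)
    simp [sizeBiasedWeight, this]
  have h3 := exp_mul_prod_charSeries (Finset.empty_subset Fᶜ) hN (fun _ => 0) θ
  have h4 : charSeries (fun x => (sizeBiasedWeight p j j x : ℂ)) θ =
      charSeries (fun x => (x : ℂ) * (p j x : ℂ)) θ := by simp [sizeBiasedWeight]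
  have h5 := H.prod_omega θ
  rw [← Finset.mul_prod_erase F _ hj] at h5
  have h6 : heavyOmega ρ θ ^ ((ξ j + 1 : ℝ) : ℂ) =
      heavyOmega ρ θ ^ (ξ j : ℂ) * heavyOmega ρ θ := by
    rw [Complex.ofReal_add, Complex.ofReal_one, Complex.cpow_add _ _ hω, Complex.cpow_one]
  have h7 : heavyOmega ρ θ ^ ((∑ k ∈ F, ξ k + 1 : ℝ) : ℂ) =
      heavyOmega ρ θ ^ ((∑ k ∈ F, ξ k : ℝ) : ℂ) * heavyOmega ρ θ := by
    rw [Complex.ofReal_add, Complex.ofReal_one, Complex.cpow_add _ _ hω, Complex.cpow_one]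
  have h8 : Complex.exp (Complex.I * (((1 + (∑ k ∈ F, ξ k) * heavyScale ρ -
      ∑ k ∈ F, lawMean (p k) : ℝ) : ℂ) - ((∑ k ∈ F, ξ k : ℝ) : ℂ) * heavyScale ρ) * θ) =
      Complex.exp (Complex.I * θ) *
        Complex.exp (-(Complex.I * ((∑ k ∈ F, lawMean (p k) : ℝ) : ℂ) * θ)) := by
    rw [← Complex.exp_add]
    congr 1
    push_cast
    ring
  rw [Finset.prod_empty, mul_one, Finset.sum_empty, add_zero] at h3
  rw [h1, h2, h4, H.charSeries_mul hj, localIntegrand, h8, h7, ← Finset.mul_prod_erase F _ hj, h6,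
    Finset.prod_mul_distrib, ← h5]
  linear_combination ((ξ j * heavyScale ρ * Complex.exp (Complex.I * θ) *
    (heavyOmega ρ θ ^ (ξ j : ℂ) * heavyOmega ρ θ) * ψ j θ - Complex.I *
      heavyOmega ρ θ ^ (ξ j : ℂ) * deriv (ψ j) θ) *
    ((∏ k ∈ F.erase j, heavyOmega ρ θ ^ (ξ k : ℂ)) * ∏ k ∈ F.erase j, ψ k θ)) * h3

end SaturableSystem

/-- With `A` empty this is the local limit for the denominator. -/
theorem exists_convCoeff_marginalWeight_le {B K r κ : ℝ} (hB : 1 ≤ B) (hK : 0 ≤ K) (hr : 0 < r)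
    (hκ : 2 ≤ κ) (ℓ : ℕ) : ∃ C, 0 ≤ C ∧ ∀ {ι : Type} [Fintype ι] [DecidableEq ι]
      {p : ι → ℕ → ℝ} {F A : Finset ι} {ξ : ι → ℝ} {ψ : ι → ℝ → ℂ} {ρ : ℝ},
      SaturableSystem p F ξ ψ ρ K r B κ → A ⊆ Fᶜ → A.card ≤ ℓ →
      ℓ * lyapOutside p F r ^ (2 / (2 + r)) ≤ 3 / 4 →
      ∀ (N : ℕ) (q : ι → ℕ), ∑ k, lawMean (p k) = N →
      |convCoeff (marginalWeight p A q) N - (∏ k ∈ A, p k (q k)) *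
          (gammaDensity (∑ k ∈ F, ξ k) (∑ k ∈ F, ξ k) / heavyScale ρ)| ≤
        (∏ k ∈ A, p k (q k)) * (C / heavyScale ρ *
          (heavyError (heavyScale ρ) (sigmaOutside p F) (lyapOutside p F r) r (∑ k ∈ F, ξ k) +
            |∑ k ∈ A, (lawMean (p k) - q k)| / heavyScale ρ)) := by
  obtain ⟨C, hC, h⟩ := exists_integral_localIntegrand_le hB hK hr hκ ℓ
  have hπ := Real.pi_pos
  refine ⟨1 / (2 * Real.pi) * C, by positivity, ?_⟩
  intro ι _ _ p F A ξ ψ ρ H hA hAℓ hℓ N q hN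
  have hP : 0 ≤ ∏ k ∈ A, p k (q k) := Finset.prod_nonneg fun k _ => (H.law k).nonneg _
  have h1 := h H hA hAℓ hℓ _ ((∑ k ∈ F, ξ k) * heavyScale ρ - ∑ k ∈ F, lawMean (p k)) _
    (∑ k ∈ A, (lawMean (p k) - q k)) H.one_le_sum
    (H.sum_le.trans (by linarith)) (H.abs_sum_mean_sub_le.trans (by linarith)) H.one_le_sum
  rw [← Real.norm_eq_abs, ← Complex.norm_real, Complex.ofReal_sub, convCoeff_eq_integral
    fun k => (hasSum_norm_marginalWeight H.law A q k).summable]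
  simp_rw [H.integrand_marginalWeight hA hN q]
  rw [intervalIntegral.integral_const_mul]
  set J := ∫ θ in (-Real.pi)..Real.pi, localIntegrand p F A ψ ρ (∑ k ∈ F, ξ k)
    ((∑ k ∈ F, ξ k) * heavyScale ρ - ∑ k ∈ F, lawMean (p k))
    (∑ k ∈ F, ξ k + (∑ k ∈ A, (lawMean (p k) - q k)) / heavyScale ρ) θ
  set P := ∏ k ∈ A, p k (q k)
  set g := gammaDensity (∑ k ∈ F, ξ k) (∑ k ∈ F, ξ k)
  have hπ' : (Real.pi : ℂ) ≠ 0 := Complex.ofReal_ne_zero.2 hπ.ne'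
  have e : ((1 / (2 * Real.pi) : ℝ) : ℂ) * ((P : ℂ) * J) - ((P * (g / heavyScale ρ) : ℝ) : ℂ) =
      ((P * (1 / (2 * Real.pi)) : ℝ) : ℂ) * (J - 2 * Real.pi / heavyScale ρ * g) := by
    push_cast
    field_simp
  rw [e, norm_mul, Complex.norm_real, Real.norm_of_nonneg (by positivity)]
  refine (mul_le_mul_of_nonneg_left h1 (by positivity)).trans_eq ?_
  ring

end Numerators

end

/-! ### The mean of a saturable queue. -/

noncomputable section

section SizeBiased

/-- The term with `ψ_j'` lacks the prefactor `α` of the main term, so `O(ε)` suffices instead of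
`O(ε/α)`. Absolute values therefore do for every `Ξ`, and no regularity of `ψ_j'` is required. -/
theorem exists_integral_remainder_le {B K r κ : ℝ} (hK : 0 ≤ K) (hκ : 2 ≤ κ) :
    ∃ C, 0 ≤ C ∧ ∀ {ι : Type} [Fintype ι] [DecidableEq ι]
      {p : ι → ℕ → ℝ} {F : Finset ι} {ξ : ι → ℝ} {ψ : ι → ℝ → ℂ} {ρ : ℝ},
      SaturableSystem p F ξ ψ ρ K r B κ → ∀ j ∈ F, ∀ t : ℝ,
      ‖∫ θ in (-Real.pi)..Real.pi, Complex.I * Complex.exp (-(Complex.I * t * θ)) *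
        heavyOmega ρ θ ^ ((∑ k ∈ F, ξ k : ℝ) : ℂ) * (deriv (ψ j) θ * ∏ k ∈ F.erase j, ψ k θ) *
        ∏ k ∈ Fᶜ \ ∅, centeredChar (p k) (lawMean (p k)) θ‖ ≤
      C * heavyError (heavyScale ρ) (sigmaOutside p F) (lyapOutside p F r) r (∑ k ∈ F, ξ k) := by
  have hc8 : 2 / Real.pi ^ 2 / κ ^ 2 ≤ 1 := by
    have h1 : 2 ^ 2 ≤ κ ^ 2 := pow_le_pow_left₀ zero_le_two hκ 2
    have h2 : (8 : ℝ) ≤ Real.pi ^ 2 := by nlinarith [Real.pi_gt_three]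
    rw [div_div, div_le_one (by positivity)]
    nlinarith
  obtain ⟨C, hC, hint⟩ := exists_norm_integral_le_of_le_exp
    (c := 2 / Real.pi ^ 2 / κ ^ 2) (by positivity) hc8
  have hπ := Real.pi_pos
  have hb := bracketIntegral_nonneg
  set M := 2 ^ B * (K * (1 + 2 * Real.pi * K) ^ ⌊B⌋₊) with hMdef
  have hM : 0 ≤ M := by positivity
  refine ⟨M * (4 * C + bracketIntegral), by positivity, ?_⟩
  intro ι _ _ p F ξ ψ ρ H j hj t
  have hα := H.alpha_pos
  have hS := H.heavyScales (Finset.empty_subset Fᶜ) (ℓ := 0) (by simp) (by norm_num)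
  set Ξ := ∑ k ∈ F, ξ k with hΞ
  set α := heavyScale ρ
  set σ := sigmaOutside p F
  set ε := heavyError α σ (lyapOutside p F r) r Ξ
  have hε := (hS.heavyError_pos Ξ).le
  have hΞ1 : 1 ≤ Ξ := H.one_le_sum
  have hu : ∀ θ, 0 < ‖linFactor α θ‖ := fun θ => one_pos.trans_le (one_le_norm_linFactor θ)
  have hmain : ∀ θ, |θ| ≤ Real.pi → ‖Complex.I * Complex.exp (-(Complex.I * t * θ)) *
        heavyOmega ρ θ ^ (Ξ : ℂ) * (deriv (ψ j) θ * ∏ k ∈ F.erase j, ψ k θ) *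
        ∏ k ∈ Fᶜ \ ∅, centeredChar (p k) (lawMean (p k)) θ‖ ≤
      M * (‖linFactor α θ‖ ^ (-Ξ) * Real.exp (-(2 / Real.pi ^ 2 / κ ^ 2 * σ ^ 2 * θ ^ 2))) := by
    intro θ hθ
    have h1 := norm_heavyOmega_cpow_le H.rho_pos H.rho_lt (zero_le_one.trans hΞ1) H.sum_le hθ
    have h2 := H.deriv_le j hj θ
    have h3 : ‖∏ k ∈ F.erase j, ψ k θ‖ ≤ (1 + 2 * Real.pi * K) ^ ⌊B⌋₊ := by
      have hT := (IsTilt.prod (T := F.erase j)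
        fun k hk => H.isTilt_psi (Finset.mem_of_mem_erase hk)).mono
        (M' := (1 + 2 * Real.pi * K) ^ ⌊B⌋₊) (by
          refine pow_le_pow_right₀ (le_add_of_nonneg_right (by positivity)) ?_
          exact (Finset.card_le_card (Finset.erase_subset j F)).trans
            (Nat.le_floor (H.card_le_sum.trans H.sum_le)))
      have := hT.one_le
      exact (hT.norm_le hθ).trans (by linarith)
    have h4 := H.norm_prod_char_le (Finset.empty_subset Fᶜ) (ℓ := 0) (by simp) hθ
    rw [Nat.cast_zero, zero_div, Real.exp_zero, one_mul] at h4
    rw [norm_mul, norm_mul, norm_mul, norm_mul, norm_mul, Complex.norm_I, one_mul,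
      show -(Complex.I * t * θ) = ((-(t * θ) : ℝ) : ℂ) * Complex.I by push_cast; ring,
      Complex.norm_exp_ofReal_mul_I, one_mul]
    calc _ ≤ 2 ^ B * ‖linFactor α θ‖ ^ (-Ξ) * (K * (1 + 2 * Real.pi * K) ^ ⌊B⌋₊) *
          Real.exp (-(2 / Real.pi ^ 2 / κ ^ 2 * σ ^ 2 * θ ^ 2)) := by gcongr
      _ = _ := by ring
  rcases le_total Ξ (3 / 2) with h | h
  · have h1 := norm_intervalIntegral_le_mul (b := fun θ => ‖linFactor α θ‖ ^ (-(Ξ - 1)) *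
      Real.exp (-(2 / Real.pi ^ 2 / κ ^ 2 * σ ^ 2 * θ ^ 2))) (fun θ => by positivity)
      (hint Ξ α σ hΞ1 h hα H.sigma_pos) hM (fun θ hθ => (hmain θ hθ).trans (by
        gcongr
        · exact one_le_norm_linFactor θ
        · linarith))
    refine h1.trans ?_
    have h2 := hS.rpow_le_heavyError Ξ
    have h3 : (σ / α) ^ (Ξ - 1) / σ ≤ 4 * ε := by
      calc _ = (σ / α) ^ (Ξ - 1) * (1 / σ) := by ring
        _ ≤ (σ / α) ^ (Ξ - 1) * (4 * lyapOutside p F r) := by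
            have := hS.ratio_pos
            gcongr
            exact hS.inv_sigma_le
        _ = 4 * (lyapOutside p F r * (σ / α) ^ (Ξ - 1)) := by ring
        _ ≤ _ := by gcongr
    calc _ ≤ M * (C * (4 * ε)) := by gcongr
      _ = M * (4 * C) * ε := by ring
      _ ≤ _ := by
        gcongr
        linarith
  · have h1 := norm_intervalIntegral_le_mul (b := fun θ => ‖linFactor α θ‖ ^ (-(3 / 2) : ℝ))
      (fun θ => by positivity)
      (fun f hf => norm_integral_le_bracket (M := 1) hα fun θ => by
        rw [one_mul]
        exact hf θ) hM (fun θ hθ => (hmain θ hθ).trans (by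
        gcongr
        rw [← mul_one (‖linFactor α θ‖ ^ (-(3 / 2) : ℝ))]
        refine mul_le_mul (Real.rpow_le_rpow_of_exponent_le (one_le_norm_linFactor θ)
          (by linarith)) ?_ (by positivity) (by positivity)
        rw [Real.exp_le_one_iff, neg_nonpos]
        positivity))
    refine h1.trans ?_
    have h2 := hS.inv_le_heavyError Ξ
    calc M * (1 * (bracketIntegral / α)) = M * bracketIntegral * (1 / α) := by ring
      _ ≤ M * bracketIntegral * ε := by gcongr
      _ ≤ _ := by
        gcongr
        linarith

/-- Both sides are the same number because `Γ(s+1) = sΓ(s)`. This makes conditioning on the total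
leave the mean of a saturable queue unchanged to first order. -/
theorem gammaDensity_add_one {s : ℝ} (hs : 0 < s) : gammaDensity (s + 1) s = gammaDensity s s := by
  rw [gammaDensity_of_pos hs, gammaDensity_of_pos hs, Real.Gamma_add_one hs.ne',
    add_sub_cancel_right, div_eq_div_iff (mul_pos hs (Real.Gamma_pos_of_pos hs)).ne'
    (Real.Gamma_pos_of_pos hs).ne', show s ^ s = s ^ (s - 1) * s by
      rw [← Real.rpow_add_one hs.ne', sub_add_cancel]]
  ring

theorem exists_convCoeff_sizeBiasedWeight_le {B K r κ : ℝ} (hB : 1 ≤ B) (hK : 0 ≤ K) (hr : 0 < r)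
    (hκ : 2 ≤ κ) : ∃ C, 0 ≤ C ∧ ∀ {ι : Type} [Fintype ι] [DecidableEq ι]
      {p : ι → ℕ → ℝ} {F : Finset ι} {ξ : ι → ℝ} {ψ : ι → ℝ → ℂ} {ρ : ℝ},
      SaturableSystem p F ξ ψ ρ K r B κ → 2 * K ≤ heavyScale ρ →
      ∀ N : ℕ, ∑ k, lawMean (p k) = N → ∀ j ∈ F,
      |convCoeff (sizeBiasedWeight p j) N - lawMean (p j) *
          (gammaDensity (∑ k ∈ F, ξ k) (∑ k ∈ F, ξ k) / heavyScale ρ)| ≤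
        lawMean (p j) * (C / heavyScale ρ * heavyError (heavyScale ρ) (sigmaOutside p F)
          (lyapOutside p F r) r (∑ k ∈ F, ξ k)) := by
  obtain ⟨C, hC, h⟩ := exists_integral_localIntegrand_le hB hK hr hκ 0
  obtain ⟨D, hD, h'⟩ := exists_integral_remainder_le (B := B) (r := r) hK hκ
  obtain ⟨G, hG, hGle⟩ := exists_gammaDensity_le B
  have hπ := Real.pi_pos
  refine ⟨2 * (1 / (2 * Real.pi) * (B * C + D) + K * G), by positivity, ?_⟩
  intro ι _ _ p F ξ ψ ρ H hKα N hN j hj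
  have hα := H.alpha_pos
  have hS := H.heavyScales (Finset.empty_subset Fᶜ) (ℓ := 0) (by simp) (by norm_num)
  have hΞ1 := H.one_le_sum
  have hξ1 := H.one_le j hj
  have hξΞ : ξ j ≤ ∑ k ∈ F, ξ k := Finset.single_le_sum (f := ξ)
    (fun k hk => zero_le_one.trans (H.one_le k hk)) hj
  have hη : |1 + (∑ k ∈ F, ξ k) * heavyScale ρ - ∑ k ∈ F, lawMean (p k)| ≤ B * K + 1 := by
    have := H.abs_sum_mean_sub_le
    rw [add_sub_assoc]
    refine (abs_add_le _ _).trans ?_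
    rw [abs_one]
    linarith
  have h1 := h H (Finset.empty_subset Fᶜ) (by simp) (by norm_num) (∑ k ∈ F, ξ k + 1) _
    (∑ k ∈ F, ξ k) 0 (by linarith) (by linarith [H.sum_le]) hη hΞ1
  rw [abs_zero, zero_div, add_zero, add_zero,
    gammaDensity_add_one (one_pos.trans_le hΞ1)] at h1
  have h2 := h' H j hj (∑ k ∈ F, lawMean (p k))
  have hε0 := hS.heavyError_pos (∑ k ∈ F, ξ k)
  have hεa := hS.heavyError_anti (lt_add_one (∑ k ∈ F, ξ k)).le
  have hεα := hS.inv_le_heavyError (∑ k ∈ F, ξ k)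
  have hm := H.abs_mean_sub_le hj
  -- The mean is of order at least `α`, which converts absolute errors `O(ε)` into `lawMean (p j) *
  -- O(ε/α)`.
  have hmα : heavyScale ρ / 2 ≤ lawMean (p j) := by
    have h3 : heavyScale ρ ≤ ξ j * heavyScale ρ := le_mul_of_one_le_left hα.le hξ1
    linarith [(abs_le.1 hm).1]
  set f1 := localIntegrand p F ∅ ψ ρ (∑ k ∈ F, ξ k + 1)
        (1 + (∑ k ∈ F, ξ k) * heavyScale ρ - ∑ k ∈ F, lawMean (p k)) (∑ k ∈ F, ξ k) with hf1
  set f2 := fun θ : ℝ => Complex.I *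
    Complex.exp (-(Complex.I * ((∑ k ∈ F, lawMean (p k) : ℝ) : ℂ) * θ)) *
        heavyOmega ρ θ ^ ((∑ k ∈ F, ξ k : ℝ) : ℂ) *
        (deriv (ψ j) θ * ∏ k ∈ F.erase j, ψ k θ) *
        ∏ k ∈ Fᶜ \ ∅, centeredChar (p k) (lawMean (p k)) θ with hf2
  have hsum := fun k => (hasSum_norm_sizeBiasedWeight H.law j k).summable
  have hint : (convCoeff (sizeBiasedWeight p j) N : ℂ) = (1 / (2 * Real.pi) : ℝ) *
      (ξ j * heavyScale ρ * (∫ θ in (-Real.pi)..Real.pi, f1 θ) -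
        ∫ θ in (-Real.pi)..Real.pi, f2 θ) := by
    rw [convCoeff_eq_integral hsum, ← intervalIntegral.integral_const_mul (ξ j * heavyScale ρ : ℂ)]
    have hc1 : Continuous fun θ => (ξ j * heavyScale ρ : ℂ) * f1 θ :=
      continuous_const.mul (H.continuous_localIntegrand _ _ _ _)
    have hc : Continuous fun θ : ℝ => Complex.exp (-(Complex.I * N * θ)) *
        ∏ k, charSeries (fun x => (sizeBiasedWeight p j k x : ℂ)) θ := by
      refine Continuous.mul (by fun_prop) ?_
      exact continuous_finsetProd _ fun k _ => continuous_charSeries (hsum k)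
    -- Although `ψ_j'` is not assumed continuous, this term is the difference of two continuous
    -- functions.
    have hc2 : Continuous f2 := by
      refine (hc1.sub hc).congr fun θ => ?_
      simp only [Pi.sub_apply]
      rw [H.integrand_sizeBiasedWeight hj hN θ]
      exact sub_sub_cancel _ _
    rw [← intervalIntegral.integral_sub (hc1.intervalIntegrable _ _) (hc2.intervalIntegrable _ _)]
    congr 2
    exact funext fun θ => H.integrand_sizeBiasedWeight hj hN θ
  set Ξ := ∑ k ∈ F, ξ k
  set α := heavyScale ρ
  set ε := heavyError α (sigmaOutside p F) (lyapOutside p F r) r Ξ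
  set g := gammaDensity Ξ Ξ
  set J1 := ∫ θ in (-Real.pi)..Real.pi, f1 θ
  set J2 := ∫ θ in (-Real.pi)..Real.pi, f2 θ
  have hg0 : 0 ≤ g := gammaDensity_nonneg (by linarith) _
  have hg : g ≤ G := hGle Ξ ⟨hΞ1, H.sum_le⟩ Ξ
  have hπ' : (Real.pi : ℂ) ≠ 0 := Complex.ofReal_ne_zero.2 hπ.ne'
  have hα' : (α : ℂ) ≠ 0 := Complex.ofReal_ne_zero.2 hα.ne'
  have e : ((convCoeff (sizeBiasedWeight p j) N - lawMean (p j) * (g / α) : ℝ) : ℂ) =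
      ((1 / (2 * Real.pi) * (ξ j * α) : ℝ) : ℂ) * (J1 - 2 * Real.pi / α * g) -
      ((1 / (2 * Real.pi) : ℝ) : ℂ) * J2 -
        (((lawMean (p j) - ξ j * α) * (g / α) : ℝ) : ℂ) := by
    rw [Complex.ofReal_sub, hint]
    push_cast
    field_simp
    ring
  rw [← Real.norm_eq_abs, ← Complex.norm_real, e]
  have hb1 : ‖((1 / (2 * Real.pi) * (ξ j * α) : ℝ) : ℂ) * (J1 - 2 * Real.pi / α * g)‖ ≤
      1 / (2 * Real.pi) * (B * C) * ε := by
    have hξ0 : 0 ≤ ξ j := zero_le_one.trans hξ1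
    rw [norm_mul, Complex.norm_real, Real.norm_of_nonneg (by positivity)]
    calc _ ≤ 1 / (2 * Real.pi) * (ξ j * α) * (C / α * ε) := by
          gcongr
          exact h1.trans (by gcongr)
      _ = 1 / (2 * Real.pi) * (ξ j * C) * ε := by field_simp
      _ ≤ _ := by
        gcongr
        exact hξΞ.trans H.sum_le
  have hb2 : ‖((1 / (2 * Real.pi) : ℝ) : ℂ) * J2‖ ≤ 1 / (2 * Real.pi) * (D * ε) := by
    rw [norm_mul, Complex.norm_real, Real.norm_of_nonneg (by positivity)]
    gcongr
  have hb3 : ‖(((lawMean (p j) - ξ j * α) * (g / α) : ℝ) : ℂ)‖ ≤ K * G * ε := by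
    rw [Complex.norm_real, norm_mul, Real.norm_eq_abs, Real.norm_of_nonneg (by positivity)]
    calc _ ≤ K * (G / α) := by gcongr
      _ = K * G * (1 / α) := by ring
      _ ≤ _ := by gcongr
  have hb : 1 / (2 * Real.pi) * (B * C) * ε + 1 / (2 * Real.pi) * (D * ε) + K * G * ε =
      α / 2 * (2 * (1 / (2 * Real.pi) * (B * C + D) + K * G) / α * ε) := by
    field_simp
  calc _ ≤ 1 / (2 * Real.pi) * (B * C) * ε + 1 / (2 * Real.pi) * (D * ε) + K * G * ε :=
        (norm_sub_le _ _).trans (add_le_add ((norm_sub_le _ _).trans (add_le_add hb1 hb2)) hb3)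
    _ = _ := hb
    _ ≤ _ := by gcongr

theorem exists_le_gammaDensity_self {B : ℝ} : ∃ c, 0 < c ∧ ∀ s ∈ Set.Icc 1 B,
    c ≤ gammaDensity s s := by
  obtain ⟨G, hG, h⟩ := exists_Gamma_le (lo := 1) (hi := B) one_pos
  refine ⟨Real.exp (-B) / G, by positivity, fun s hs => ?_⟩
  have hs0 : 0 < s := one_pos.trans_le hs.1
  have := Real.Gamma_pos_of_pos hs0
  rw [gammaDensity_of_pos hs0]
  have h1 : 1 ≤ s ^ (s - 1) := Real.one_le_rpow hs.1 (by linarith [hs.1])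
  calc Real.exp (-B) / G ≤ Real.exp (-s) / Real.Gamma s := by
        gcongr
        · exact hs.2
        · exact h s hs
    _ ≤ _ := by
        gcongr
        exact le_mul_of_one_le_left (Real.exp_pos _).le h1

end SizeBiased

end

/-! ### Estimates for one network. -/

noncomputable section

/-- Shows that `ε` is small with `σ/α` and `L`; the term `1/α` is below `σ/α` since `σ ≥ 1`. -/
theorem HeavyScales.heavyError_le_add {r c α σ τ L s : ℝ} (H : HeavyScales r c α σ τ L)
    (hs : 1 ≤ s) : heavyError α σ L r s ≤ 2 * (σ / α) + 2 * L := by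
  have h0 := H.ratio_pos
  have h1 := H.ratio_le_one
  have hr := H.r_pos
  have hL := H.L_nonneg
  have h2 : (σ / α) ^ 2 ≤ σ / α := pow_le_of_le_one h0.le h1 two_ne_zero
  have h3 : 1 / α ≤ σ / α := by
    have := H.alpha_pos
    gcongr
    exact H.one_le_sigma
  have h4 : L * (σ / α) ^ (2 + r) ≤ L :=
    mul_le_of_le_one_right hL (Real.rpow_le_one h0.le h1 (by linarith))
  have h5 : L * (σ / α) ^ (s - 1) ≤ L :=
    mul_le_of_le_one_right hL (Real.rpow_le_one h0.le h1 (by linarith))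
  unfold heavyError
  linarith

theorem abs_div_sub_le_of_le {x X D P a b c : ℝ} (hP : 0 ≤ P) (hc : 0 < c) (hD : c ≤ D)
    (h1 : |x - P * X| ≤ P * a) (h2 : |D - X| ≤ b) : |x / D - P| ≤ (a + b) / c * P := by
  have hD0 : 0 < D := hc.trans_le hD
  have e : x / D - P = ((x - P * X) - P * (D - X)) / D := by
    field_simp
    ring
  have h3 : |(x - P * X) - P * (D - X)| ≤ P * a + P * b := by
    refine (abs_sub _ _).trans (add_le_add h1 ?_)
    rw [abs_mul, abs_of_nonneg hP]
    gcongr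
  rw [e, abs_div, abs_of_pos hD0]
  calc _ ≤ (P * a + P * b) / c := by
        have := (abs_nonneg _).trans h3
        gcongr
    _ = _ := by ring

section Bounds

theorem exists_closedNetwork_bounds {B K r κ : ℝ} (hB : 1 ≤ B) (hK : 0 ≤ K) (hr : 0 < r)
    (hκ : 2 ≤ κ) (ℓ : ℕ) : ∃ M δ, 0 ≤ M ∧ 0 < δ ∧ ∀ {n : ℕ} {C : ClosedNetwork n} {lam : ℝ}
      {F : Finset (Fin n)} {ξ : Fin n → ℝ} {ψ : Fin n → ℝ → ℂ} {ρ α σ L Ξ ε : ℝ},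
      0 < lam → (∀ k, C.HasMoment lam k 2) → ∑ k, C.openMean lam k = C.clients →
      SaturableSystem (C.openProb lam) F ξ ψ ρ K r B κ →
      Ξ = ∑ k ∈ F, ξ k → α = heavyScale ρ → σ = C.sigmaHat lam F → L = C.lyapHat lam F r →
      ε = heavyError α σ L r Ξ →
      ℓ * L ^ (2 / (2 + r)) ≤ 3 / 4 → 2 * K ≤ α → σ / α ≤ δ → L ≤ δ →
      (∀ q : Fin n → ℕ, ∑ k, q k = C.clients →
        |C.closedProb q - α * Real.Gamma Ξ / (Real.exp (-Ξ) * Ξ ^ (Ξ - 1)) *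
            ∏ k, C.openProb lam k (q k)| ≤
          M * ε * (α * Real.Gamma Ξ / (Real.exp (-Ξ) * Ξ ^ (Ξ - 1)) *
            ∏ k, C.openProb lam k (q k))) ∧
      (∀ A : Finset (Fin n), A.card ≤ ℓ → Disjoint A F → ∀ q : Fin n → ℕ,
        |C.closedMarginal A q - ∏ k ∈ A, C.openProb lam k (q k)| ≤
          M * (ε + |∑ k ∈ A, (C.openMean lam k - q k)| / α) *
            ∏ k ∈ A, C.openProb lam k (q k)) ∧
      ∀ j ∈ F, |C.closedMean j - C.openMean lam j| ≤ M * ε * C.openMean lam j := by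
  obtain ⟨C1, hC1, h1⟩ := exists_convCoeff_marginalWeight_le hB hK hr hκ ℓ
  obtain ⟨C2, hC2, h2⟩ := exists_convCoeff_marginalWeight_le hB hK hr hκ 0
  obtain ⟨C3, hC3, h3⟩ := exists_convCoeff_sizeBiasedWeight_le hB hK hr hκ
  obtain ⟨c, hc, h4⟩ := exists_le_gammaDensity_self (B := B)
  -- `δ` makes `ε ≤ 4δ`, hence `C2 ε ≤ c/2`: the denominator then keeps at least half of the lower
  -- bound `c/α`, whence the factor `2/c`.
  refine ⟨2 / c * (C1 + C2 + C3), c / (8 * (C2 + 1)), by positivity, by positivity, ?_⟩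
  intro n C lam F ξ ψ ρ α σ L Ξ ε hlam hmom hmean H hΞ hα hσ hL hε hℓ hKα hσα hLδ
  have hS := H.heavyScales (Finset.empty_subset Fᶜ) (ℓ := 0) (by simp) (by norm_num)
  have hα0 : 0 < α := hα ▸ H.alpha_pos
  have hΞ1 : 1 ≤ Ξ := hΞ ▸ H.one_le_sum
  have hΞB : Ξ ≤ B := hΞ ▸ H.sum_le
  have hp := H.law
  change ∑ k, lawMean (C.openProb lam k) = C.clients at hmean
  change σ = sigmaOutside (C.openProb lam) F at hσ
  change L = lyapOutside (C.openProb lam) F r at hL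
  have hD0 := h2 H (Finset.empty_subset Fᶜ) (by simp) (by norm_num) C.clients (fun _ => 0) hmean
  rw [marginalWeight_empty, Finset.prod_empty, Finset.sum_empty, abs_zero, zero_div, add_zero,
    one_mul, one_mul, ← hα, ← hσ, ← hL, ← hΞ, ← hε] at hD0
  rw [← hα, ← hσ, ← hL] at hS
  have hε0 : 0 < ε := hε ▸ hS.heavyError_pos Ξ
  have hεδ : C2 * ε ≤ c / 2 := by
    have h5 := hS.heavyError_le_add hΞ1
    rw [← hε] at h5
    calc C2 * ε ≤ (C2 + 1) * (4 * (c / (8 * (C2 + 1)))) := by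
          gcongr
          · linarith
          · linarith
      _ = c / 2 := by
          field_simp
          norm_num
  have hg := h4 Ξ ⟨hΞ1, hΞB⟩
  set X := gammaDensity Ξ Ξ / α with hX
  set D := convCoeff (C.openProb lam) C.clients
  have hXc : c / α ≤ X := by
    rw [hX]
    gcongr
  have hX0 : 0 < X := lt_of_lt_of_le (by positivity) hXc
  have hDc : c / 2 / α ≤ D := by
    have h5 : C2 / α * ε ≤ c / 2 / α := by
      rw [div_mul_eq_mul_div]
      gcongr
    have h6 : c / α = c / 2 / α + c / 2 / α := by ring
    linarith [(abs_le.1 hD0).1]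
  have hc2 : 0 < c / 2 / α := by positivity
  refine ⟨fun q hq => ?_, fun A hAℓ hAF q => ?_, fun j hj => ?_⟩
  · have hP : 0 ≤ ∏ k, C.openProb lam k (q k) := Finset.prod_nonneg fun k _ => (hp k).nonneg _
    have e1 : α * Real.Gamma Ξ / (Real.exp (-Ξ) * Ξ ^ (Ξ - 1)) = 1 / X := by
      have h5 := (Real.Gamma_pos_of_pos (one_pos.trans_le hΞ1)).ne'
      have h6 := (Real.rpow_pos_of_pos (one_pos.trans_le hΞ1) (Ξ - 1)).ne'
      rw [hX, gammaDensity_of_pos (one_pos.trans_le hΞ1)]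
      field_simp
    rw [C.closedProb_eq hlam hmom q hq, e1]
    change |_ / D - _| ≤ _
    have hD1 : 0 < D := hc2.trans_le hDc
    have e2 : (∏ k, C.openProb lam k (q k)) / D - 1 / X * ∏ k, C.openProb lam k (q k) =
        (X - D) / D * (1 / X * ∏ k, C.openProb lam k (q k)) := by
      field_simp
    rw [e2, abs_mul, abs_of_nonneg (a := 1 / X * _) (by positivity), abs_div, abs_of_pos hD1]
    refine mul_le_mul_of_nonneg_right ?_ (by positivity)
    rw [abs_sub_comm] at hD0
    calc |X - D| / D ≤ C2 / α * ε / (c / 2 / α) := by gcongr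
      _ = 2 / c * C2 * ε := by field_simp
      _ ≤ _ := by
        gcongr
        linarith
  · have hA : A ⊆ Fᶜ := fun k hk => Finset.mem_compl.2 (Finset.disjoint_left.1 hAF hk)
    have hP : 0 ≤ ∏ k ∈ A, C.openProb lam k (q k) := Finset.prod_nonneg fun k _ => (hp k).nonneg _
    have h5 := h1 H hA hAℓ (by rwa [← hL]) C.clients q hmean
    rw [← hα, ← hσ, ← hL, ← hΞ, ← hε] at h5
    rw [C.closedMarginal_eq hlam hmom A q]
    refine (abs_div_sub_le_of_le hP hc2 hDc h5 hD0).trans ?_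
    refine mul_le_mul_of_nonneg_right ?_ hP
    change (C1 / α * (ε + |∑ k ∈ A, (C.openMean lam k - q k)| / α) + _) / _ ≤ _
    set d := |∑ k ∈ A, (C.openMean lam k - q k)| / α
    have hd : 0 ≤ d := by positivity
    calc _ = 2 / c * (C1 * (ε + d) + C2 * ε) := by field_simp
      _ ≤ 2 / c * ((C1 + C2 + C3) * (ε + d)) := by
        gcongr
        have e1 : 0 ≤ C2 * d := by positivity
        have e2 : 0 ≤ C3 * (ε + d) := by positivity
        linarith
      _ = _ := by ring
  · have h5 := h3 H (by rwa [← hα]) C.clients hmean j hj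
    rw [← hα, ← hσ, ← hL, ← hΞ, ← hε] at h5
    rw [C.closedMean_eq hlam hmom j]
    have hm : 0 ≤ C.openMean lam j := (hp j).lawMean_nonneg
    refine (abs_div_sub_le_of_le hm hc2 hDc h5 hD0).trans ?_
    refine mul_le_mul_of_nonneg_right ?_ hm
    calc _ = 2 / c * (C2 + C3) * ε := by
          field_simp
          ring
      _ ≤ _ := by
        gcongr
        linarith

namespace ClosedNetwork

variable {n : ℕ} (C : ClosedNetwork n) {lam : ℝ} (hlam : 0 < lam)
  (hmom : ∀ k, C.HasMoment lam k 2)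
include hlam hmom

/-- Crude bounds, with a constant that depends on the network. -/
theorem exists_crude_bounds {ε c : ℝ} (hε : 0 < ε) (hc : 0 < c) : ∃ M, 0 ≤ M ∧
    (∀ q : Fin n → ℕ, ∑ k, q k = C.clients →
      |C.closedProb q - c * ∏ k, C.openProb lam k (q k)| ≤
        M * ε * (c * ∏ k, C.openProb lam k (q k))) ∧
    (∀ (A : Finset (Fin n)) (q : Fin n → ℕ),
      |C.closedMarginal A q - ∏ k ∈ A, C.openProb lam k (q k)| ≤
        M * ε * ∏ k ∈ A, C.openProb lam k (q k)) ∧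
    ∀ j, |C.closedMean j - C.openMean lam j| ≤ M * ε * C.openMean lam j := by
  have hp := fun k => (hmom k).isSqLaw hlam
  have hD := C.convCoeff_openProb_pos hlam hmom
  have key : ∀ {x P : ℝ}, 0 ≤ P → |x| ≤ P → |x / convCoeff (C.openProb lam) C.clients - P| ≤
      (1 / convCoeff (C.openProb lam) C.clients + 1) * P := fun {x P} hP hx => by
    refine (abs_sub _ _).trans ?_
    rw [abs_div, abs_of_pos hD, abs_of_nonneg hP, add_mul, one_mul, div_mul_eq_mul_div, one_mul]
    gcongr
  set D := convCoeff (C.openProb lam) C.clients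
  refine ⟨(1 / D + 1) / ε + (1 / (D * c) + 1) / ε, by positivity, fun q hq => ?_, fun A q => ?_,
    fun j => ?_⟩
  · have hP : 0 ≤ ∏ k, C.openProb lam k (q k) := Finset.prod_nonneg fun k _ => (hp k).nonneg _
    rw [C.closedProb_eq hlam hmom q hq]
    refine (abs_sub _ _).trans ?_
    change |_ / D| + _ ≤ _
    rw [abs_of_nonneg (by positivity), abs_of_nonneg (by positivity), add_mul]
    calc _ = (1 / (D * c) + 1) / ε * ε * (c * ∏ k, C.openProb lam k (q k)) := by field_simp
      _ ≤ _ := by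
        gcongr
        exact le_add_of_nonneg_left (by positivity)
  · have hP : 0 ≤ ∏ k ∈ A, C.openProb lam k (q k) := Finset.prod_nonneg fun k _ => (hp k).nonneg _
    have h1 := abs_convCoeff_le (fun k => hasSum_norm_marginalWeight hp A q k) C.clients
    rw [Finset.prod_ite_mem, Finset.univ_inter] at h1
    rw [C.closedMarginal_eq hlam hmom A q]
    refine (key hP h1).trans (mul_le_mul_of_nonneg_right ?_ hP)
    rw [add_mul, div_mul_cancel₀ _ hε.ne']
    exact le_add_of_nonneg_right (by positivity)
  · have hP : 0 ≤ C.openMean lam j := (hp j).lawMean_nonneg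
    have h1 := abs_convCoeff_le (fun k => hasSum_norm_sizeBiasedWeight hp j k) C.clients
    rw [Finset.prod_ite_eq' Finset.univ j fun k => lawMean (C.openProb lam k),
      if_pos (Finset.mem_univ j)] at h1
    rw [C.closedMean_eq hlam hmom j]
    refine (key hP h1).trans (mul_le_mul_of_nonneg_right ?_ hP)
    rw [add_mul, div_mul_cancel₀ _ hε.ne']
    exact le_add_of_nonneg_right (by positivity)

/-- The relative error on the marginal law is integrated against `x`; the term `|m - x|/α` becomes
`E(X_j |X_j - m|)/α`, bounded by second moments. -/
theorem closedMean_le_of_closedMarginal_le {j : Fin n} {M ε α : ℝ} (hM : 0 ≤ M) (hα : 0 < α) (hε : 0 ≤ ε)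
    (h : ∀ x : ℕ, |C.closedMarginal {j} (fun _ => x) - C.openProb lam j x| ≤
      M * (ε + |C.openMean lam j - x| / α) * C.openProb lam j x) :
    |C.closedMean j - C.openMean lam j| ≤
      3 / 2 * M * (ε + (C.variance lam j + C.openMean lam j ^ 2) / (C.openMean lam j * α)) *
        C.openMean lam j := by
  have hp := (hmom j).isSqLaw hlam
  change |_ - lawMean (C.openProb lam j)| ≤ 3 / 2 * M * (ε + (absMoment (C.openProb lam j)
    (lawMean (C.openProb lam j)) 2 + lawMean (C.openProb lam j) ^ 2) /
      (lawMean (C.openProb lam j) * α)) * lawMean (C.openProb lam j)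
  change ∀ x : ℕ, |_ - C.openProb lam j x| ≤
    M * (ε + |lawMean (C.openProb lam j) - x| / α) * C.openProb lam j x at h
  have hmean : HasSum (fun x : ℕ => (x : ℝ) * C.openProb lam j x) (lawMean (C.openProb lam j)) :=
    hp.summable_mul.hasSum
  set p := C.openProb lam j
  set m := lawMean p
  have hm : 0 ≤ m := hp.lawMean_nonneg
  have hdiff := (C.hasSum_closedMarginal j).sub hmean
  have hv : HasSum (fun x : ℕ => ((x : ℝ) - m) ^ 2 * p x) (absMoment p m 2) := by
    rw [IsSqLaw.absMoment_two]
    exact (hp.summable_sub_sq m).hasSum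
  have hterm : ∀ x : ℕ, ‖(x : ℝ) * C.closedMarginal {j} (fun _ => x) - x * p x‖ ≤
      M * (ε * (x * p x) + 1 / α * (|(x : ℝ) * (m - x)| * p x)) := fun x => by
    rw [← mul_sub, norm_mul, Real.norm_natCast, Real.norm_eq_abs, abs_mul, Nat.abs_cast]
    calc _ ≤ (x : ℝ) * (M * (ε + |m - x| / α) * p x) := by
          gcongr
          exact h x
      _ = _ := by ring
  -- A queue of mean `0` is separate because the quotient by the mean is then `0` by convention. The
  -- open law is concentrated at `0`, and the marginal bound transfers this to the closed one.
  rcases hm.eq_or_lt with h0 | h0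
  · have hx : ∀ x : ℕ, (x : ℝ) * p x = 0 := by
      rw [← h0] at hmean
      exact congrFun ((hasSum_zero_iff_of_nonneg
        fun x => mul_nonneg x.cast_nonneg (hp.nonneg x)).1 hmean)
    have hz : ∀ x : ℕ, (x : ℝ) * C.closedMarginal {j} (fun _ => x) - x * p x = 0 := fun x => by
      refine norm_le_zero_iff.1 ((hterm x).trans_eq ?_)
      rw [abs_mul, Nat.abs_cast, mul_right_comm, hx]
      ring
    simp_rw [hz] at hdiff
    rw [hdiff.unique hasSum_zero, ← h0]
    simp
  · have hbound : HasSum (fun x : ℕ => M * (ε * (x * p x) + 1 / α * (3 / 2 *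
        ((x - m) ^ 2 * p x) + m ^ 2 / 2 * p x)))
        (M * (ε * m + 1 / α * (3 / 2 * absMoment p m 2 + m ^ 2 / 2 * 1))) :=
      ((hmean.mul_left ε).add (((hv.mul_left (3 / 2)).add
        (hp.hasSum.mul_left (m ^ 2 / 2))).mul_left (1 / α))).mul_left M
    have hle := tsum_of_norm_bounded hbound fun x => (hterm x).trans (by
      -- From `x|x - m| ≤ (x-m)² + m|x-m|` and `2m|x-m| ≤ m² + (x-m)²`.
      have h1 : |(x : ℝ) * (m - x)| ≤ 3 / 2 * (x - m) ^ 2 + m ^ 2 / 2 := by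
        rw [abs_le]
        constructor
        · linarith [sq_nonneg ((x : ℝ) - 2 * m)]
        · linarith [sq_nonneg (x : ℝ), sq_nonneg ((x : ℝ) - m)]
      have h2 := mul_le_mul_of_nonneg_right h1 (hp.nonneg x)
      gcongr
      linarith)
    rw [hdiff.tsum_eq, Real.norm_eq_abs] at hle
    refine hle.trans ?_
    have e : 3 / 2 * M * (ε + (absMoment p m 2 + m ^ 2) / (m * α)) * m =
        M * (3 / 2 * (ε * m) + 1 / α * (3 / 2 * absMoment p m 2 + 3 / 2 * m ^ 2)) := by
      field_simp
    rw [e]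
    refine mul_le_mul_of_nonneg_left (add_le_add ?_
      (mul_le_mul_of_nonneg_left ?_ (by positivity))) hM
    · linarith [mul_nonneg hε hm]
    · linarith [sq_nonneg m]

end ClosedNetwork

end Bounds

end

/-! ### From one network to the sequence. -/

noncomputable section

section Sequences

theorem PNat.exists_forall_of_eventually {P : ℕ+ → ℝ → Prop}
    (hmono : ∀ n M M', M ≤ M' → P n M → P n M') (hev : ∃ M, ∀ᶠ n in atTop, P n M)
    (hall : ∀ n, ∃ M, P n M) : ∃ M, ∀ n, P n M := by
  obtain ⟨M, hM⟩ := hev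
  obtain ⟨N, hN⟩ := eventually_atTop.1 hM
  choose f hf using hall
  obtain ⟨M', hM'⟩ := ((Set.finite_Iio N).image f).bddAbove
  refine ⟨max M M', fun n => ?_⟩
  rcases le_or_gt N n with h | h
  · exact hmono n M _ (le_max_left _ _) (hN n h)
  · exact hmono n (f n) _ ((hM' ⟨n, h, rfl⟩).trans (le_max_right _ _)) (hf n)

theorem one_le_of_rpow_neg_le_one {σ r : ℝ} (hσ : 0 < σ) (hr : 0 < r) (h : σ ^ (-r) ≤ 1) :
    1 ≤ σ := by
  by_contra! h1
  exact absurd h (not_le.2 (Real.one_lt_rpow_of_pos_of_lt_one_of_neg hσ h1 (by linarith)))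

/-- The quantitative regime follows from the limits: `L → 0` and `σ^{-r} ≤ 4L` give `σ ≥ 1`, then
`σ/α → 0` gives `α → ∞`. The maximum with `2` in `κ` ensures the decay rate is at most `1/8`. -/
theorem exists_eventually_saturableSystem (C : ∀ n : ℕ+, ClosedNetwork n)
    (lam : ℕ+ → ℝ) (hlam : ∀ n, 0 < lam n) (ρ : ℕ+ → ℝ) (hρ : ∀ n, 0 < ρ n ∧ ρ n < 1)
    (F : ∀ n : ℕ+, Finset (Fin n)) (hF : ∀ n, (F n).Nonempty)
    (ξ : ∀ n : ℕ+, Fin n → ℝ) (hsat : SaturableQueues C lam ρ F ξ)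
    (r : ℝ) (hr : 0 < r ∧ r ≤ 1) (hmom : ∀ n k, (C n).HasMoment (lam n) k 2)
    (hmom' : ∀ n, ∀ k ∉ F n, (C n).HasMoment (lam n) k (2 + r))
    (α σ L : ℕ+ → ℝ) (hα : ∀ n, α n = heavyScale (ρ n))
    (hσ : ∀ n, σ n = (C n).sigmaHat (lam n) (F n))
    (hL : ∀ n, L n = (C n).lyapHat (lam n) (F n) r)
    (hΞbdd : ∃ B : ℝ, ∀ n, ∑ k ∈ F n, ξ n k ≤ B) (hσpos : ∀ᶠ n in atTop, 0 < σ n)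
    (hσα : Tendsto (fun n => σ n / α n) atTop (𝓝 0)) (hLyap : Tendsto L atTop (𝓝 0))
    (hσγ : σ =O[atTop] fun n => (C n).gammaHat (lam n) (F n)) :
    ∃ (ψ : ∀ n : ℕ+, Fin n → ℝ → ℂ) (K B κ : ℝ), 1 ≤ B ∧ 0 ≤ K ∧ 2 ≤ κ ∧
      (∀ᶠ n in atTop, 2 * K ≤ α n) ∧ ∀ᶠ n in atTop,
        SaturableSystem ((C n).openProb (lam n)) (F n) (ξ n) (ψ n) (ρ n) K r B κ := by
  obtain ⟨⟨ψ, K, hψ⟩, ξmax, hξ⟩ := hsat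
  obtain ⟨B, hB⟩ := hΞbdd
  obtain ⟨c, hc⟩ := hσγ.bound
  have hp := fun n k => (hmom n k).isSqLaw (hlam n)
  have hlawmom : ∀ n, ∀ k ∉ F n, Summable fun x : ℕ =>
      |(x : ℝ) - lawMean ((C n).openProb (lam n) k)| ^ (2 + r) * (C n).openProb (lam n) k x :=
    fun n k hk => ClosedNetwork.HasMoment.summable_abs_sub (hlam n) (by linarith) (hmom n k)
      (hmom' n k hk) _
  have hα0 : ∀ n, 0 < α n := fun n => by
    rw [hα]
    exact heavyScale_pos (hρ n).1 (hρ n).2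
  have hσ1 : ∀ᶠ n in atTop, 1 ≤ σ n := by
    filter_upwards [hσpos, hLyap.eventually_le_const (show (0 : ℝ) < 1 / 4 by norm_num)] with n h1 h2
    have h3 := sigmaOutside_rpow_neg_le (F := F n) (hp n) hr.1 hr.2 (hlawmom n) (by
      rw [hσ] at h1
      exact h1)
    refine one_le_of_rpow_neg_le_one h1 hr.1 ?_
    rw [hσ]
    refine h3.trans ?_
    change 4 * (C n).lyapHat (lam n) (F n) r ≤ 1
    rw [← hL]
    linarith
  have hαT : ∀ T : ℝ, 0 < T → ∀ᶠ n in atTop, T ≤ α n := fun T hT => by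
    filter_upwards [hσ1, hσα.eventually_le_const (show (0 : ℝ) < 1 / T by positivity)] with n h1 h2
    rw [div_le_div_iff₀ (hα0 n) hT, one_mul] at h2
    exact (le_mul_of_one_le_left hT.le h1).trans h2
  have hK : 0 ≤ K := by
    obtain ⟨k, hk⟩ := hF 1
    exact (norm_nonneg _).trans ((hψ 1 k hk).2.2 0)
  refine ⟨ψ, K, max B 1, max c 2, le_max_right _ _, hK, le_max_right _ _, ?_, ?_⟩
  · filter_upwards [hαT (2 * K + 1) (by positivity)] with n h
    linarith
  · filter_upwards [hσ1, hαT 1 one_pos, hσα.eventually_le_const one_pos,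
      hLyap.eventually_le_const one_pos, hc] with n h1 h2 h3 h4 h5
    have e1 : sigmaOutside ((C n).openProb (lam n)) (F n) = σ n := (hσ n).symm
    have e2 : lyapOutside ((C n).openProb (lam n)) (F n) r = L n := (hL n).symm
    refine ⟨hp n, hlawmom n, hF n, fun k hk θ => ?_, fun k hk => (hψ n k hk).2.1,
      fun k hk => (hψ n k hk).2.2, fun k hk => (hξ n k hk).1, (hρ n).1, (hρ n).2, hr.1, hr.2,
      le_max_right _ _, (hB n).trans (le_max_left _ _), hα n ▸ h2, e1.symm ▸ h1, ?_,
      e2.symm ▸ h4, ?_⟩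
    · have h6 := (hψ n k hk).1 θ
      rw [charSeries_eq_centeredChar _ ((C n).openMean (lam n) k)]
      change centeredChar ((C n).openProb (lam n) k) ((C n).openMean (lam n) k) θ = _ at h6
      rw [h6, ← mul_assoc, ← mul_assoc, ← Complex.exp_add, add_neg_cancel, Complex.exp_zero,
        one_mul]
    · rw [e1, ← hα]
      exact (div_le_one (hα0 n)).1 h3
    · rw [e1]
      change σ n ≤ max c 2 * (C n).gammaHat (lam n) (F n)
      have h6 : 0 ≤ (C n).gammaHat (lam n) (F n) := Real.sqrt_nonneg _
      rw [Real.norm_of_nonneg h6] at h5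
      exact (le_abs_self _).trans (h5.trans (mul_le_mul_of_nonneg_right (le_max_left _ _) h6))

end Sequences

end

/-! ### The theorem. -/

theorem mainTheorem5
    -- for each `n ≥ 1`, a closed network with `n` queues
    (C : ∀ n : ℕ+, ClosedNetwork n)
    -- the load `lam n` of the open network, whose mean number of clients is that of the closed one
    (lam : ℕ+ → ℝ) (hlam : ∀ n, 0 < lam n)
    (hmean : ∀ n, ∑ k, (C n).openMean (lam n) k = (C n).clients)
    -- the saturable queues
    (ρ : ℕ+ → ℝ) (hρ : ∀ n, 0 < ρ n ∧ ρ n < 1)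
    (F : ∀ n : ℕ+, Finset (Fin n)) (hF : ∀ n, (F n).Nonempty)
    (ξ : ∀ n : ℕ+, Fin n → ℝ) (hsat : SaturableQueues C lam ρ F ξ)
    -- finite moments
    (r : ℝ) (hr : 0 < r ∧ r ≤ 1)
    (hmom : ∀ n k, (C n).HasMoment (lam n) k 2)
    (hmom' : ∀ n, ∀ k ∉ F n, (C n).HasMoment (lam n) k (2 + r))
    -- abbreviations
    (Ξ α σ L ε : ℕ+ → ℝ)
    (hΞ : ∀ n, Ξ n = ∑ k ∈ F n, ξ n k)
    (hα : ∀ n, α n = heavyScale (ρ n))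
    (hσ : ∀ n, σ n = (C n).sigmaHat (lam n) (F n))
    (hL : ∀ n, L n = (C n).lyapHat (lam n) (F n) r)
    (hε : ∀ n, ε n = heavyError (α n) (σ n) (L n) r (Ξ n))
    -- heavy traffic conditions
    (hΞbdd : ∃ B : ℝ, ∀ n, Ξ n ≤ B)
    (hσpos : ∀ᶠ n in atTop, 0 < σ n)
    (hσα : Tendsto (fun n => σ n / α n) atTop (𝓝 0))
    (hLyap : Tendsto L atTop (𝓝 0))
    (hσγ : σ =O[atTop] fun n => (C n).gammaHat (lam n) (F n)) :
    -- joint law of all queues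
    (∃ K : ℝ, ∀ n : ℕ+, ∀ q : Fin n → ℕ, ∑ k, q k = (C n).clients →
      |(C n).closedProb q -
          α n * Real.Gamma (Ξ n) / (Real.exp (-Ξ n) * Ξ n ^ (Ξ n - 1)) *
            ∏ k, (C n).openProb (lam n) k (q k)| ≤
        K * ε n * (α n * Real.Gamma (Ξ n) / (Real.exp (-Ξ n) * Ξ n ^ (Ξ n - 1)) *
            ∏ k, (C n).openProb (lam n) k (q k))) ∧
    -- marginals of boundedly many non-saturated queues
    (∀ ℓ : ℕ, ∃ K : ℝ, ∀ n : ℕ+, ∀ A : Finset (Fin n), A.card ≤ ℓ → Disjoint A (F n) →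
      ∀ q : Fin n → ℕ,
        |(C n).closedMarginal A q - ∏ k ∈ A, (C n).openProb (lam n) k (q k)| ≤
          K * (ε n + |∑ k ∈ A, ((C n).openMean (lam n) k - q k)| / α n) *
            ∏ k ∈ A, (C n).openProb (lam n) k (q k)) ∧
    -- mean lengths of non-saturated queues
    (∃ K : ℝ, ∀ n : ℕ+, ∀ j ∉ F n,
      |(C n).closedMean j - (C n).openMean (lam n) j| ≤
        K * (ε n + ((C n).variance (lam n) j + (C n).openMean (lam n) j ^ 2) /
            ((C n).openMean (lam n) j * α n)) * (C n).openMean (lam n) j) ∧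
    -- mean lengths of saturated queues
    (∃ K : ℝ, ∀ n : ℕ+, ∀ j ∈ F n,
      |(C n).closedMean j - (C n).openMean (lam n) j| ≤
        K * ε n * (C n).openMean (lam n) j) := by
  obtain ⟨ψ, K, B, κ, hB, hK, hκ, hKα, hsys⟩ := exists_eventually_saturableSystem C lam hlam ρ hρ
    F hF ξ hsat r hr hmom hmom' α σ L hα hσ hL (by simpa only [hΞ] using hΞbdd) hσpos hσα hLyap hσγ
  have hp := fun n k => (hmom n k).isSqLaw (hlam n)
  have hα0 : ∀ n, 0 < α n := fun n => by
    rw [hα]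
    exact heavyScale_pos (hρ n).1 (hρ n).2
  have hσ0 : ∀ n, 0 ≤ σ n := fun n => by
    rw [hσ]
    exact Real.sqrt_nonneg _
  have hL0 : ∀ n, 0 ≤ L n := fun n => by
    rw [hL]
    exact lyapOutside_nonneg (F n) r (hp n)
  -- The term `1/α` keeps `ε` positive even when `σ = 0`, where `L` is `0` by division by zero; a
  -- network-dependent constant times `ε` can thus absorb any fixed error.
  have hε0 : ∀ n, 0 < ε n := fun n => by
    have h1 := hα0 n
    have h2 := hσ0 n
    have h3 := hL0 n
    rw [hε, heavyError]
    positivity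
  have hΞ0 : ∀ n, 0 < Ξ n := fun n => by
    rw [hΞ]
    exact Finset.sum_pos (fun k hk => one_pos.trans_le (hsat.2.choose_spec n k hk).1) (hF n)
  have hc0 : ∀ n, 0 < α n * Real.Gamma (Ξ n) / (Real.exp (-Ξ n) * Ξ n ^ (Ξ n - 1)) := fun n => by
    have h1 := hα0 n
    have h2 := Real.Gamma_pos_of_pos (hΞ0 n)
    have h3 := Real.rpow_pos_of_pos (hΞ0 n) (Ξ n - 1)
    positivity
  have hprod : ∀ (n : ℕ+) (A : Finset (Fin n)) (q : Fin n → ℕ),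
      0 ≤ ∏ k ∈ A, (C n).openProb (lam n) k (q k) :=
    fun n A q => Finset.prod_nonneg fun k _ => (hp n k).nonneg _
  have hm0 : ∀ n j, 0 ≤ (C n).openMean (lam n) j := fun n j => (hp n j).lawMean_nonneg
  have hℓ : ∀ ℓ : ℕ, ∀ᶠ n in atTop, ℓ * L n ^ (2 / (2 + r)) ≤ 3 / 4 := fun ℓ => by
    have he : 0 < 2 / (2 + r) := by
      have := hr.1
      positivity
    have h1 := (hLyap.rpow_const (Or.inr he.le)).const_mul (ℓ : ℝ)
    rw [Real.zero_rpow he.ne', mul_zero] at h1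
    exact h1.eventually_le_const (by norm_num)
  -- The omitted statement is the conjunction of the three estimates of
  -- `exists_closedNetwork_bounds`; how large `n` must be depends on `ℓ`.
  have key : ∀ ℓ : ℕ, ∃ M, ∀ᶠ n in atTop, _ := fun ℓ => by
    obtain ⟨M, δ, -, hδ, h⟩ := exists_closedNetwork_bounds hB hK hr.1 hκ ℓ
    refine ⟨M, ?_⟩
    filter_upwards [hKα, hsys, hℓ ℓ, hσα.eventually_le_const hδ, hLyap.eventually_le_const hδ]
      with n h1 h2 h3 h4 h5
    exact h (hlam n) (hmom n) (hmean n) h2 (hΞ n) (hα n) (hσ n) (hL n) (hε n) h3 h1 h4 h5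
  have crude := fun n => (C n).exists_crude_bounds (hlam n) (hmom n) (hε0 n) (hc0 n)
  have marginal : ∀ ℓ : ℕ, ∃ K : ℝ, ∀ n : ℕ+, ∀ A : Finset (Fin n), A.card ≤ ℓ →
      Disjoint A (F n) → ∀ q : Fin n → ℕ,
        |(C n).closedMarginal A q - ∏ k ∈ A, (C n).openProb (lam n) k (q k)| ≤
          K * (ε n + |∑ k ∈ A, ((C n).openMean (lam n) k - q k)| / α n) *
            ∏ k ∈ A, (C n).openProb (lam n) k (q k) := fun ℓ => by
    refine PNat.exists_forall_of_eventually (fun n M M' hM h A hA hAF q => ?_) ?_ fun n => ?_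
    · have h1 := hα0 n
      have h2 := hε0 n
      refine (h A hA hAF q).trans (mul_le_mul_of_nonneg_right ?_ (hprod n A q))
      gcongr
    · obtain ⟨M, hM⟩ := key ℓ
      exact ⟨M, hM.mono fun n h => h.2.1⟩
    · obtain ⟨M, hM, -, h, -⟩ := crude n
      refine ⟨M, fun A _ _ q => (h A q).trans (mul_le_mul_of_nonneg_right ?_ (hprod n A q))⟩
      have h1 := hα0 n
      gcongr
      exact le_add_of_nonneg_right (by positivity)
  refine ⟨?_, marginal, ?_, ?_⟩
  · refine PNat.exists_forall_of_eventually (fun n M M' hM h q hq => ?_) ?_ fun n => ?_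
    · have h2 := hε0 n
      refine (h q hq).trans (mul_le_mul_of_nonneg_right ?_
        (mul_nonneg (hc0 n).le (hprod n _ q)))
      gcongr
    · obtain ⟨M, hM⟩ := key 0
      exact ⟨M, hM.mono fun n h => h.1⟩
    · obtain ⟨M, -, h, -⟩ := crude n
      exact ⟨M, h⟩
  -- The case of one queue holds for every `n`, so (iii) needs no separate treatment of small `n`.
  · obtain ⟨M, hM⟩ := marginal 1
    refine ⟨3 / 2 * |M|, fun n j hj => (C n).closedMean_le_of_closedMarginal_le (hlam n) (hmom n)
      (abs_nonneg M) (hα0 n) (hε0 n).le fun x => ?_⟩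
    have h := hM n {j} (by simp) (by simpa using hj) fun _ => x
    rw [Finset.prod_singleton, Finset.sum_singleton] at h
    have h1 := hα0 n
    have h2 := hε0 n
    refine h.trans (mul_le_mul_of_nonneg_right ?_ ((hp n j).nonneg x))
    gcongr
    exact le_abs_self M
  · refine PNat.exists_forall_of_eventually (fun n M M' hM h j hj => ?_) ?_ fun n => ?_
    · have h2 := hε0 n
      refine (h j hj).trans (mul_le_mul_of_nonneg_right ?_ (hm0 n j))
      gcongr
    · obtain ⟨M, hM⟩ := key 0
      exact ⟨M, hM.mono fun n h => h.2.2⟩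
    · obtain ⟨M, -, -, -, h⟩ := crude n
      exact ⟨M, fun j _ => h j⟩
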